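/- Let $G=(V,E)$ be an infinite, locally finite, connected, vertex-transitive simple graph, let $\Gamma=\mathrm{Aut}(G)$ be its automorphism group, and let $p_n(x,y)=P_x(X(n)=y)$ denote the transition probabilities of simple random walk on $G$. For a countable set $S$ let $\mathcal M(S)$ be the set of point measures $\omega=\sum_{i\in I}\delta_{s_i}$ on $S$ ($I$ finite or countable) with $\omega(\{s\})<\infty$ for every $s\in S$, with the $\sigma$-algebra generated by the evaluations $\omega\mapsto\omega(A)$, $A\subseteq S$. For $\omega=\sum_i\delta_{(x_i,y_i)}\in\mathcal M(V\times V)$ put $\mathbf p_1(\omega)=\sum_i\delta_{x_i}$ and $\mathbf p_2(\omega)=\sum_i\delta_{y_i}$. The group $\Gamma$ acts on $\mathcal M(V)$ by $\varphi(\sum_i\delta_{x_i})=\sum_i\delta_{\varphi(x_i)}$, on $\mathcal M(V\times V)$ by $\varphi(\sum_i\delta_{(x_i,y_i)})=\sum_i\delta_{(\varphi(x_i),\varphi(y_i))}$, and on families $\underline\eta=(\eta_x)_{x\in V}$ by $\varphi(\underline\eta)=(\eta_{\varphi^{-1}(x)})_{x\in V}$. **Lemma (Partial matching of i.i.d. PPPs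 on $V$).** Let $\alpha\in[0,\infty)$ and $L\in\mathbb N=\{0,1,2,\dots\}$. There exist a probability space $(\hat\Omega,\hat{\mathcal A},\hat\pi)$ and a measurable map $$\Psi:\ \mathcal M(V)\times\mathcal M(V)\times\hat\Omega^V\to\mathcal M(V\times V)$$ such that: 1. for all $\varphi\in\Gamma$, $\omega_1,\omega_2\in\mathcal M(V)$ and $\underline\eta\in\hat\Omega^V$, $\ \Psi(\varphi(\omega_1),\varphi(\omega_2),\varphi(\underline\eta))=\varphi(\Psi(\omega_1,\omega_2,\underline\eta))$; 2. for all $\omega_1,\omega_2\in\mathcal M(V)$ and $\underline\eta\in\hat\Omega^V$, $\ \mathbf p_1(\Psi(\omega_1,\omega_2,\underline\eta))=\omega_1$; 3. whenever $\mathcal R_1,\mathcal R_2$ are independent Poisson point processes on $V$, each with intensity measure $\alpha$ times the counting measure, and $\underline{\hat\eta}=(\hat\eta_x)_{x\in V}$ is an i.i.d. family with distribution $\hat\pi$ that is independent of $(\mathcal R_1,\mathcal R_2)$, the point process $\mathcal R:=\Psi(\mathcal R_1,\mathcal R_2,\underline{\hat\eta})$ is a Poisson point process on $V\times V$ with intensity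 measure $\nu^{(2)}(\{(x,y)\})=\alpha\,p_L(x,y)$, and for every vertex $o\in V$ $$\mathbb E\big[(\mathcal R_2(\{o\})-\mathbf p_2(\mathcal R)(\{o\}))_+\big]\le\sqrt{2\alpha\,p_{2L}(o,o)},\qquad \mathbb E\big[(\mathbf p_2(\mathcal R)(\{o\})-\mathcal R_2(\{o\}))_+\big]\le\sqrt{2\alpha\,p_{2L}(o,o)}.$$ -/

import Mathlib

open MeasureTheory ProbabilityTheory
open scoped ENNReal NNReal

noncomputable section

/-- A point measure: a measure of the form `∑ i ∈ I, δ_{s i}` with `I` finite or countably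
infinite (points may be repeated, `I` may be empty). -/
def IsPointMeasure {S : Type*} [MeasurableSpace S] (ω : Measure S) : Prop :=
  ∃ (I : Type) (_ : Countable I) (s : I → S), ω = Measure.sum fun i => Measure.dirac (s i)

/-- The space of locally finite point measures on a (countable) set `S`: point measures giving
finite mass to every singleton. As a subtype of `Measure S` it carries the sigma-algebra
generated by the evaluations `ω ↦ ω A`, with `A` measurable. -/
abbrev LocFinPointMeasure (S : Type*) [MeasurableSpace S] : Type _ :=
  {ω : Measure S // IsPointMeasure ω ∧ ∀ s : S, ω {s} < ∞}

/-- The image `∑ i, δ_{e (s i)}` of `ω = ∑ i, δ_{s i}` under a bijection `e` which is measurable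
in both directions. -/
def LocFinPointMeasure.image {S T : Type*} [MeasurableSpace S] [MeasurableSpace T]
    (e : S ≃ᵐ T) (ω : LocFinPointMeasure S) : LocFinPointMeasure T :=
  ⟨Measure.map e ω.1, by
    obtain ⟨ω, ⟨I, hI, s, rfl⟩, hfin⟩ := ω
    refine ⟨⟨I, hI, fun i => e (s i), ?_⟩, fun t => ?_⟩
    · rw [Measure.map_sum e.measurable.aemeasurable]
      congr 1
      ext1 i
      exact Measure.map_dirac' e.measurable _
    · rw [e.map_apply]
      have h : e ⁻¹' {t} = {e.symm t} := by
        ext x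
        simp only [Set.mem_preimage, Set.mem_singleton_iff]
        exact e.toEquiv.eq_symm_apply.symm
      rw [h]
      exact hfin _⟩

/-- `X` is a Poisson point process with (sigma-finite) intensity measure `ν` under `P`: it is a
random locally finite point measure, the number of points in a set `A` of finite intensity is
Poisson with parameter `ν A`, and the numbers of points in disjoint sets are independent. -/
structure IsPoissonPointProcess {Ω S : Type*} [MeasurableSpace Ω] [MeasurableSpace S]
    (P : Measure Ω) (X : Ω → LocFinPointMeasure S) (ν : Measure S) : Prop where
  measurable : Measurable X
  map_eq_poisson : ∀ A : Set S, MeasurableSet A → ν A ≠ ∞ →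
    P.map (fun w => (X w).1 A) =
      (poissonMeasure (ν A).toNNReal).map (fun k : ℕ => (k : ℝ≥0∞))
  indep : ∀ (n : ℕ) (A : Fin n → Set S), (∀ i, MeasurableSet (A i)) →
    (∀ i j, i ≠ j → Disjoint (A i) (A j)) →
    iIndepFun (fun i w => (X w).1 (A i)) P

section Graph

variable {V : Type*} (G : SimpleGraph V)

/-- The law of one step of simple random walk from `x`: a uniformly chosen neighbour of `x`
(the walk stays put at an isolated vertex). -/
def srwStep [G.LocallyFinite] (x : V) : PMF V :=
  if h : (G.neighborFinset x).Nonempty then PMF.uniformOfFinset (G.neighborFinset x) h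
  else PMF.pure x

/-- The law of the position `X n` at time `n` of simple random walk started at `X 0 = x`. -/
def srwLaw [G.LocallyFinite] (x : V) : ℕ → PMF V
  | 0 => PMF.pure x
  | n + 1 => (srwLaw x n).bind (srwStep G)

/-- The transition probability `p_n(x, y) = P_x (X n = y)`. -/
def srwProb [G.LocallyFinite] (n : ℕ) (x y : V) : ℝ := (srwLaw G x n y).toReal

/-- The measure on `V × V` giving mass `α * p_L(x, y)` to the pair `(x, y)`. -/
def pairIntensity [G.LocallyFinite] [MeasurableSpace V] (α : ℝ≥0) (L : ℕ) : Measure (V × V) :=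
  Measure.sum fun z : V × V =>
    ENNReal.ofReal (α * srwProb G L z.1 z.2) • Measure.dirac z

/-- Vertex transitivity. -/
def IsVertexTransitive : Prop := ∀ x y : V, ∃ φ : G ≃g G, φ x = y

variable {G} in
/-- A graph automorphism as a measurable bijection of the (discrete) vertex set. -/
def autMeasurableEquiv [MeasurableSpace V] [DiscreteMeasurableSpace V] (φ : G ≃g G) : V ≃ᵐ V where
  toEquiv := φ.toEquiv
  measurable_toFun := Measurable.of_discrete
  measurable_invFun := Measurable.of_discrete

variable {G} in
/-- The action of an automorphism on point measures on `V`. -/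
def autActV [MeasurableSpace V] [DiscreteMeasurableSpace V] (φ : G ≃g G)
    (ω : LocFinPointMeasure V) : LocFinPointMeasure V :=
  ω.image (autMeasurableEquiv φ)

variable {G} in
/-- The diagonal action of an automorphism on point measures on `V × V`. -/
def autActVV [MeasurableSpace V] [DiscreteMeasurableSpace V] (φ : G ≃g G)
    (ω : LocFinPointMeasure (V × V)) : LocFinPointMeasure (V × V) :=
  ω.image ((autMeasurableEquiv φ).prodCongr (autMeasurableEquiv φ))

variable {G} in
/-- The action of an automorphism on families indexed by vertices:
`(φ η) x = η (φ⁻¹ x)`. -/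
def autActFamily {Ω' : Type*} (φ : G ≃g G) (η : V → Ω') : V → Ω' :=
  fun x => η (φ.symm x)

end Graph

/-- The projection `∑ i, δ_{(x i, y i)} ↦ ∑ i, δ_{x i}`; the result need not be locally finite,
so it is a measure. -/
def projFst {V : Type*} [MeasurableSpace V] (ω : LocFinPointMeasure (V × V)) : Measure V :=
  Measure.map Prod.fst ω.1

/-- The projection `∑ i, δ_{(x i, y i)} ↦ ∑ i, δ_{y i}`; the result need not be locally finite,
so it is a measure. -/
def projSnd {V : Type*} [MeasurableSpace V] (ω : LocFinPointMeasure (V × V)) : Measure V :=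
  Measure.map Prod.snd ω.1

end

/-! The coupling is a soft local time construction. Picture the points of `R₂` at `y` as a Poisson
process on the heights [0, α] above `y`, continued by virtual points at larger heights. A particle
at `x` raises the curve ξ·p_L(x,·) over the heights already used, until it meets a point. Then ξ is
Exp(1), the site of that point has law p_L(x,·), the two are independent, and what lies above the
new curve is again Poisson. So the particles of `R₁` are displaced independently with law p_L, which
makes the pairs a Poisson process of intensity α p_L, while each point of `R₂` below the final curve
has been matched.

If S_x is the total time used at `x`, the points left at `o` have conditional mean (α - ∑ S_x
p_L(x,o))⁺. The S_x are independent sums of a Poisson(α) number of exponentials, with mean α and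
variance 2α. By transitivity the walk is symmetric, so ∑ p_L(x,o) = 1 and ∑ p_L(x,o)² = p_{2L}(o,o).
A centred variable has mean positive part at most half its standard deviation, which gives c/2 with
c = √(2α p_{2L}(o,o)). The second estimate follows from the first because both processes have mean α
at `o`.

The obstacle is equivariance: no order on the vertices is invariant. Each vertex draws a label in
{0,…,M}, vertices of equal label act in the same round, and `x` may use the points at `y` only if it
owns `y`, being the only vertex of its label that reaches `y`. The mass lost at `o` has mean at most
α(d+1)/(M+1), where d+1 is the size of the support of p_L(x,·); for large M this fits into the
remaining c/2. Uniform positions enumerate the supports equivariantly, so that all sampling takes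
place on `Fin (d + 1)`.

Heights are not part of the data, only counts are. The joint law of initial points, displacements,
time and remaining points is therefore built backwards, adding each found point to what remains
(`coupling`). Its first marginal is Poisson because of a product-rule identity
(`lintegral_exp_mul_poissonWeight`), and disintegration over the initial points gives a measurable
sampler (`exists_sampler`). For finitely many acting vertices the global law follows by peeling off
a vertex of maximal label (`lintegral_result_state`); locality extends it to the whole graph
(`map_result`, `lintegral_state`). -/

noncomputable section

set_option linter.unusedSectionVars false

/-! ### Independent Poisson families as a kernel in their parameters -/

section PoissonField

/-- The law of a family of independent Poisson variables with parameters `(b i)⁺`. -/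
def poissonField {ι : Type*} (b : ι → ℝ) : Measure (ι → ℕ) :=
  Measure.infinitePi fun i => poissonMeasure (b i).toNNReal

instance {ι : Type*} (b : ι → ℝ) : IsProbabilityMeasure (poissonField b) := by
  unfold poissonField; infer_instance

lemma measurable_poissonMeasure_toNNReal :
    Measurable fun c : ℝ => poissonMeasure c.toNNReal := by
  refine Measure.measurable_of_measurable_coe _ fun s hs => ?_
  have h : ∀ c : ℝ, poissonMeasure c.toNNReal s =
      ∑' n : s, ENNReal.ofReal (Real.exp (-c.toNNReal) * c.toNNReal ^ (n : ℕ) / (n : ℕ).factorial) := by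
    intro c
    rw [← Measure.tsum_indicator_apply_singleton _ _ hs, ← tsum_subtype s]
    simp [poissonMeasure_singleton]
  simp_rw [h]
  refine Measurable.tsum fun n => ?_
  fun_prop

/-- Boxes over finite sets of coordinates form a generating pi-system. -/
lemma measurable_infinitePi {A ι : Type*} [MeasurableSpace A] {X : ι → Type*}
    [∀ i, MeasurableSpace (X i)] {μ : A → (i : ι) → Measure (X i)}
    [∀ a i, IsProbabilityMeasure (μ a i)] (h : ∀ i, Measurable fun a => μ a i) :
    Measurable fun a => Measure.infinitePi (μ a) := by
  refine Measurable.measure_of_isPiSystem_of_isProbabilityMeasure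
    generateFrom_measurableCylinders.symm isPiSystem_measurableCylinders ?_
  intro s hs
  obtain ⟨I, S, hS, rfl⟩ := (mem_measurableCylinders _).1 hs
  simp_rw [Measure.infinitePi_cylinder _ hS]
  have : Measurable fun a => Measure.pi fun i : I => μ a i := by
    refine Measurable.measure_of_isPiSystem_of_isProbabilityMeasure
      generateFrom_pi.symm isPiSystem_pi ?_
    rintro _ ⟨t, ht, rfl⟩
    simp_rw [Measure.pi_pi]
    refine Finset.measurable_prod _ fun i _ => ?_
    exact (Measure.measurable_coe (ht i (Set.mem_univ _))).comp (h i)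
  exact (Measure.measurable_coe hS).comp this

lemma measurable_poissonField {ι : Type*} :
    Measurable fun b : ι → ℝ => poissonField b :=
  measurable_infinitePi fun i => measurable_poissonMeasure_toNNReal.comp (measurable_pi_apply i)

/-- The law of independent Poisson variables, as a kernel in the vector of parameters. -/
def poissonFieldKernel (ι : Type*) : Kernel (ι → ℝ) (ι → ℕ) :=
  ⟨fun b => poissonField b, measurable_poissonField⟩

instance {ι : Type*} : IsMarkovKernel (poissonFieldKernel ι) :=
  ⟨fun b => inferInstanceAs (IsProbabilityMeasure (poissonField b))⟩

lemma poissonFieldKernel_apply {ι : Type*} (b : ι → ℝ) :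
    poissonFieldKernel ι b = poissonField b := rfl

end PoissonField

/-! ### The product-rule identity behind one exponential step -/

section ExponentialStep

/-- The Poisson weight `e^{-c⁺} (c⁺)^n / n!` as a function of a real parameter. -/
def poissonWeight (c : ℝ) (n : ℕ) : ℝ :=
  Real.exp (-max c 0) * max c 0 ^ n / n.factorial

/-- The weight of `n` after a point has been removed, as long as the parameter is positive. -/
def poissonWeightPred (c : ℝ) (n : ℕ) : ℝ :=
  if 0 < c then (if n = 0 then 0 else poissonWeight c (n - 1)) else poissonWeight c n

lemma poissonMeasure_toNNReal_singleton (c : ℝ) (n : ℕ) :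
    poissonMeasure c.toNNReal {n} = ENNReal.ofReal (poissonWeight c n) := by
  rw [poissonMeasure_singleton, poissonWeight, Real.coe_toNNReal']

lemma poissonWeight_nonneg (c : ℝ) (n : ℕ) : 0 ≤ poissonWeight c n := by
  unfold poissonWeight; positivity

lemma poissonWeightPred_nonneg (c : ℝ) (n : ℕ) : 0 ≤ poissonWeightPred c n := by
  unfold poissonWeightPred
  split_ifs <;> simp [poissonWeight_nonneg]

lemma poissonWeight_le_one (c : ℝ) (n : ℕ) : poissonWeight c n ≤ 1 := by
  have : poissonMeasure c.toNNReal {n} ≤ 1 := prob_le_one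
  rw [poissonMeasure_toNNReal_singleton] at this
  simpa using this

lemma continuous_poissonWeight (n : ℕ) : Continuous fun c => poissonWeight c n := by
  unfold poissonWeight; fun_prop

/-- The weight has a kink where the parameter reaches zero, so only a right derivative is available.
Past that point the budget is exhausted and the weight stays constant, which is why
`poissonWeightPred` equals `poissonWeight` there: a point met beyond the budget is virtual and
changes no count. -/
lemma hasDerivWithinAt_poissonWeight (b p : ℝ) (hp : 0 ≤ p) (n : ℕ) (t : ℝ) :
    HasDerivWithinAt (fun s => poissonWeight (b - s * p) n)
      (p * (poissonWeight (b - t * p) n - poissonWeightPred (b - t * p) n)) (Set.Ioi t) t := by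
  rcases lt_or_ge 0 (b - t * p) with hc | hc
  · have hlin : HasDerivAt (fun s : ℝ => b - s * p) (-p) t := by
      simpa using ((hasDerivAt_id t).mul_const p).const_sub b
    have h1 : HasDerivAt (fun s : ℝ => Real.exp (-(b - s * p)) * (b - s * p) ^ n / n.factorial)
        (p * (poissonWeight (b - t * p) n - poissonWeightPred (b - t * p) n)) t := by
      have h2 := ((hlin.neg.exp).mul (hlin.pow n)).div_const (n.factorial : ℝ)
      refine h2.congr_deriv ?_
      simp only [poissonWeight, poissonWeightPred, hc, if_true, max_eq_left hc.le]
      rcases n with _ | n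
      · simp
        ring
      · simp only [Nat.add_sub_cancel, Nat.factorial_succ, Nat.succ_ne_zero, if_false]
        have : ((n.factorial : ℕ) : ℝ) ≠ 0 := by positivity
        have h' : ((n : ℝ) + 1) ≠ 0 := by positivity
        push_cast
        simp only [Pi.neg_apply, Pi.pow_apply]
        field_simp
        ring
    have hev : (fun s => poissonWeight (b - s * p) n) =ᶠ[nhds t]
        fun s : ℝ => Real.exp (-(b - s * p)) * (b - s * p) ^ n / n.factorial := by
      have : ∀ᶠ s in nhds t, 0 < b - s * p :=
        (by fun_prop : ContinuousAt (fun s : ℝ => b - s * p) t).eventually (lt_mem_nhds hc)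
      filter_upwards [this] with s hs
      simp [poissonWeight, max_eq_left hs.le]
    exact (h1.congr_of_eventuallyEq hev).hasDerivWithinAt
  · have h0 : p * (poissonWeight (b - t * p) n - poissonWeightPred (b - t * p) n) = 0 := by
      simp [poissonWeightPred, not_lt.2 hc]
    rw [h0]
    refine (hasDerivWithinAt_const t (Set.Ioi t) (poissonWeight (b - t * p) n)).congr ?_ rfl
    intro s hs
    have : b - s * p ≤ 0 := by
      have := mul_le_mul_of_nonneg_right (le_of_lt (Set.mem_Ioi.1 hs)) hp
      linarith
    simp [poissonWeight, max_eq_right this, max_eq_right hc]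

variable {ι : Type*} [Fintype ι] [DecidableEq ι]

/-- Independent exponential clocks: fundamental theorem of calculus for the product weight. -/
lemma lintegral_exp_mul_poissonWeight (p : ι → ℝ) (hp : ∀ i, 0 ≤ p i) (hp1 : ∑ i, p i = 1)
    (b : ι → ℝ) (n : ι → ℕ) :
    ∫⁻ t in Set.Ioi (0 : ℝ), ENNReal.ofReal (Real.exp (-t) * ∑ y, p y *
        (poissonWeightPred (b y - t * p y) (n y) *
          ∏ j ∈ Finset.univ.erase y, poissonWeight (b j - t * p j) (n j))) =
      ENNReal.ofReal (∏ j, poissonWeight (b j) (n j)) := by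
  set g : ℝ → ℝ := fun t => Real.exp (-t) * ∑ y, p y *
        (poissonWeightPred (b y - t * p y) (n y) *
          ∏ j ∈ Finset.univ.erase y, poissonWeight (b j - t * p j) (n j)) with hg
  set f : ℝ → ℝ := fun t => -(Real.exp (-t) * ∏ j, poissonWeight (b j - t * p j) (n j)) with hf
  have hg0 : ∀ t, 0 ≤ g t := fun t => by
    refine mul_nonneg (Real.exp_pos _).le (Finset.sum_nonneg fun y _ => mul_nonneg (hp y)
      (mul_nonneg (poissonWeightPred_nonneg _ _) (Finset.prod_nonneg fun _ _ =>
        poissonWeight_nonneg _ _)))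
  have hcont : Continuous f := by
    have : ∀ j, Continuous fun t : ℝ => poissonWeight (b j - t * p j) (n j) := fun j =>
      (continuous_poissonWeight (n j)).comp (by fun_prop)
    fun_prop
  have hder : ∀ t, HasDerivWithinAt f (g t) (Set.Ioi t) t := by
    intro t
    have h1 : HasDerivWithinAt (fun s : ℝ => Real.exp (-s)) (-Real.exp (-t)) (Set.Ioi t) t := by
      simpa using ((hasDerivAt_id t).neg.exp).hasDerivWithinAt
    have h2 := HasDerivWithinAt.fun_finsetProd (u := Finset.univ)
      (f := fun j (s : ℝ) => poissonWeight (b j - s * p j) (n j))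
      (fun j _ => hasDerivWithinAt_poissonWeight (b j) (p j) (hp j) (n j) t)
    refine (h1.mul h2).neg.congr_deriv ?_
    simp only [hg, smul_eq_mul]
    have h3 : ∀ y, (∏ j ∈ Finset.univ.erase y, poissonWeight (b j - t * p j) (n j)) *
        (p y * (poissonWeight (b y - t * p y) (n y) - poissonWeightPred (b y - t * p y) (n y))) =
        p y * ∏ j, poissonWeight (b j - t * p j) (n j) -
          p y * (poissonWeightPred (b y - t * p y) (n y) *
          ∏ j ∈ Finset.univ.erase y, poissonWeight (b j - t * p j) (n j)) := by
      intro y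
      rw [← Finset.mul_prod_erase Finset.univ _ (Finset.mem_univ y)]
      ring
    simp_rw [h3]
    -- Since the rates sum to one, the undiminished terms of the product rule cancel against the
    -- derivative of `exp (-t)`; only the terms with one point removed survive.
    rw [Finset.sum_sub_distrib, ← Finset.sum_mul, hp1]
    ring
  have hfin : ∀ k : ℕ, ∫⁻ t in Set.Ioc (0 : ℝ) k, ENNReal.ofReal (g t) =
      ENNReal.ofReal (f k - f 0) := by
    intro k
    have hint : IntegrableOn g (Set.Ioc 0 (k : ℝ)) :=
      intervalIntegral.integrableOn_deriv_right_of_nonneg hcont.continuousOn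
        (fun x _ => hder x) (fun x _ => hg0 x)
    rw [← ofReal_integral_eq_lintegral_ofReal hint (Filter.Eventually.of_forall hg0),
      ← intervalIntegral.integral_of_le (Nat.cast_nonneg k),
      intervalIntegral.integral_eq_sub_of_hasDeriv_right_of_le (Nat.cast_nonneg k)
        hcont.continuousOn (fun x _ => hder x)
        ((intervalIntegrable_iff_integrableOn_Ioc_of_le (Nat.cast_nonneg k)).2 hint)]
  have hU : Set.Ioi (0 : ℝ) = ⋃ k : ℕ, Set.Ioc (0 : ℝ) k := by
    ext t
    simp only [Set.mem_Ioi, Set.mem_iUnion, Set.mem_Ioc]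
    exact ⟨fun h => (exists_nat_ge t).imp fun k hk => ⟨h, hk⟩, fun ⟨k, h, _⟩ => h⟩
  have hmono : Monotone fun k : ℕ => Set.Ioc (0 : ℝ) k := fun a c hac =>
    Set.Ioc_subset_Ioc_right (Nat.cast_le.2 hac)
  have hmono' : Monotone fun k : ℕ => ENNReal.ofReal (f k - f 0) := by
    intro a c hac
    change ENNReal.ofReal (f a - f 0) ≤ ENNReal.ofReal (f c - f 0)
    rw [← hfin, ← hfin]
    exact lintegral_mono_set (hmono hac)
  rw [hU, setLIntegral_iUnion_of_directed _ (directed_of_isDirected_le hmono)]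
  change ⨆ k : ℕ, ∫⁻ t in Set.Ioc (0 : ℝ) k, ENNReal.ofReal (g t) = _
  simp_rw [hfin]
  refine tendsto_nhds_unique (tendsto_atTop_iSup hmono') ?_
  -- At infinity the primitive vanishes because the weights are at most one, so the integral is `-f
  -- 0`, the product weight with the full budget.
  have hlim : Filter.Tendsto (fun k : ℕ => f k - f 0) Filter.atTop (nhds (0 - f 0)) := by
    refine Filter.Tendsto.sub_const ?_ _
    refine squeeze_zero_norm (a := fun k : ℕ => Real.exp (-(k : ℝ))) (fun k => ?_) ?_
    · simp only [hf, norm_neg, norm_mul, Real.norm_eq_abs, abs_of_pos (Real.exp_pos _)]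
      refine mul_le_of_le_one_right (Real.exp_pos _).le ?_
      rw [abs_of_nonneg (Finset.prod_nonneg fun _ _ => poissonWeight_nonneg _ _)]
      exact Finset.prod_le_one (fun _ _ => poissonWeight_nonneg _ _)
        fun _ _ => poissonWeight_le_one _ _
    · exact Real.tendsto_exp_neg_atTop_nhds_zero.comp tendsto_natCast_atTop_atTop
  have := ENNReal.tendsto_ofReal hlim
  simpa [hf] using this

end ExponentialStep

/-! ### One particle: remaining points plus the found point form the initial field -/

section StepLaw

lemma lintegral_expMeasure_one {h : ℝ → ℝ≥0∞} (hh : Measurable h) :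
    ∫⁻ t, h t ∂(expMeasure 1) =
      ∫⁻ t in Set.Ioi (0 : ℝ), ENNReal.ofReal (Real.exp (-t)) * h t := by
  have h0 : Measurable (gammaPDF 1 1) := (measurable_gammaPDFReal 1 1).ennreal_ofReal
  rw [expMeasure, gammaMeasure, lintegral_withDensity_eq_lintegral_mul _ h0 hh,
    ← lintegral_indicator measurableSet_Ioi]
  refine lintegral_congr_ae ?_
  filter_upwards [compl_mem_ae_iff.2 (measure_singleton (μ := volume) (0 : ℝ))] with t ht
  have ht : t ≠ 0 := ht
  rcases lt_or_gt_of_ne ht with h1 | h1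
  · rw [Set.indicator_of_notMem (by simpa using h1.le)]
    simp [gammaPDF_of_neg h1]
  · rw [Set.indicator_of_mem (by simpa using h1)]
    simp [gammaPDF_of_nonneg h1.le]

instance : IsProbabilityMeasure (expMeasure 1) := isProbabilityMeasure_expMeasure one_pos

variable {ι : Type*} [Fintype ι]

/-- The measure giving mass `p i` to `i`. -/
def pickMeasure [MeasurableSpace ι] (p : ι → ℝ) : Measure ι :=
  ∑ i, ENNReal.ofReal (p i) • Measure.dirac i

lemma lintegral_pickMeasure [MeasurableSpace ι] [DiscreteMeasurableSpace ι]
    (p : ι → ℝ) (h : ι → ℝ≥0∞) :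
    ∫⁻ i, h i ∂(pickMeasure p) = ∑ i, ENNReal.ofReal (p i) * h i := by
  simp [pickMeasure]

lemma isProbabilityMeasure_pickMeasure [MeasurableSpace ι]
    {p : ι → ℝ} (hp : ∀ i, 0 ≤ p i) (hp1 : ∑ i, p i = 1) :
    IsProbabilityMeasure (pickMeasure p) :=
  ⟨by simp [pickMeasure, ← ENNReal.ofReal_sum_of_nonneg fun i _ => hp i, hp1]⟩

lemma poissonField_singleton (b : ι → ℝ) (n : ι → ℕ) :
    poissonField b {n} = ENNReal.ofReal (∏ j, poissonWeight (b j) (n j)) := by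
  rw [poissonField, Measure.infinitePi_singleton_of_fintype,
    ENNReal.ofReal_prod_of_nonneg fun _ _ => poissonWeight_nonneg _ _]
  simp_rw [poissonMeasure_toNNReal_singleton]

variable [DecidableEq ι]

/-- The point discovered at time `ξ` at site `y` with rate `p y` and budget `b y`, if any. -/
def foundPoint (p b : ι → ℝ) (y : ι) (ξ : ℝ) : ι → ℕ :=
  if 0 < b y - ξ * p y then Pi.single y 1 else 0

/-- Adding the found point is injective, so `n` has at most one preimage: none if a point is found
at an empty site, otherwise `n` with that point removed. Independence of the sites then gives the
product. -/
lemma poissonField_preimage_add_foundPoint (p b : ι → ℝ) (n : ι → ℕ) (y : ι) (ξ : ℝ) :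
    poissonField (fun j => b j - ξ * p j) {r | r + foundPoint p b y ξ = n} =
      ENNReal.ofReal (poissonWeightPred (b y - ξ * p y) (n y) *
          ∏ j ∈ Finset.univ.erase y, poissonWeight (b j - ξ * p j) (n j)) := by
  unfold foundPoint poissonWeightPred
  split_ifs with hc hn
  · have : {r : ι → ℕ | r + Pi.single y 1 = n} = ∅ := by
      ext r
      simp only [Set.mem_ofPred_eq, Set.mem_empty_iff_false, iff_false]
      intro h
      have := congrFun h y
      simp [hn] at this
    rw [this]
    simp
  · have : {r : ι → ℕ | r + Pi.single y 1 = n} = {n - Pi.single y 1} := by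
      ext r
      simp only [Set.mem_ofPred_eq, Set.mem_singleton_iff]
      constructor
      · rintro rfl
        simp
      · rintro rfl
        ext j
        by_cases hj : j = y
        · subst hj
          simp
          omega
        · simp [hj]
    rw [this, poissonField_singleton, ← Finset.mul_prod_erase Finset.univ _ (Finset.mem_univ y)]
    congr 2
    · simp
    · refine Finset.prod_congr rfl fun j hj => ?_
      simp [Finset.ne_of_mem_erase hj]
  · have : {r : ι → ℕ | r + 0 = n} = {n} := by ext; simp
    rw [this, poissonField_singleton, ← Finset.mul_prod_erase Finset.univ _ (Finset.mem_univ y)]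

/-- One step of the soft local time construction preserves the Poisson field. -/
lemma lintegral_step_poissonField [MeasurableSpace ι] [DiscreteMeasurableSpace ι]
    {p : ι → ℝ} (hp : ∀ i, 0 ≤ p i) (hp1 : ∑ i, p i = 1)
    (b : ι → ℝ) (F : (ι → ℕ) → ℝ≥0∞) :
    ∫⁻ y, ∫⁻ ξ, ∫⁻ r, F (r + foundPoint p b y ξ) ∂(poissonField fun j => b j - ξ * p j)
      ∂(expMeasure 1) ∂(pickMeasure p) = ∫⁻ r, F r ∂(poissonField b) := by
  have hcount : ∀ (μ : Measure (ι → ℕ)) (G : (ι → ℕ) → (ι → ℕ)),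
      ∫⁻ r, F (G r) ∂μ = ∑' n, F n * μ {r | G r = n} := by
    intro μ G
    have hG : Measurable G := measurable_of_countable _
    rw [← lintegral_map (f := F) (measurable_of_countable _) hG, lintegral_countable']
    refine tsum_congr fun n => ?_
    rw [Measure.map_apply hG (measurableSet_singleton n)]
    rfl
  have hmeas : ∀ (n : ι → ℕ) (y : ι), Measurable fun ξ : ℝ =>
      ENNReal.ofReal (poissonWeightPred (b y - ξ * p y) (n y) *
          ∏ j ∈ Finset.univ.erase y, poissonWeight (b j - ξ * p j) (n j)) := by
    intro n y
    have h1 : Measurable fun c : ℝ => poissonWeightPred c (n y) := by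
      unfold poissonWeightPred
      refine Measurable.ite measurableSet_Ioi ?_ (continuous_poissonWeight _).measurable
      split_ifs
      · exact measurable_const
      · exact (continuous_poissonWeight _).measurable
    have h2 : ∀ j, Measurable fun c : ℝ => poissonWeight c (n j) := fun j =>
      (continuous_poissonWeight _).measurable
    refine ENNReal.measurable_ofReal.comp (((h1.comp (by fun_prop))).mul
      (Finset.measurable_prod _ fun j _ => (h2 j).comp (by fun_prop)))
  calc _ = ∫⁻ y, ∫⁻ ξ, ∑' n, F n * ENNReal.ofReal (poissonWeightPred (b y - ξ * p y) (n y) *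
          ∏ j ∈ Finset.univ.erase y, poissonWeight (b j - ξ * p j) (n j))
          ∂(expMeasure 1) ∂(pickMeasure p) := by
        simp_rw [hcount _ (fun r => r + foundPoint p b _ _), poissonField_preimage_add_foundPoint]
    _ = ∑' n, F n * ∑ y, ENNReal.ofReal (p y) * ∫⁻ ξ, ENNReal.ofReal
          (poissonWeightPred (b y - ξ * p y) (n y) *
          ∏ j ∈ Finset.univ.erase y, poissonWeight (b j - ξ * p j) (n j)) ∂(expMeasure 1) := by
        rw [lintegral_pickMeasure]
        simp_rw [lintegral_tsum fun n => ((hmeas n _).const_mul (F n)).aemeasurable,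
          lintegral_const_mul _ (hmeas _ _), ← ENNReal.tsum_mul_left]
        rw [← Summable.tsum_finsetSum fun _ _ => ENNReal.summable]
        refine tsum_congr fun n => ?_
        rw [Finset.mul_sum]
        refine Finset.sum_congr rfl fun y _ => by ring
    _ = ∑' n, F n * ENNReal.ofReal (∏ j, poissonWeight (b j) (n j)) := by
        refine tsum_congr fun n => ?_
        rw [← lintegral_exp_mul_poissonWeight p hp hp1 b n]
        congr 1
        simp_rw [lintegral_expMeasure_one (hmeas n _)]
        simp_rw [← lintegral_const_mul' _ _ ENNReal.ofReal_ne_top]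
        rw [← lintegral_finsetSum']
        · refine lintegral_congr fun t => ?_
          rw [ENNReal.ofReal_mul (Real.exp_pos _).le, ENNReal.ofReal_sum_of_nonneg, Finset.mul_sum]
          · refine Finset.sum_congr rfl fun y _ => ?_
            rw [ENNReal.ofReal_mul (hp y)]
            ring
          · exact fun y _ => mul_nonneg (hp y)
              (mul_nonneg (poissonWeightPred_nonneg _ _) (Finset.prod_nonneg fun _ _ =>
              poissonWeight_nonneg _ _))
        · exact fun y _ => (((by fun_prop : Measurable fun t : ℝ =>
            ENNReal.ofReal (Real.exp (-t))).mul (hmeas n y)).const_mul _).aemeasurable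
    _ = _ := by
        rw [hcount _ (fun r => r)]
        refine tsum_congr fun n => ?_
        rw [← poissonField_singleton]
        simp

end StepLaw

/-! ### Many particles, and the sampler conditioned on the initial points -/

section Coupling

variable {ι : Type*} [Fintype ι] [DecidableEq ι] [MeasurableSpace ι] [DiscreteMeasurableSpace ι]

instance (p : ι → ℝ) : IsFiniteMeasure (pickMeasure p) :=
  ⟨by simp [pickMeasure]⟩

lemma measurable_foundPoint (p : ι → ℝ) :
    Measurable fun q : (ι → ℝ) × ι × ℝ => foundPoint p q.1 q.2.1 q.2.2 := by
  have h : Measurable fun q : ι × (ι → ℝ) × ℝ => foundPoint p q.2.1 q.1 q.2.2 := by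
    refine measurable_from_prod_countable_right fun y => ?_
    unfold foundPoint
    have h0 : Measurable fun q : (ι → ℝ) × ℝ => q.1 y - q.2 * p y :=
      ((measurable_pi_apply y).comp measurable_fst).sub (measurable_snd.mul_const _)
    exact Measurable.ite (measurableSet_lt measurable_const h0)
      (measurable_const (a := (Pi.single y 1 : ι → ℕ))) measurable_const
  exact h.comp (by fun_prop : Measurable fun q : (ι → ℝ) × ι × ℝ => (q.2.1, q.1, q.2.2))

/-- Prepend one step `(y, ξ)` to the outcome `(r, (m, S), r')` of a chain of matchings. -/
def prependStep (p : ι → ℝ) (q : ((ι → ℝ) × ι × ℝ) × (ι → ℕ) × ((ι → ℕ) × ℝ) × (ι → ℕ)) :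
    (ι → ℕ) × ((ι → ℕ) × ℝ) × (ι → ℕ) :=
  (q.2.1 + foundPoint p q.1.1 q.1.2.1 q.1.2.2,
    (Pi.single q.1.2.1 1 + q.2.2.1.1, q.1.2.2 + q.2.2.1.2), q.2.2.2)

lemma measurable_prependStep (p : ι → ℝ) : Measurable (prependStep p) := by
  have h2 : Measurable fun i : ι => (Pi.single i 1 : ι → ℕ) := Measurable.of_discrete
  have h3 : Measurable fun q : ((ι → ℝ) × ι × ℝ) × (ι → ℕ) × ((ι → ℕ) × ℝ) × (ι → ℕ) =>
    (Pi.single q.1.2.1 1 : ι → ℕ) := h2.comp (by fun_prop)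
  have h4 : Measurable fun q : ((ι → ℝ) × ι × ℝ) × (ι → ℕ) × ((ι → ℕ) × ℝ) × (ι → ℕ) =>
    foundPoint p q.1.1 q.1.2.1 q.1.2.2 := (measurable_foundPoint p).comp measurable_fst
  unfold prependStep
  fun_prop

lemma measurable_budget_step (p : ι → ℝ) :
    Measurable fun q : (ι → ℝ) × ι × ℝ => fun j => q.1 j - q.2.2 * p j := by
  fun_prop

/-- The joint law of the initial points `r`, the displacement counts `m` of `n` particles, the
total time `S`, and the remaining points `r'`, when the initial budget is `b`. -/
def coupling (p : ι → ℝ) : ℕ → Kernel (ι → ℝ) ((ι → ℕ) × ((ι → ℕ) × ℝ) × (ι → ℕ))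
  | 0 => (poissonFieldKernel ι).map fun r => (r, (0, 0), r)
  | n + 1 =>
    ((Kernel.id ×ₖ ((coupling p n).comap _ (measurable_budget_step p))).map (prependStep p)) ∘ₖ
      (Kernel.id ×ₖ Kernel.const _ ((pickMeasure p).prod (expMeasure 1)))

/-- The joint law of the displacement counts and the total time of `n` particles. -/
def pathLaw (p : ι → ℝ) : ℕ → Measure ((ι → ℕ) × ℝ)
  | 0 => Measure.dirac (0, 0)
  | n + 1 => (((pickMeasure p).prod (expMeasure 1)).prod (pathLaw p n)).map
      fun q => (Pi.single q.1.1 1 + q.2.1, q.1.2 + q.2.2)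

lemma measurable_pathLaw_step :
    Measurable fun q : (ι × ℝ) × (ι → ℕ) × ℝ =>
      ((Pi.single q.1.1 1 + q.2.1, q.1.2 + q.2.2) : (ι → ℕ) × ℝ) := by
  have h2 : Measurable fun i : ι => (Pi.single i 1 : ι → ℕ) := Measurable.of_discrete
  have h3 : Measurable fun q : (ι × ℝ) × (ι → ℕ) × ℝ =>
    (Pi.single q.1.1 1 : ι → ℕ) := h2.comp (by fun_prop)
  fun_prop

instance isFiniteMeasure_pathLaw (p : ι → ℝ) (n : ℕ) : IsFiniteMeasure (pathLaw p n) := by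
  induction n with
  | zero => unfold pathLaw; infer_instance
  | succ n ih => unfold pathLaw; infer_instance

lemma lintegral_pathLaw_zero (p : ι → ℝ) {F : (ι → ℕ) × ℝ → ℝ≥0∞} (hF : Measurable F) :
    ∫⁻ q, F q ∂(pathLaw p 0) = F (0, 0) := by
  rw [pathLaw, lintegral_dirac' _ hF]

lemma lintegral_pathLaw_succ (p : ι → ℝ) (n : ℕ) {F : (ι → ℕ) × ℝ → ℝ≥0∞} (hF : Measurable F) :
    ∫⁻ q, F q ∂(pathLaw p (n + 1)) = ∫⁻ y, ∫⁻ ξ, ∫⁻ q, F (Pi.single y 1 + q.1, ξ + q.2)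
      ∂(pathLaw p n) ∂(expMeasure 1) ∂(pickMeasure p) := by
  have h : Measurable fun q : (ι × ℝ) × (ι → ℕ) × ℝ =>
    F (Pi.single q.1.1 1 + q.2.1, q.1.2 + q.2.2) := hF.comp measurable_pathLaw_step
  rw [pathLaw, lintegral_map hF measurable_pathLaw_step, lintegral_prod _ h.aemeasurable,
    lintegral_prod _ (Measurable.aemeasurable (Measurable.lintegral_prod_right' h))]

instance isSFiniteKernel_coupling (p : ι → ℝ) (n : ℕ) : IsFiniteKernel (coupling p n) := by
  induction n with
  | zero => unfold coupling; infer_instance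
  | succ n ih => unfold coupling; infer_instance

lemma lintegral_coupling_zero (p : ι → ℝ) (b : ι → ℝ)
    {F : (ι → ℕ) × ((ι → ℕ) × ℝ) × (ι → ℕ) → ℝ≥0∞} (hF : Measurable F) :
    ∫⁻ o, F o ∂(coupling p 0 b) = ∫⁻ r, F (r, (0, 0), r) ∂(poissonField b) := by
  rw [coupling, Kernel.lintegral_map _ (by fun_prop) _ hF, poissonFieldKernel_apply]

lemma lintegral_coupling_succ (p : ι → ℝ) (n : ℕ) (b : ι → ℝ)
    {F : (ι → ℕ) × ((ι → ℕ) × ℝ) × (ι → ℕ) → ℝ≥0∞} (hF : Measurable F) :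
    ∫⁻ o, F o ∂(coupling p (n + 1) b) = ∫⁻ y, ∫⁻ ξ, ∫⁻ o, F (prependStep p ((b, y, ξ), o))
      ∂(coupling p n fun j => b j - ξ * p j) ∂(expMeasure 1) ∂(pickMeasure p) := by
  have hG := hF.comp (measurable_prependStep p)
  rw [coupling, Kernel.lintegral_comp _ _ _ hF, Kernel.lintegral_id_prod,
    Kernel.const_apply]
  · rw [lintegral_prod]
    · refine lintegral_congr fun y => lintegral_congr fun ξ => ?_
      rw [Kernel.lintegral_map _ (measurable_prependStep p) _ hF, Kernel.lintegral_id_prod,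
        Kernel.lintegral_comap]
      exact hG
    · exact (hF.lintegral_kernel.comp (by fun_prop)).aemeasurable
  · exact hF.lintegral_kernel

lemma isMarkovKernel_coupling {p : ι → ℝ} (hp : ∀ i, 0 ≤ p i) (hp1 : ∑ i, p i = 1) (n : ℕ) :
    IsMarkovKernel (coupling p n) := by
  have := isProbabilityMeasure_pickMeasure hp hp1
  induction n with
  | zero =>
    unfold coupling
    exact Kernel.IsMarkovKernel.map _ (by fun_prop)
  | succ n ih =>
    unfold coupling
    have := Kernel.IsMarkovKernel.map (Kernel.id ×ₖ ((coupling p n).comap _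
      (measurable_budget_step p))) (measurable_prependStep p)
    infer_instance

lemma isProbabilityMeasure_pathLaw {p : ι → ℝ} (hp : ∀ i, 0 ≤ p i) (hp1 : ∑ i, p i = 1) (n : ℕ) :
    IsProbabilityMeasure (pathLaw p n) := by
  have := isProbabilityMeasure_pickMeasure hp hp1
  induction n with
  | zero => unfold pathLaw; infer_instance
  | succ n ih =>
    unfold pathLaw
    exact Measure.isProbabilityMeasure_map measurable_pathLaw_step.aemeasurable

/-- Although the initial points are assembled from the remaining ones and the found ones, they are a
Poisson field whose law does not depend on `n`. Each prepended step preserves this by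
`lintegral_step_poissonField`. This is what allows the given configuration to serve as the first
coordinate. -/
lemma lintegral_coupling_fst {p : ι → ℝ} (hp : ∀ i, 0 ≤ p i) (hp1 : ∑ i, p i = 1) (n : ℕ)
    (b : ι → ℝ) (F : (ι → ℕ) → ℝ≥0∞) :
    ∫⁻ o, F o.1 ∂(coupling p n b) = ∫⁻ r, F r ∂(poissonField b) := by
  induction n generalizing b F with
  | zero => rw [lintegral_coupling_zero _ _ (F := fun o => F o.1)
      ((measurable_of_countable F).comp measurable_fst)]
  | succ n ih =>
    rw [lintegral_coupling_succ _ _ _ (F := fun o => F o.1)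
      ((measurable_of_countable F).comp measurable_fst), ← lintegral_step_poissonField hp hp1]
    refine lintegral_congr fun y => lintegral_congr fun ξ => ?_
    exact ih (fun j => b j - ξ * p j) fun r => F (r + foundPoint p b y ξ)

lemma measurable_pathLaw_inner (p b : ι → ℝ) {F : ((ι → ℕ) × ℝ) × (ι → ℕ) → ℝ≥0∞}
    (hF : Measurable F) : Measurable fun q : (ι → ℕ) × ℝ =>
      ∫⁻ r, F (q, r) ∂(poissonField fun j => b j - q.2 * p j) := by
  have h := Measurable.lintegral_kernel_prod_right'
    (κ := (poissonFieldKernel ι).comap (fun q : (ι → ℕ) × ℝ => fun j => b j - q.2 * p j)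
      (by fun_prop)) hF
  exact h

/-- A Markov property: the steps are drawn without looking at the field, so given displacements and
total time the remaining points are a Poisson field with the reduced budget. Successive reductions
of the budget add up, and only the total time matters. -/
lemma lintegral_coupling_snd (p : ι → ℝ) (n : ℕ)
    (b : ι → ℝ) {F : ((ι → ℕ) × ℝ) × (ι → ℕ) → ℝ≥0∞} (hF : Measurable F) :
    ∫⁻ o, F o.2 ∂(coupling p n b) =
      ∫⁻ q, ∫⁻ r, F (q, r) ∂(poissonField fun j => b j - q.2 * p j) ∂(pathLaw p n) := by
  induction n generalizing b F with
  | zero =>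
    rw [lintegral_coupling_zero _ _ (F := fun o => F o.2) (hF.comp measurable_snd),
      lintegral_pathLaw_zero _ (measurable_pathLaw_inner p b hF)]
    simp
  | succ n ih =>
    rw [lintegral_coupling_succ _ _ _ (F := fun o => F o.2) (hF.comp measurable_snd),
      lintegral_pathLaw_succ _ _ (measurable_pathLaw_inner p b hF)]
    refine lintegral_congr fun y => lintegral_congr fun ξ => ?_
    refine (ih (fun j => b j - ξ * p j)
      (F := fun o => F ((Pi.single y 1 + o.1.1, ξ + o.1.2), o.2)) (hF.comp (by fun_prop))).trans ?_
    refine lintegral_congr fun q => ?_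
    congr 2
    ext j
    ring

lemma measurableSet_coupling_le : MeasurableSet
    {o : (ι → ℕ) × ((ι → ℕ) × ℝ) × (ι → ℕ) | o.1 ≤ o.2.1.1 + o.2.2} := by
  have : Measurable fun o : (ι → ℕ) × ((ι → ℕ) × ℝ) × (ι → ℕ) => (o.1, o.2.1.1, o.2.2) := by
    fun_prop
  exact this (Set.to_countable
    {q : (ι → ℕ) × (ι → ℕ) × (ι → ℕ) | q.1 ≤ q.2.1 + q.2.2}).measurableSet

lemma measurable_ite_zero_one {A : Type*} [MeasurableSpace A] {P : A → Prop}
    [DecidablePred P] (hP : MeasurableSet {a | P a}) :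
    Measurable fun a => (if P a then 0 else 1 : ℝ≥0∞) :=
  Measurable.ite hP measurable_const measurable_const

/-- The recursive laws are known through their integrals; this puts almost sure statements in that
form. -/
lemma ae_iff_lintegral_ite {A : Type*} [MeasurableSpace A] {μ : Measure A} {P : A → Prop}
    [DecidablePred P] (hP : MeasurableSet {a | P a}) :
    (∀ᵐ a ∂μ, P a) ↔ ∫⁻ a, (if P a then 0 else 1 : ℝ≥0∞) ∂μ = 0 := by
  rw [lintegral_eq_zero_iff (Measurable.ite hP measurable_const measurable_const)]
  refine Filter.eventually_congr (Filter.Eventually.of_forall fun a => ?_)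
  by_cases h : P a <;> simp [h]

/-- A step adds at most one initial point, and at the very site to which its particle moves; virtual
points make the inequality strict. It is this inequality that turns leftover points into a bound on
unmatched ones. -/
lemma ae_coupling_le (p : ι → ℝ) (n : ℕ) (b : ι → ℝ) :
    ∀ᵐ o ∂(coupling p n b), o.1 ≤ o.2.1.1 + o.2.2 := by
  classical
  have hm := measurableSet_coupling_le (ι := ι)
  have hF := measurable_ite_zero_one hm
  induction n generalizing b with
  | zero =>
    rw [ae_iff_lintegral_ite hm, lintegral_coupling_zero _ _ hF]
    simp
  | succ n ih =>
    rw [ae_iff_lintegral_ite hm, lintegral_coupling_succ _ _ _ hF]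
    refine (lintegral_congr fun y => lintegral_congr fun ξ => ?_).trans
      (by simp : ∫⁻ y, ∫⁻ ξ, (0 : ℝ≥0∞) ∂(expMeasure 1) ∂(pickMeasure p) = 0)
    refine (lintegral_congr_ae ?_).trans lintegral_zero
    filter_upwards [ih fun j => b j - ξ * p j] with o ho
    rw [if_pos]
    intro j
    have h1 := ho j
    have h2 : foundPoint p b y ξ j ≤ (Pi.single y 1 : ι → ℕ) j := by
      unfold foundPoint
      split_ifs <;> simp
    simp only [prependStep, Pi.add_apply] at h1 ⊢
    omega

lemma ae_pathLaw_succ (p : ι → ℝ) (n : ℕ) {P : (ι → ℕ) × ℝ → Prop} (hP : MeasurableSet {q | P q})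
    (h : ∀ y, ∀ᵐ ξ ∂(expMeasure 1), ∀ᵐ q ∂(pathLaw p n), P (Pi.single y 1 + q.1, ξ + q.2)) :
    ∀ᵐ q ∂(pathLaw p (n + 1)), P q := by
  classical
  have hF := measurable_ite_zero_one hP
  rw [ae_iff_lintegral_ite hP, lintegral_pathLaw_succ _ _ hF]
  refine (lintegral_congr fun y => (lintegral_congr_ae ?_).trans
    (by simp : ∫⁻ ξ, (0 : ℝ≥0∞) ∂(expMeasure 1) = 0)).trans (by simp)
  filter_upwards [h y] with ξ hξ
  refine (lintegral_congr_ae ?_).trans lintegral_zero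
  filter_upwards [hξ] with q hq
  simp [hq]

lemma ae_expMeasure_nonneg : ∀ᵐ ξ ∂(expMeasure 1), 0 ≤ ξ := by
  classical
  rw [ae_iff_lintegral_ite measurableSet_Ici, lintegral_expMeasure_one
    (Measurable.ite measurableSet_Ici measurable_const measurable_const)]
  refine (setLIntegral_congr_fun measurableSet_Ioi fun t ht => ?_).trans lintegral_zero
  simp [le_of_lt (Set.mem_Ioi.1 ht)]

lemma measurable_sum_counts : Measurable fun q : (ι → ℕ) × ℝ => ∑ j, q.1 j := by fun_prop

lemma ae_pathLaw_sum (p : ι → ℝ) (n : ℕ) : ∀ᵐ q ∂(pathLaw p n), ∑ j, q.1 j = n := by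
  have hm : ∀ n : ℕ, MeasurableSet {q : (ι → ℕ) × ℝ | ∑ j, q.1 j = n} := fun n =>
    measurable_sum_counts (measurableSet_singleton n)
  induction n with
  | zero =>
    rw [pathLaw, ae_dirac_iff (hm 0)]
    simp
  | succ n ih =>
    refine ae_pathLaw_succ p n (hm _) fun y => Filter.Eventually.of_forall fun ξ => ?_
    filter_upwards [ih] with q hq
    simp [Finset.sum_add_distrib, hq, add_comm]

lemma ae_pathLaw_nonneg (p : ι → ℝ) (n : ℕ) : ∀ᵐ q ∂(pathLaw p n), 0 ≤ q.2 := by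
  have hm : MeasurableSet {q : (ι → ℕ) × ℝ | 0 ≤ q.2} :=
    measurableSet_le measurable_const measurable_snd
  induction n with
  | zero =>
    rw [pathLaw, ae_dirac_iff hm]
  | succ n ih =>
    refine ae_pathLaw_succ p n hm fun y => ?_
    filter_upwards [ae_expMeasure_nonneg] with ξ hξ
    filter_upwards [ih] with q hq
    exact add_nonneg hξ hq

/-- A measurable sampler: given the initial points `r` in a Poisson field with budget `b` and a
uniform variable, it produces displacement counts `m` of `n` particles, a total time `S` and the
remaining points, so that `(m, S)` has law `pathLaw p n` and the remaining points form a Poisson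
field with the reduced budget. -/
theorem exists_sampler [Nonempty ι] {p : ι → ℝ} (hp : ∀ i, 0 ≤ p i) (hp1 : ∑ i, p i = 1) :
    ∃ f : ℕ → (ι → ℕ) → (ι → ℝ) × unitInterval → ((ι → ℕ) × ℝ) × (ι → ℕ),
      (∀ n r, Measurable (f n r)) ∧ (∀ n r q, ∑ j, (f n r q).1.1 j = n) ∧
      (∀ n r q, r ≤ (f n r q).1.1 + (f n r q).2) ∧
      ∀ n b (F : ((ι → ℕ) × ℝ) × (ι → ℕ) → ℝ≥0∞), Measurable F →
        ∫⁻ r, ∫⁻ v, F (f n r (b, v)) ∂volume ∂(poissonField b) =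
          ∫⁻ q, ∫⁻ r, F (q, r) ∂(poissonField fun j => b j - q.2 * p j) ∂(pathLaw p n) := by
  classical
  suffices h : ∀ n, ∃ f : (ι → ℕ) → (ι → ℝ) × unitInterval → ((ι → ℕ) × ℝ) × (ι → ℕ),
      (∀ r, Measurable (f r)) ∧ (∀ r q, ∑ j, (f r q).1.1 j = n) ∧
      (∀ r q, r ≤ (f r q).1.1 + (f r q).2) ∧
      ∀ b (F : ((ι → ℕ) × ℝ) × (ι → ℕ) → ℝ≥0∞), Measurable F →
        ∫⁻ r, ∫⁻ v, F (f r (b, v)) ∂volume ∂(poissonField b) =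
          ∫⁻ q, ∫⁻ r, F (q, r) ∂(poissonField fun j => b j - q.2 * p j) ∂(pathLaw p n) by
    choose f h1 h2 h3 h4 using h
    exact ⟨f, h1, h2, h3, h4⟩
  intro n
  have := isMarkovKernel_coupling hp hp1 n
  -- The conditional law of the rest given budget and initial points, realised as a function of a
  -- uniform variable.
  obtain ⟨g, hg, hgκ⟩ := Kernel.exists_measurable_map_eq_unitInterval (coupling p n).condKernel
  let j₀ : ι := Classical.arbitrary ι
  let good : (ι → ℕ) × ((ι → ℕ) × ℝ) × (ι → ℕ) → Prop := fun o =>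
    o.1 ≤ o.2.1.1 + o.2.2 ∧ ∑ j, o.2.1.1 j = n
  have hgood : MeasurableSet {o | good o} := measurableSet_coupling_le.inter
    ((measurable_sum_counts.comp (measurable_fst.comp measurable_snd)) (measurableSet_singleton n))
  -- On the exceptional null set all particles go to one site and no point is removed, so that the
  -- total `n` and the domination of `r` hold for every input.
  let fix : (ι → ℕ) × ((ι → ℕ) × ℝ) × (ι → ℕ) → ((ι → ℕ) × ℝ) × (ι → ℕ) := fun o =>
    if good o then o.2 else ((Pi.single j₀ n, 0), o.1)
  have hfix : Measurable fix := Measurable.ite hgood measurable_snd (by fun_prop)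
  have hg' : ∀ r, Measurable fun q : (ι → ℝ) × unitInterval => g (q.1, r) q.2 := fun r =>
    hg.comp (by fun_prop : Measurable fun q : (ι → ℝ) × unitInterval => ((q.1, r), q.2))
  refine ⟨fun r q => fix (r, g (q.1, r) q.2), fun r => hfix.comp ?_, fun r q => ?_, fun r q => ?_,
    fun b F hF => ?_⟩
  · exact measurable_const.prodMk (hg' r)
  · by_cases h : good (r, g (q.1, r) q.2)
    · simp only [fix, h, if_true]
      exact h.2
    · simp [fix, h]
  · by_cases h : good (r, g (q.1, r) q.2)
    · simp only [fix, h, if_true]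
      exact h.1
    · simp [fix, h]
  · have hFf := hF.comp hfix
    have h1 : ∀ r, ∫⁻ v, F (fix (r, g (b, r) v)) =
        ∫⁻ o, F (fix (r, o)) ∂((coupling p n).condKernel (b, r)) := by
      intro r
      have hg1 : Measurable (g (b, r)) := hg.comp measurable_prodMk_left
      rw [← hgκ (b, r), lintegral_map (f := fun o => F (fix (r, o)))
        (hFf.comp measurable_prodMk_left) hg1]
    -- The first marginal of the coupling is the Poisson field, so integrating the conditional
    -- kernel against it rebuilds the coupling.
    have h2 : ∫⁻ r, ∫⁻ o, F (fix (r, o)) ∂((coupling p n).condKernel (b, r)) ∂(poissonField b) =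
        ∫⁻ o, F (fix o) ∂(coupling p n b) := by
      rw [← lintegral_coupling_fst hp hp1 n]
      conv_rhs => rw [← (coupling p n).disintegrate (coupling p n).condKernel]
      rw [Kernel.lintegral_compProd _ _ _ (f := fun o => F (fix o)) hFf, Kernel.fst_apply, lintegral_map]
      · exact measurable_of_countable _
      · exact measurable_fst
    simp_rw [h1, h2]
    rw [← lintegral_coupling_snd p n b hF]
    have hsum : ∀ᵐ o ∂(coupling p n b), ∑ j, o.2.1.1 j = n := by
      have hm : MeasurableSet {o : ((ι → ℕ) × ℝ) × (ι → ℕ) | ∑ j, o.1.1 j = n} :=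
        (measurable_sum_counts.comp measurable_fst) (measurableSet_singleton n)
      have hm' : MeasurableSet {o : (ι → ℕ) × ((ι → ℕ) × ℝ) × (ι → ℕ) | ∑ j, o.2.1.1 j = n} :=
        measurable_snd hm
      rw [ae_iff_lintegral_ite hm', lintegral_coupling_snd p n b (F := fun o =>
        if ∑ j, o.1.1 j = n then 0 else 1)
        (Measurable.ite hm measurable_const measurable_const)]
      refine (lintegral_congr_ae ?_).trans lintegral_zero
      filter_upwards [ae_pathLaw_sum p n] with q hq
      simp [hq]
    refine lintegral_congr_ae ?_
    filter_upwards [ae_coupling_le p n b, hsum] with o h1 h2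
    have : good o := ⟨h1, h2⟩
    simp [fix, this]

end Coupling

/-! ### A Poisson number of particles: Poisson splitting and moments of the total time -/

section ParticleLaw

/-- Size-biasing a Poisson variable adds one. -/
lemma lintegral_natCast_mul_poissonMeasure (r : ℝ≥0) (f : ℕ → ℝ≥0∞) :
    ∫⁻ n, n * f n ∂(poissonMeasure r) = r * ∫⁻ n, f (n + 1) ∂(poissonMeasure r) := by
  rw [lintegral_countable', lintegral_countable', tsum_eq_zero_add' ENNReal.summable,
    ← ENNReal.tsum_mul_left]
  simp only [Nat.cast_zero, zero_mul, zero_add]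
  refine tsum_congr fun n => ?_
  have h : ((n + 1 : ℕ) : ℝ≥0∞) * poissonMeasure r {n + 1} = r * poissonMeasure r {n} := by
    rw [poissonMeasure_singleton, poissonMeasure_singleton, ← ENNReal.ofReal_natCast,
      ← ENNReal.ofReal_coe_nnreal, ← ENNReal.ofReal_mul (by positivity),
      ← ENNReal.ofReal_mul (by positivity)]
    congr 1
    rw [Nat.factorial_succ]
    push_cast
    have : ((n.factorial : ℕ) : ℝ) ≠ 0 := by positivity
    have h' : ((n : ℝ) + 1) ≠ 0 := by positivity
    field_simp
    ring
  calc _ = f (n + 1) * (((n + 1 : ℕ) : ℝ≥0∞) * poissonMeasure r {n + 1}) := by ring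
    _ = _ := by rw [h]; ring

lemma lintegral_natCast_poissonMeasure (r : ℝ≥0) :
    ∫⁻ n, (n : ℝ≥0∞) ∂(poissonMeasure r) = r := by
  simpa using lintegral_natCast_mul_poissonMeasure r 1

/-- A sum of `n` standard exponentials has second moment n² + n; this averages it over a Poisson
number of terms. -/
lemma lintegral_sq_add_poissonMeasure (r : ℝ≥0) :
    ∫⁻ n, ((n : ℝ≥0∞) ^ 2 + n) ∂(poissonMeasure r) = r ^ 2 + 2 * r := by
  have h := lintegral_natCast_mul_poissonMeasure r fun n => (n : ℝ≥0∞) + 1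
  have h2 : ∀ n : ℕ, (n : ℝ≥0∞) ^ 2 + n = n * (n + 1) := fun n => by ring
  simp_rw [h2]
  rw [h]
  push_cast
  rw [lintegral_add_right _ measurable_const, lintegral_add_right _ measurable_const,
    lintegral_natCast_poissonMeasure]
  simp
  ring

variable {ι : Type*} [Fintype ι] [DecidableEq ι] [MeasurableSpace ι] [DiscreteMeasurableSpace ι]

lemma lintegral_expMeasure_ofReal : ∫⁻ ξ, ENNReal.ofReal ξ ∂(expMeasure 1) = 1 := by
  rw [lintegral_expMeasure_one ENNReal.measurable_ofReal]
  have h : ∀ t : ℝ, ENNReal.ofReal (Real.exp (-t)) * ENNReal.ofReal t =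
      ENNReal.ofReal (Real.exp (-t) * t) := fun t =>
    (ENNReal.ofReal_mul (Real.exp_pos _).le).symm
  simp_rw [h]
  have hi := Real.GammaIntegral_convergent (s := 2) two_pos
  have hG := Real.Gamma_eq_integral (s := 2) two_pos
  have : ∀ x : ℝ, Real.exp (-x) * x ^ ((2 : ℝ) - 1) = Real.exp (-x) * x := fun x => by norm_num
  simp_rw [this] at hi hG
  rw [← ofReal_integral_eq_lintegral_ofReal hi, ← hG, Real.Gamma_two, ENNReal.ofReal_one]
  exact (ae_restrict_mem measurableSet_Ioi).mono fun t ht =>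
    mul_nonneg (Real.exp_pos _).le (le_of_lt ht)

lemma lintegral_expMeasure_ofReal_sq : ∫⁻ ξ, ENNReal.ofReal ξ ^ 2 ∂(expMeasure 1) = 2 := by
  rw [lintegral_expMeasure_one (ENNReal.measurable_ofReal.pow_const 2)]
  have hi := Real.GammaIntegral_convergent (s := 3) three_pos
  have hG := Real.Gamma_eq_integral (s := 3) three_pos
  have : ∀ x : ℝ, Real.exp (-x) * x ^ ((3 : ℝ) - 1) = Real.exp (-x) * x ^ 2 := fun x => by
    norm_num
  simp_rw [this] at hi hG
  have h3 : Real.Gamma 3 = 2 := by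
    have h : (3 : ℝ) = ((2 : ℕ) : ℝ) + 1 := by norm_num
    rw [h, Real.Gamma_nat_eq_factorial]
    norm_num
  calc _ = ∫⁻ t in Set.Ioi (0 : ℝ), ENNReal.ofReal (Real.exp (-t) * t ^ 2) := by
        refine setLIntegral_congr_fun measurableSet_Ioi fun t ht => ?_
        rw [ENNReal.ofReal_mul (Real.exp_pos _).le, ENNReal.ofReal_pow (le_of_lt ht)]
    _ = _ := by
        rw [← ofReal_integral_eq_lintegral_ofReal hi, ← hG, h3]
        · norm_num
        · exact Filter.Eventually.of_forall fun t => by positivity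

lemma lintegral_pathLaw_time {p : ι → ℝ} (hp : ∀ i, 0 ≤ p i) (hp1 : ∑ i, p i = 1) (n : ℕ) :
    ∫⁻ q, ENNReal.ofReal q.2 ∂(pathLaw p n) = n := by
  have := isProbabilityMeasure_pickMeasure hp hp1
  have hF : Measurable fun q : (ι → ℕ) × ℝ => ENNReal.ofReal q.2 := by fun_prop
  induction n with
  | zero => rw [lintegral_pathLaw_zero _ hF]; simp
  | succ n ih =>
    have := isProbabilityMeasure_pathLaw hp hp1 n
    have key : ∀ᵐ ξ ∂(expMeasure 1), ∫⁻ q, ENNReal.ofReal (ξ + q.2) ∂(pathLaw p n) =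
        ENNReal.ofReal ξ + n := by
      filter_upwards [ae_expMeasure_nonneg] with ξ hξ
      have h : ∀ᵐ q ∂(pathLaw p n), ENNReal.ofReal (ξ + q.2) =
          ENNReal.ofReal ξ + ENNReal.ofReal q.2 := by
        filter_upwards [ae_pathLaw_nonneg p n] with q hq
        exact ENNReal.ofReal_add hξ hq
      rw [lintegral_congr_ae h, lintegral_add_right _ hF, ih]
      simp
    rw [lintegral_pathLaw_succ _ _ hF]
    simp only [lintegral_congr_ae key]
    rw [lintegral_add_right _ measurable_const, lintegral_expMeasure_ofReal]
    simp [add_comm]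

lemma lintegral_pathLaw_time_sq {p : ι → ℝ} (hp : ∀ i, 0 ≤ p i) (hp1 : ∑ i, p i = 1) (n : ℕ) :
    ∫⁻ q, ENNReal.ofReal q.2 ^ 2 ∂(pathLaw p n) = n ^ 2 + n := by
  have := isProbabilityMeasure_pickMeasure hp hp1
  have hF : Measurable fun q : (ι → ℕ) × ℝ => ENNReal.ofReal q.2 := by fun_prop
  induction n with
  | zero => rw [lintegral_pathLaw_zero _ (hF.pow_const 2)]; simp
  | succ n ih =>
    have := isProbabilityMeasure_pathLaw hp hp1 n
    have key : ∀ᵐ ξ ∂(expMeasure 1), ∫⁻ q, ENNReal.ofReal (ξ + q.2) ^ 2 ∂(pathLaw p n) =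
        ENNReal.ofReal ξ ^ 2 + 2 * n * ENNReal.ofReal ξ + (n ^ 2 + n) := by
      filter_upwards [ae_expMeasure_nonneg] with ξ hξ
      have h : ∀ᵐ q ∂(pathLaw p n), ENNReal.ofReal (ξ + q.2) ^ 2 =
          ENNReal.ofReal ξ ^ 2 + 2 * ENNReal.ofReal ξ * ENNReal.ofReal q.2 +
            ENNReal.ofReal q.2 ^ 2 := by
        filter_upwards [ae_pathLaw_nonneg p n] with q hq
        rw [ENNReal.ofReal_add hξ hq]
        ring
      rw [lintegral_congr_ae h, lintegral_add_right _ (hF.pow_const 2), ih,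
        lintegral_add_right _ (hF.const_mul _), lintegral_const_mul _ hF,
        lintegral_pathLaw_time hp hp1]
      simp
      ring
    rw [lintegral_pathLaw_succ _ _ (hF.pow_const 2)]
    simp only [lintegral_congr_ae key]
    have hξ : ∫⁻ ξ, (ENNReal.ofReal ξ ^ 2 + 2 * n * ENNReal.ofReal ξ + (n ^ 2 + n))
        ∂(expMeasure 1) = 2 + 2 * n * 1 + (n ^ 2 + n) := by
      rw [lintegral_add_right _ measurable_const, lintegral_add_right _ (by fun_prop),
        lintegral_const_mul _ (by fun_prop), lintegral_expMeasure_ofReal,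
        lintegral_expMeasure_ofReal_sq]
      simp
    rw [hξ]
    simp
    ring

/-- The weight of the vector of counts `k` for a multinomial distribution. -/
def multinomialWeight (p : ι → ℝ) (n : ℕ) (k : ι → ℕ) : ℝ :=
  if ∑ j, k j = n then n.factorial * ∏ j, (p j ^ k j / (k j).factorial) else 0

/-- Conditioning on the first displacement: when the total is n + 1, the term for `y` is `k y` times
a factor independent of `y`, and ∑ `k y` = n + 1 completes the factorial. -/
lemma multinomialWeight_succ (p : ι → ℝ) (n : ℕ) (k : ι → ℕ) :
    multinomialWeight p (n + 1) k = ∑ y, p y *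
      (if k y = 0 then 0 else multinomialWeight p n (k - Pi.single y 1)) := by
  have h1 : ∀ y, p y * (if k y = 0 then 0 else multinomialWeight p n (k - Pi.single y 1)) =
      if ∑ j, k j = n + 1 then k y * (n.factorial * ∏ j, (p j ^ k j / (k j).factorial)) else 0 := by
    intro y
    by_cases hy : k y = 0
    · simp [hy]
    have hsum : ∑ j, (k - Pi.single y 1 : ι → ℕ) j + 1 = ∑ j, k j := by
      have : k = (k - Pi.single y 1) + Pi.single y 1 := by
        ext j
        by_cases hj : j = y
        · subst hj; simp; omega
        · simp [hj]
      conv_rhs => rw [this]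
      simp only [Pi.add_apply, Finset.sum_add_distrib]
      simp
    rw [if_neg hy, multinomialWeight]
    have hiff : ∑ j, (k - Pi.single y 1 : ι → ℕ) j = n ↔ ∑ j, k j = n + 1 := by omega
    simp only [hiff]
    split_ifs with h
    · rw [← Finset.mul_prod_erase Finset.univ (fun j => p j ^ k j / ((k j).factorial : ℝ))
        (Finset.mem_univ y), ← Finset.mul_prod_erase Finset.univ _ (Finset.mem_univ y)]
      have hprod : ∏ j ∈ Finset.univ.erase y, (p j ^ (k - Pi.single y 1 : ι → ℕ) j /
          (((k - Pi.single y 1 : ι → ℕ) j).factorial : ℝ)) =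
          ∏ j ∈ Finset.univ.erase y, (p j ^ k j / ((k j).factorial : ℝ)) :=
        Finset.prod_congr rfl fun j hj => by simp [Finset.ne_of_mem_erase hj]
      rw [hprod]
      obtain ⟨l, hl⟩ := Nat.exists_eq_succ_of_ne_zero hy
      simp only [Pi.sub_apply, Pi.single_eq_same, hl, Nat.succ_eq_add_one, Nat.add_sub_cancel,
        Nat.factorial_succ]
      have : ((l.factorial : ℕ) : ℝ) ≠ 0 := by positivity
      have h' : ((l : ℝ) + 1) ≠ 0 := by positivity
      push_cast
      field_simp
      ring
    · simp
  simp_rw [h1]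
  rw [multinomialWeight]
  split_ifs with h
  · rw [← Finset.sum_mul, ← Nat.cast_sum, h, Nat.factorial_succ]
    push_cast
    ring
  · simp

lemma multinomialWeight_nonneg {p : ι → ℝ} (hp : ∀ i, 0 ≤ p i) (n : ℕ) (k : ι → ℕ) :
    0 ≤ multinomialWeight p n k := by
  unfold multinomialWeight
  split_ifs
  · exact mul_nonneg (by positivity) (Finset.prod_nonneg fun j _ =>
      div_nonneg (pow_nonneg (hp j) _) (by positivity))
  · exact le_rfl

lemma pathLaw_counts_eq {p : ι → ℝ} (hp : ∀ i, 0 ≤ p i) (n : ℕ) (k : ι → ℕ) :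
    ∫⁻ q, (if q.1 = k then 1 else 0 : ℝ≥0∞) ∂(pathLaw p n) =
      ENNReal.ofReal (multinomialWeight p n k) := by
  have hF : ∀ k : ι → ℕ, Measurable fun q : (ι → ℕ) × ℝ => (if q.1 = k then 1 else 0 : ℝ≥0∞) :=
    fun k => (measurable_of_countable fun m : ι → ℕ => (if m = k then 1 else 0 : ℝ≥0∞)).comp
      measurable_fst
  induction n generalizing k with
  | zero =>
    rw [lintegral_pathLaw_zero _ (hF k), multinomialWeight]
    by_cases hk : k = 0
    · subst hk
      simp
    · have : ¬ ∑ j, k j = 0 := fun h => hk (by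
        ext j
        simpa using Finset.sum_eq_zero_iff.1 h j (Finset.mem_univ j))
      rw [if_neg this, if_neg (fun h => hk h.symm)]
      simp
  | succ n ih =>
    rw [lintegral_pathLaw_succ _ _ (hF k), lintegral_pickMeasure, multinomialWeight_succ,
      ENNReal.ofReal_sum_of_nonneg]
    · refine Finset.sum_congr rfl fun y _ => ?_
      rw [ENNReal.ofReal_mul (hp y)]
      congr 1
      split_ifs with hy
      · have : ∀ m : ι → ℕ, ¬ (Pi.single y 1 + m = k) := fun m h => by
          have := congrFun h y
          simp [hy] at this
        simp [this]
      · have : ∀ m : ι → ℕ, Pi.single y 1 + m = k ↔ m = k - Pi.single y 1 := fun m => by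
          constructor
          · rintro rfl
            simp
          · rintro rfl
            ext j
            by_cases hj : j = y
            · subst hj
              simp
              omega
            · simp [hj]
        simp_rw [this, ih]
        simp
    · intro y _
      refine mul_nonneg (hp y) ?_
      split_ifs
      · exact le_rfl
      · exact multinomialWeight_nonneg hp _ _

/-- The joint law of displacement counts and total time of a Poisson number of particles. -/
def particleLaw (α : ℝ≥0) (p : ι → ℝ) : Measure ((ι → ℕ) × ℝ) :=
  (poissonMeasure α).bind (pathLaw p)

lemma lintegral_particleLaw (α : ℝ≥0) (p : ι → ℝ) {F : (ι → ℕ) × ℝ → ℝ≥0∞} (hF : Measurable F) :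
    ∫⁻ q, F q ∂(particleLaw α p) = ∫⁻ n, ∫⁻ q, F q ∂(pathLaw p n) ∂(poissonMeasure α) := by
  rw [particleLaw, Measure.lintegral_bind (measurable_of_countable _).aemeasurable hF.aemeasurable]

lemma isProbabilityMeasure_particleLaw (α : ℝ≥0) {p : ι → ℝ} (hp : ∀ i, 0 ≤ p i)
    (hp1 : ∑ i, p i = 1) : IsProbabilityMeasure (particleLaw α p) := by
  have := isProbabilityMeasure_pathLaw hp hp1
  constructor
  rw [← lintegral_one, lintegral_particleLaw _ _ measurable_const]
  simp

/-- Poisson splitting: the displacement counts are independent Poisson variables. -/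
lemma lintegral_particleLaw_counts (α : ℝ≥0) {p : ι → ℝ} (hp : ∀ i, 0 ≤ p i)
    (hp1 : ∑ i, p i = 1) (F : (ι → ℕ) → ℝ≥0∞) :
    ∫⁻ q, F q.1 ∂(particleLaw α p) = ∫⁻ r, F r ∂(poissonField fun j => α * p j) := by
  have h : (particleLaw α p).map Prod.fst = poissonField fun j => α * p j := by
    refine Measure.ext_of_singleton fun k => ?_
    have hF : Measurable fun q : (ι → ℕ) × ℝ => (if q.1 = k then 1 else 0 : ℝ≥0∞) :=
      (measurable_of_countable fun m : ι → ℕ => (if m = k then 1 else 0 : ℝ≥0∞)).comp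
        measurable_fst
    have h1 : (particleLaw α p).map Prod.fst {k} =
        ∫⁻ q, (if q.1 = k then 1 else 0 : ℝ≥0∞) ∂(particleLaw α p) := by
      rw [Measure.map_apply measurable_fst (measurableSet_singleton k),
        ← lintegral_indicator_one (measurable_fst (measurableSet_singleton k))]
      refine lintegral_congr fun q => ?_
      simp [Set.indicator]
    rw [h1, lintegral_particleLaw _ _ hF, poissonField_singleton]
    simp_rw [pathLaw_counts_eq hp]
    -- The counts determine the number of particles, so a single value of `n` contributes; its
    -- factorial cancels between Poisson and multinomial weights.
    rw [lintegral_countable', tsum_eq_single (∑ j, k j)]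
    · rw [poissonMeasure_singleton, multinomialWeight, if_pos rfl, ← ENNReal.ofReal_mul
        (mul_nonneg (by positivity) (Finset.prod_nonneg fun j _ =>
          div_nonneg (pow_nonneg (hp j) _) (by positivity)))]
      congr 1
      have h2 : ∀ j, poissonWeight (α * p j) (k j) =
          Real.exp (-(α * p j)) * ((α : ℝ) ^ k j * (p j ^ k j / (k j).factorial)) := by
        intro j
        rw [poissonWeight, max_eq_left (mul_nonneg α.coe_nonneg (hp j)), mul_pow]
        ring
      simp_rw [h2]
      rw [Finset.prod_mul_distrib, Finset.prod_mul_distrib, ← Real.exp_sum, Finset.sum_neg_distrib,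
        ← Finset.mul_sum, hp1, Finset.prod_pow_eq_pow_sum]
      have : (((∑ j, k j).factorial : ℕ) : ℝ) ≠ 0 := by positivity
      field_simp
    · intro n hn
      rw [multinomialWeight, if_neg (fun h => hn h.symm)]
      simp
  rw [← h, lintegral_map (measurable_of_countable F) measurable_fst]

lemma ae_particleLaw_nonneg (α : ℝ≥0) (p : ι → ℝ) : ∀ᵐ q ∂(particleLaw α p), 0 ≤ q.2 := by
  classical
  have hm : MeasurableSet {q : (ι → ℕ) × ℝ | 0 ≤ q.2} :=
    measurableSet_le measurable_const measurable_snd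
  rw [ae_iff_lintegral_ite hm, lintegral_particleLaw _ _ (measurable_ite_zero_one hm)]
  simp_rw [fun n => (ae_iff_lintegral_ite hm).1 (ae_pathLaw_nonneg p n)]
  simp

lemma lintegral_particleLaw_time (α : ℝ≥0) {p : ι → ℝ} (hp : ∀ i, 0 ≤ p i)
    (hp1 : ∑ i, p i = 1) :
    ∫⁻ q, ENNReal.ofReal q.2 ∂(particleLaw α p) = α := by
  rw [lintegral_particleLaw _ _ (by fun_prop)]
  simp_rw [lintegral_pathLaw_time hp hp1]
  exact lintegral_natCast_poissonMeasure α

lemma lintegral_particleLaw_time_sq (α : ℝ≥0) {p : ι → ℝ} (hp : ∀ i, 0 ≤ p i)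
    (hp1 : ∑ i, p i = 1) :
    ∫⁻ q, ENNReal.ofReal q.2 ^ 2 ∂(particleLaw α p) = α ^ 2 + 2 * α := by
  rw [lintegral_particleLaw _ _ (by fun_prop)]
  simp_rw [lintegral_pathLaw_time_sq hp hp1]
  exact lintegral_sq_add_poissonMeasure α

lemma memLp_particleLaw_time (α : ℝ≥0) {p : ι → ℝ} (hp : ∀ i, 0 ≤ p i)
    (hp1 : ∑ i, p i = 1) : MemLp (fun q : (ι → ℕ) × ℝ => q.2) 2 (particleLaw α p) := by
  refine (memLp_two_iff_integrable_sq measurable_snd.aestronglyMeasurable).2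
    ⟨by fun_prop, ?_⟩
  rw [hasFiniteIntegral_iff_ofReal (Filter.Eventually.of_forall fun q => sq_nonneg _)]
  have h : ∀ᵐ q ∂(particleLaw α p), ENNReal.ofReal (q.2 ^ 2) = ENNReal.ofReal q.2 ^ 2 := by
    filter_upwards [ae_particleLaw_nonneg α p] with q hq
    exact ENNReal.ofReal_pow hq 2
  rw [lintegral_congr_ae h, lintegral_particleLaw_time_sq α hp hp1]
  exact ENNReal.add_lt_top.2 ⟨by simp, ENNReal.mul_lt_top (by simp) (by simp)⟩

lemma integral_particleLaw_time (α : ℝ≥0) {p : ι → ℝ} (hp : ∀ i, 0 ≤ p i)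
    (hp1 : ∑ i, p i = 1) : ∫ q, q.2 ∂(particleLaw α p) = α := by
  rw [integral_eq_lintegral_of_nonneg_ae (ae_particleLaw_nonneg α p)
    measurable_snd.aestronglyMeasurable, lintegral_particleLaw_time α hp hp1]
  simp

/-- Half of this variance comes from the Poisson number of terms, half from the exponentials. It is
the source of the factor 2 under the square root in the final bound. -/
lemma variance_particleLaw_time (α : ℝ≥0) {p : ι → ℝ} (hp : ∀ i, 0 ≤ p i)
    (hp1 : ∑ i, p i = 1) : variance (fun q : (ι → ℕ) × ℝ => q.2) (particleLaw α p) = 2 * α := by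
  have := isProbabilityMeasure_particleLaw α hp hp1
  rw [variance_eq_sub (memLp_particleLaw_time α hp hp1), integral_particleLaw_time α hp hp1]
  have h : ∫ q, q.2 ^ 2 ∂(particleLaw α p) = α ^ 2 + 2 * α := by
    have h : ∀ᵐ q ∂(particleLaw α p), ENNReal.ofReal (q.2 ^ 2) =
        ENNReal.ofReal q.2 ^ 2 := by
      filter_upwards [ae_particleLaw_nonneg α p] with q hq
      exact ENNReal.ofReal_pow hq 2
    rw [integral_eq_lintegral_of_nonneg_ae (Filter.Eventually.of_forall fun q => sq_nonneg _)
      (Measurable.aestronglyMeasurable (by fun_prop)), lintegral_congr_ae h,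
      lintegral_particleLaw_time_sq α hp hp1, ENNReal.toReal_add (by simp)
        (ENNReal.mul_ne_top (by simp) (by simp))]
    simp
  simp only [Pi.pow_apply]
  rw [h]
  ring

end ParticleLaw

/-! ### Resampling coordinates of product measures -/

section InfinitePi

variable {V X : Type*} [MeasurableSpace X]

lemma measurableSet_finset_pi {s : Finset V} {t : V → Set X} (ht : ∀ i, MeasurableSet (t i)) :
    MeasurableSet (Set.pi (s : Set V) t) :=
  MeasurableSet.pi s.countable_toSet fun i _ => ht i

/-- Replace the coordinates in `O` by the coordinates of another family, along `e`. -/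
def glueAlong {κ : Type*} (O : V → Prop) [DecidablePred O] (e : V → κ) (σ : κ → X) (ρ : V → X) :
    V → X :=
  fun y => if O y then σ (e y) else ρ y

lemma measurable_glueAlong {κ : Type*} (O : V → Prop) [DecidablePred O] (e : V → κ) :
    Measurable fun q : (V → X) × (κ → X) => glueAlong O e q.2 q.1 := by
  refine measurable_pi_lambda _ fun y => ?_
  unfold glueAlong
  by_cases h : O y
  · simp only [h, if_true]; fun_prop
  · simp only [h, if_false]; fun_prop

/-- Resampling a block of coordinates of a product measure. -/
lemma map_glueAlong_infinitePi {κ : Type*} [Fintype κ] (O : V → Prop) [DecidablePred O]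
    (e : V → κ) (he : ∀ y z, O y → O z → e y = e z → y = z)
    (μ₀ μ : V → Measure X) (ν : κ → Measure X) [∀ y, IsProbabilityMeasure (μ₀ y)]
    [∀ y, IsProbabilityMeasure (μ y)] [∀ j, IsProbabilityMeasure (ν j)]
    (h1 : ∀ y, O y → μ y = ν (e y)) (h2 : ∀ y, ¬ O y → μ y = μ₀ y) :
    ((Measure.infinitePi μ₀).prod (Measure.infinitePi ν)).map
      (fun q => glueAlong O e q.2 q.1) = Measure.infinitePi μ := by
  classical
  refine Measure.eq_infinitePi _ fun s t ht => ?_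
  rw [Measure.map_apply (measurable_glueAlong O e) (measurableSet_finset_pi ht)]
  -- The pulled-back box is a product of boxes. Since `e` is injective on `O`, each intersection
  -- over a fibre in the second factor involves just one site.
  have hset : (fun q : (V → X) × (κ → X) => glueAlong O e q.2 q.1) ⁻¹' (Set.pi (s : Set V) t) =
      (Set.pi ((s.filter fun y => ¬ O y : Finset V) : Set V) t) ×ˢ
        (Set.pi (((s.filter O).image e : Finset κ) : Set κ)
          fun j => ⋂ y ∈ s.filter fun y => O y ∧ e y = j, t y) := by
    ext q
    simp only [Set.mem_preimage, Set.mem_pi, Finset.mem_coe, glueAlong, Set.mem_prod,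
      Finset.mem_filter, Finset.mem_image, Set.mem_iInter]
    constructor
    · intro h
      refine ⟨fun y hy => by simpa [hy.2] using h y hy.1, ?_⟩
      rintro j - y ⟨hy, hO, rfl⟩
      simpa [hO] using h y hy
    · rintro ⟨h, h'⟩ y hy
      by_cases hO : O y
      · simpa [hO] using h' (e y) ⟨y, ⟨hy, hO⟩, rfl⟩ y ⟨hy, hO, rfl⟩
      · simpa [hO] using h y ⟨hy, hO⟩
  rw [hset, Measure.prod_prod, Measure.infinitePi_pi _ fun i _ => ht i,
    Measure.infinitePi_pi _ fun j _ => Finset.measurableSet_biInter _ fun i _ => ht i,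
    Finset.prod_image, mul_comm, ← Finset.prod_filter_mul_prod_filter_not s O]
  · congr 1
    · refine Finset.prod_congr rfl fun y hy => ?_
      obtain ⟨hy, hO⟩ := Finset.mem_filter.1 hy
      rw [h1 y hO]
      congr 1
      ext z
      simp only [Finset.mem_filter, Set.mem_iInter]
      constructor
      · exact fun h => h y ⟨hy, hO, rfl⟩
      · rintro h y' ⟨_, hO', hyy⟩
        rwa [he y' y hO' hO hyy]
    · refine Finset.prod_congr rfl fun y hy => ?_
      rw [h2 y (Finset.mem_filter.1 hy).2]
  · intro y hy z hz hyz
    exact he y z (Finset.mem_filter.1 hy).2 (Finset.mem_filter.1 hz).2 hyz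

lemma lintegral_infinitePi_glueAlong {κ : Type*} [Fintype κ] (O : V → Prop) [DecidablePred O]
    (e : V → κ) (he : ∀ y z, O y → O z → e y = e z → y = z)
    (μ₀ μ : V → Measure X) (ν : κ → Measure X) [∀ y, IsProbabilityMeasure (μ₀ y)]
    [∀ y, IsProbabilityMeasure (μ y)] [∀ j, IsProbabilityMeasure (ν j)]
    (h1 : ∀ y, O y → μ y = ν (e y)) (h2 : ∀ y, ¬ O y → μ y = μ₀ y)
    {F : (V → X) → ℝ≥0∞} (hF : Measurable F) :
    ∫⁻ ρ, ∫⁻ σ, F (glueAlong O e σ ρ) ∂(Measure.infinitePi ν) ∂(Measure.infinitePi μ₀) =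
      ∫⁻ ρ, F ρ ∂(Measure.infinitePi μ) := by
  rw [← map_glueAlong_infinitePi O e he μ₀ μ ν h1 h2,
    lintegral_map hF (measurable_glueAlong O e), lintegral_prod]
  exact (hF.comp (measurable_glueAlong O e)).aemeasurable

/-- Resampling one coordinate of a product measure. -/
lemma lintegral_infinitePi_update [DecidableEq V] (μ : V → Measure X)
    [∀ y, IsProbabilityMeasure (μ y)] (x : V) {F : (V → X) → ℝ≥0∞} (hF : Measurable F) :
    ∫⁻ ρ, ∫⁻ z, F (Function.update ρ x z) ∂(μ x) ∂(Measure.infinitePi μ) =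
      ∫⁻ ρ, F ρ ∂(Measure.infinitePi μ) := by
  have hF' : Measurable fun q : (V → X) × X => F (Function.update q.1 x q.2) := by
    refine hF.comp (measurable_pi_lambda _ fun y => ?_)
    by_cases h : y = x
    · subst h; simp only [Function.update_self]; fun_prop
    · simp only [Function.update_of_ne h]; fun_prop
  have h := lintegral_infinitePi_glueAlong (κ := Unit) (fun y => y = x) (fun _ => ())
    (fun y z hy hz _ => hy.trans hz.symm) μ μ (fun _ => μ x) (fun y hy => by rw [hy])
    (fun _ _ => rfl) hF
  rw [← h]
  refine lintegral_congr fun ρ => ?_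
  have h2 : ∀ σ : Unit → X, glueAlong (fun y => y = x) (fun _ => ()) σ ρ =
      Function.update ρ x (σ ()) := by
    intro σ
    ext y
    by_cases h : y = x
    · subst h; simp [glueAlong]
    · simp [glueAlong, h]
  simp_rw [h2]
  conv_lhs => rw [← Measure.infinitePi_map_eval (fun _ : Unit => μ x) ()]
  rw [lintegral_map (f := fun z => F (Function.update ρ x z))
    (hF'.comp measurable_prodMk_left) (measurable_pi_apply ())]

/-- Resampling the coordinate `x` detaches its factor from the product, which gives an induction on
the finite set. -/
lemma lintegral_prod_infinitePi (μ : V → Measure X) [∀ y, IsProbabilityMeasure (μ y)]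
    (s : Finset V) {g : V → X → ℝ≥0∞} (hg : ∀ x, Measurable (g x)) :
    ∫⁻ ρ, ∏ x ∈ s, g x (ρ x) ∂(Measure.infinitePi μ) = ∏ x ∈ s, ∫⁻ z, g x z ∂(μ x) := by
  classical
  induction s using Finset.induction_on with
  | empty => simp
  | insert x s hx ih =>
    have hm : ∀ s : Finset V, Measurable fun ρ : V → X => ∏ y ∈ s, g y (ρ y) := fun s =>
      Finset.measurable_prod _ fun y _ => (hg y).comp (measurable_pi_apply y)
    rw [← lintegral_infinitePi_update μ x (hm (insert x s)), Finset.prod_insert hx, ← ih]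
    have : ∀ (ρ : V → X) z, ∏ y ∈ insert x s, g y (Function.update ρ x z y) =
        g x z * ∏ y ∈ s, g y (ρ y) := by
      intro ρ z
      rw [Finset.prod_insert hx, Function.update_self]
      congr 1
      refine Finset.prod_congr rfl fun y hy => ?_
      rw [Function.update_of_ne (by rintro rfl; exact hx hy)]
    simp_rw [this, lintegral_mul_const _ (hg x)]
    rw [lintegral_const_mul _ (hm s)]

/-- A product measure whose factors are products is a product of product measures. -/
lemma map_zip_infinitePi {Y : Type*} [MeasurableSpace Y] (μ : V → Measure X) (ν : V → Measure Y)
    [∀ y, IsProbabilityMeasure (μ y)] [∀ y, IsProbabilityMeasure (ν y)] :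
    ((Measure.infinitePi μ).prod (Measure.infinitePi ν)).map (fun q x => (q.1 x, q.2 x)) =
      Measure.infinitePi fun x => (μ x).prod (ν x) := by
  refine Measure.eq_infinitePi _ fun s t ht => ?_
  have hm : Measurable fun q : (V → X) × (V → Y) => fun x => (q.1 x, q.2 x) := by fun_prop
  rw [Measure.map_apply hm (measurableSet_finset_pi ht),
    Measure.prod_apply (hm (measurableSet_finset_pi ht))]
  have h : ∀ n : V → X, (Measure.infinitePi ν) (Prod.mk n ⁻¹'
      ((fun q : (V → X) × (V → Y) => fun x => (q.1 x, q.2 x)) ⁻¹' (Set.pi (s : Set V) t))) =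
      ∏ x ∈ s, ν x (Prod.mk (n x) ⁻¹' (t x)) := by
    intro n
    rw [← Measure.infinitePi_pi ν (t := fun x => Prod.mk (n x) ⁻¹' (t x))
      fun x _ => measurable_prodMk_left (ht x)]
    rfl
  simp_rw [h]
  rw [lintegral_prod_infinitePi μ s (g := fun x z => ν x (Prod.mk z ⁻¹' (t x)))
    fun x => measurable_measure_prodMk_left (ht x)]
  refine Finset.prod_congr rfl fun x _ => ?_
  rw [Measure.prod_apply (ht x)]

end InfinitePi

/-! ### The matching in rounds: locality, and peeling off a vertex of maximal label -/

section MatchingProcess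

/-- The deterministic data of the local matching procedure: displacement probabilities `p`, their
supports `supp`, and a sampler. -/
structure MatchingData (V κ : Type*) where
  p : V → V → ℝ
  supp : V → Finset V
  sampler : (κ → ℝ) → ℕ → (κ → ℕ) → (κ → ℝ) × unitInterval → ((κ → ℕ) × ℝ) × (κ → ℕ)

/-- The local random environment: `own x y` says that the points at `y` are available to the
particles at `x`, and `rk x` enumerates the support of `p x`. -/
structure MatchingEnv (V κ : Type*) where
  own : V → V → Prop
  rk : V → V → κ

open Classical in
/-- The displacement probabilities from `x` in the enumeration `rk x`. -/
def MatchingData.rates {V κ : Type*} (D : MatchingData V κ) (rk : V → κ) (x : V) : κ → ℝ :=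
  fun j => ∑ y ∈ D.supp x, if rk y = j then D.p x y else 0

namespace MatchingEnv

variable {V κ : Type*} (D : MatchingData V κ) (E : MatchingEnv V κ) (ζ : V → ℕ × unitInterval)

open Classical in
/-- The budgets available to `x`. -/
def localBudget (x : V) (s : V → ℝ × ℕ) : κ → ℝ :=
  fun j => ∑ y ∈ D.supp x, if E.own x y ∧ E.rk x y = j then (s y).1 else 0

open Classical in
/-- The points available to `x`. -/
def localPoints (x : V) (s : V → ℝ × ℕ) : κ → ℕ :=
  fun j => ∑ y ∈ D.supp x, if E.own x y ∧ E.rk x y = j then (s y).2 else 0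

/-- The outcome of the displacement of the particles at `x` when the current state is `s`. -/
def outcome (x : V) (s : V → ℝ × ℕ) : ((κ → ℕ) × ℝ) × (κ → ℕ) :=
  D.sampler (D.rates (E.rk x) x) (ζ x).1 (E.localPoints D x s) (E.localBudget D x s, (ζ x).2)

open Classical in
/-- The state after all vertices in `A` have displaced their particles simultaneously. -/
def stepState (A : V → Prop) (s : V → ℝ × ℕ) : V → ℝ × ℕ := fun y =>
  ((s y).1 - ∑ x ∈ D.supp y, if A x ∧ E.own x y then (E.outcome D ζ x s).1.2 * D.p x y else 0,
    (∑ x ∈ D.supp y, if A x ∧ E.own x y then (E.outcome D ζ x s).2 (E.rk x y) else 0) +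
      if ∃ x ∈ D.supp y, A x ∧ E.own x y then 0 else (s y).2)

/-- The state before round `k`, when the vertices of label `k` act in round `k`. -/
def state (α : ℝ≥0) (r : V → ℕ) (l : V → ℕ) : ℕ → V → ℝ × ℕ
  | 0 => fun y => (α, r y)
  | k + 1 => E.stepState D ζ (fun x => l x = k) (state α r l k)

/-- The displacement counts and total times of all vertices with label smaller than `N`. -/
def result (α : ℝ≥0) (r : V → ℕ) (l : V → ℕ) (N : ℕ) : V → (κ → ℕ) × ℝ := fun x =>
  if l x < N then (E.outcome D ζ x (E.state D ζ α r l (l x))).1 else 0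

open Classical in
/-- The budgets left after the total times in `X` have been used. -/
def budget (α : ℝ≥0) (X : V → (κ → ℕ) × ℝ) : V → ℝ := fun y =>
  α - ∑ x ∈ D.supp y, if E.own x y then (X x).2 * D.p x y else 0

variable {D E ζ}

/-- Locality: a vertex reads only its own noise and the state at the finitely many sites it owns
within its support. -/
lemma outcome_congr {ζ' : V → ℕ × unitInterval} {x : V} {s s' : V → ℝ × ℕ} (hζ : ζ x = ζ' x)
    (h : ∀ y ∈ D.supp x, E.own x y → s y = s' y) :
    E.outcome D ζ x s = E.outcome D ζ' x s' := by
  have h1 : E.localPoints D x s = E.localPoints D x s' := by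
    ext j
    refine Finset.sum_congr rfl fun y hy => ?_
    split_ifs with ho
    · rw [h y hy ho.1]
    · rfl
  have h2 : E.localBudget D x s = E.localBudget D x s' := by
    ext j
    refine Finset.sum_congr rfl fun y hy => ?_
    split_ifs with ho
    · rw [h y hy ho.1]
    · rfl
  rw [outcome, outcome, h1, h2, hζ]

lemma stepState_congr {ζ' : V → ℕ × unitInterval} {A A' : V → Prop} {s s' : V → ℝ × ℕ} {y : V}
    (hA : ∀ x ∈ D.supp y, (A x ∧ E.own x y ↔ A' x ∧ E.own x y))
    (hζ : ∀ x ∈ D.supp y, A x → ζ x = ζ' x)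
    (hy : s y = s' y)
    (h : ∀ x ∈ D.supp y, A x → ∀ z ∈ D.supp x, E.own x z → s z = s' z) :
    E.stepState D ζ A s y = E.stepState D ζ' A' s' y := by
  have h1 : ∀ x ∈ D.supp y, A x → E.outcome D ζ x s = E.outcome D ζ' x s' :=
    fun x hx hAx => outcome_congr (hζ x hx hAx) (h x hx hAx)
  have h2 : (∃ x ∈ D.supp y, A x ∧ E.own x y) ↔ ∃ x ∈ D.supp y, A' x ∧ E.own x y :=
    exists_congr fun x => and_congr_right fun hx => hA x hx
  simp only [stepState, h2, hy]
  congr 1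
  · congr 1
    refine Finset.sum_congr rfl fun x hx => ?_
    by_cases hx' : A x ∧ E.own x y
    · rw [if_pos hx', if_pos ((hA x hx).1 hx'), h1 x hx hx'.1]
    · rw [if_neg hx', if_neg fun h => hx' ((hA x hx).2 h)]
  · congr 1
    refine Finset.sum_congr rfl fun x hx => ?_
    by_cases hx' : A x ∧ E.own x y
    · rw [if_pos hx', if_pos ((hA x hx).1 hx'), h1 x hx hx'.1]
    · rw [if_neg hx', if_neg fun h => hx' ((hA x hx).2 h)]
    · by_cases h3 : ∃ x ∈ D.supp y, A x ∧ E.own x y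
      · rw [if_pos h3, if_pos (h2.1 h3)]
      · rw [if_neg h3, if_neg fun h => h3 (h2.2 h)]

lemma stepState_of_forall_not {A : V → Prop} {s : V → ℝ × ℕ} {y : V}
    (hA : ∀ x ∈ D.supp y, ¬ (A x ∧ E.own x y)) : E.stepState D ζ A s y = s y := by
  have h2 : ¬ ∃ x ∈ D.supp y, A x ∧ E.own x y := fun ⟨x, hx, h⟩ => hA x hx h
  simp only [stepState, h2, if_false]
  rw [Finset.sum_eq_zero fun x hx => if_neg (hA x hx),
    Finset.sum_eq_zero fun x hx => if_neg (hA x hx)]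
  simp

lemma stepState_of_unique {A : V → Prop} {s : V → ℝ × ℕ} {x y : V} (hx : x ∈ D.supp y)
    (hAx : A x) (ho : E.own x y) (hu : ∀ x' ∈ D.supp y, A x' → E.own x' y → x' = x) :
    E.stepState D ζ A s y =
      ((s y).1 - (E.outcome D ζ x s).1.2 * D.p x y, (E.outcome D ζ x s).2 (E.rk x y)) := by
  have h2 : ∃ x ∈ D.supp y, A x ∧ E.own x y := ⟨x, hx, hAx, ho⟩
  simp only [stepState, h2, if_true]
  rw [Finset.sum_eq_single_of_mem x hx fun x' hx' hne => if_neg fun h => hne (hu x' hx' h.1 h.2),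
    Finset.sum_eq_single_of_mem x hx fun x' hx' hne => if_neg fun h => hne (hu x' hx' h.1 h.2)]
  simp [hAx, ho]

variable {α : ℝ≥0} {r : V → ℕ} {l : V → ℕ} {N : ℕ}

lemma state_congr {ζ' : V → ℕ × unitInterval} {l' : V → ℕ} {k : ℕ}
    (hl : ∀ x, ∀ j < k, l x = j ↔ l' x = j) (hζ : ∀ x, l x < k → ζ x = ζ' x) :
    E.state D ζ α r l k = E.state D ζ' α r l' k := by
  induction k with
  | zero => rfl
  | succ k ih =>
    have ih' := ih (fun x j hj => hl x j (by omega)) (fun x hx => hζ x (by omega))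
    ext1 y
    simp only [state]
    rw [ih']
    exact stepState_congr (fun x _ => by rw [hl x k (by omega)])
      (fun x _ hx => hζ x (by omega)) rfl fun _ _ _ _ _ _ => rfl

/-- The hypothesis says that no label lies in the interval from `k` to `m`, so in these rounds
nobody acts. -/
lemma state_eq_of_le {k m : ℕ} (hkm : k ≤ m) (hl : ∀ x, k ≤ l x → m ≤ l x) :
    E.state D ζ α r l m = E.state D ζ α r l k := by
  induction m, hkm using Nat.le_induction with
  | base => rfl
  | succ m hkm ih =>
    rw [← ih fun x hx => by have := hl x hx; omega]
    ext1 y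
    simp only [state]
    exact stepState_of_forall_not fun x _ h => by have := hl x (by omega); omega

/-- The vertices with labels below `N` own disjoint sets of sites in each round. -/
structure IsAdmissible (D : MatchingData V κ) (E : MatchingEnv V κ) (l : V → ℕ) (N : ℕ) :
    Prop where
  mem_supp : ∀ {x y}, E.own x y → y ∈ D.supp x
  mem_supp' : ∀ {x y}, E.own x y → x ∈ D.supp y
  unique : ∀ {x x' y}, E.own x y → E.own x' y → l x < N → l x = l x' → x = x'

/-- The budget is a function of the total times alone. Hence the pair of results and remaining
points carries the whole state, which is what makes the later induction close. -/
lemma state_budget (k : ℕ) (hk : k ≤ N) (y : V) :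
    (E.state D ζ α r l k y).1 = E.budget D α (E.result D ζ α r l k) y := by
  classical
  induction k with
  | zero => simp [state, budget, result]
  | succ k ih =>
    have ih := ih (by omega)
    simp only [state, stepState, ih, budget, sub_sub, ← Finset.sum_add_distrib]
    congr 1
    refine Finset.sum_congr rfl fun x hx => ?_
    simp only [result]
    by_cases ho : E.own x y
    · rcases lt_trichotomy (l x) k with h1 | h1 | h1
      · simp [ho, h1, h1.ne, Nat.lt_succ_of_lt h1]
      · simp [ho, h1]
      · simp [ho, h1.ne', not_lt.2 h1.le, not_lt.2 (Nat.succ_le_of_lt h1)]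
    · simp [ho]

section Peel

variable [DecidableEq V] {x : V} (hE : E.IsAdmissible D l N) (hx : l x < N)
  (hmax : ∀ x', l x' < N → l x' ≤ l x)

include hE hx hmax

/-- Giving `x` the label `N` silences it. By maximality the rounds after `l x` are then empty, and
in round `l x` no other vertex owns a site of `x`. On its own sites `x` therefore sees the same
state whether it acts in its round or after everybody else. -/
lemma state_update_eq_of_own {y : V} (hy : E.own x y) :
    E.state D ζ α r (Function.update l x N) N y = E.state D ζ α r l (l x) y := by
  have h1 : E.state D ζ α r (Function.update l x N) N =
      E.state D ζ α r (Function.update l x N) (l x + 1) := by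
    refine state_eq_of_le hx fun x' hx' => ?_
    by_cases h : x' = x
    · subst h; simp
    · rw [Function.update_of_ne h] at hx' ⊢
      by_contra hlt
      have := hmax x' (by omega)
      omega
  have h2 : E.state D ζ α r (Function.update l x N) (l x) = E.state D ζ α r l (l x) := by
    refine state_congr (fun x' j hj => ?_) fun _ _ => rfl
    by_cases h : x' = x
    · subst h; simp only [Function.update_self]; omega
    · rw [Function.update_of_ne h]
  rw [h1]
  simp only [state]
  rw [h2]
  refine stepState_of_forall_not fun x' _ h => ?_
  by_cases hxx : x' = x
  · subst hxx; simp only [Function.update_self] at h; omega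
  · rw [Function.update_of_ne hxx] at h
    exact hxx (hE.unique h.2 hy (by omega) h.1)

lemma outcome_update : E.outcome D ζ x (E.state D ζ α r (Function.update l x N) N) =
    E.outcome D ζ x (E.state D ζ α r l (l x)) :=
  outcome_congr rfl fun _ _ hy => state_update_eq_of_own hE hx hmax hy

/-- Acting last, `x` replaces the points on the sites it owns by what its sampler leaves and touches
nothing else. -/
lemma state_eq_glueAlong [DecidablePred (E.own x)] :
    (fun y => (E.state D ζ α r l N y).2) = glueAlong (E.own x) (E.rk x)
      (E.outcome D ζ x (E.state D ζ α r (Function.update l x N) N)).2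
      (fun y => (E.state D ζ α r (Function.update l x N) N y).2) := by
  have h0 : ∀ x', l x + 1 ≤ l x' → N ≤ l x' := fun x' hx' => by
    by_contra hlt
    have := hmax x' (by omega)
    omega
  have h1 : E.state D ζ α r (Function.update l x N) N =
      E.state D ζ α r (Function.update l x N) (l x + 1) := by
    refine state_eq_of_le hx fun x' hx' => ?_
    by_cases h : x' = x
    · subst h; simp
    · rw [Function.update_of_ne h] at hx' ⊢
      exact h0 x' hx'
  have h2 : E.state D ζ α r (Function.update l x N) (l x) = E.state D ζ α r l (l x) := by
    refine state_congr (fun x' j hj => ?_) fun _ _ => rfl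
    by_cases h : x' = x
    · subst h; simp only [Function.update_self]; omega
    · rw [Function.update_of_ne h]
  ext1 y
  rw [state_eq_of_le hx h0]
  by_cases hy : E.own x y
  · rw [outcome_update hE hx hmax]
    simp only [glueAlong, hy, if_true, state]
    rw [stepState_of_unique (A := fun x' => l x' = l x) (hE.mem_supp' hy) rfl hy fun x' _ (h : l x' = l x) ho =>
      hE.unique ho hy (by omega) h]
  · simp only [glueAlong, hy, if_false]
    rw [h1]
    simp only [state]
    rw [h2, stepState_congr (A' := fun x' => Function.update l x N x' = l x) (fun x' _ => ?_)
      (fun _ _ _ => rfl) rfl fun _ _ _ _ _ _ => rfl]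
    by_cases h : x' = x
    · subst h; simp [hy]
    · rw [Function.update_of_ne h]

/-- Since `x` has maximal label, no other vertex acts in a later round, so its action influences no
other outcome. -/
lemma result_eq_update : E.result D ζ α r l N =
    Function.update (E.result D ζ α r (Function.update l x N) N) x
      (E.outcome D ζ x (E.state D ζ α r (Function.update l x N) N)).1 := by
  ext1 x'
  by_cases h : x' = x
  · subst h
    rw [Function.update_self, outcome_update hE hx hmax, result, if_pos hx]
  · rw [Function.update_of_ne h, result, result, Function.update_of_ne h]
    split_ifs with hlt
    · rw [state_congr (l' := Function.update l x N) (fun x'' j hj => ?_) fun _ _ => rfl]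
      by_cases h' : x'' = x
      · subst h'
        have := hmax x' hlt
        simp only [Function.update_self]
        omega
      · rw [Function.update_of_ne h']
    · rfl

end Peel

/-- The noise of a silent vertex is never read; it remains fresh for the moment when that vertex is
made to act last. -/
lemma result_update_noise [DecidableEq V] {x : V} (hx : ¬ l x < N) (z : ℕ × unitInterval) :
    E.result D (Function.update ζ x z) α r l N = E.result D ζ α r l N := by
  ext1 x'
  rw [result, result]
  split_ifs with h
  · have hne : ∀ x', l x' < N → x' ≠ x := by rintro _ h rfl; exact hx h
    rw [state_congr (ζ' := ζ) (fun _ _ _ => Iff.rfl) fun x'' hx'' =>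
      Function.update_of_ne (hne x'' (hx''.trans h)) _ _]
    rw [outcome_congr (ζ' := ζ) (Function.update_of_ne (hne x' h) _ _) fun _ _ _ => rfl]
  · rfl

lemma state_update_noise [DecidableEq V] {x : V} (hx : ¬ l x < N) (z : ℕ × unitInterval) :
    E.state D (Function.update ζ x z) α r l N = E.state D ζ α r l N :=
  state_congr (fun _ _ _ => Iff.rfl) fun x'' hx'' =>
    Function.update_of_ne (by rintro rfl; exact hx hx'') _ _

open Classical in
/-- The state at a vertex is the one obtained when only finitely many vertices act. -/
lemma eventually_state_eq (D : MatchingData V κ) (E : MatchingEnv V κ) (α : ℝ≥0) (l : V → ℕ)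
    (k : ℕ) (hk : k ≤ N) (y : V) :
    ∀ᶠ A : Finset V in Filter.atTop, ∀ ζ r,
      E.state D ζ α r (fun x => if x ∈ A then l x else N) k y = E.state D ζ α r l k y := by
  induction k generalizing y with
  | zero => exact Filter.Eventually.of_forall fun _ _ _ => rfl
  | succ k ih =>
    have ih := fun y => ih (by omega) y
    have h1 : ∀ᶠ A : Finset V in Filter.atTop, ∀ x ∈ D.supp y, x ∈ A :=
      (Filter.eventually_ge_atTop (D.supp y)).mono fun A hA x hx => hA hx
    have h2 : ∀ᶠ A : Finset V in Filter.atTop, ∀ x ∈ D.supp y, ∀ z ∈ D.supp x, ∀ ζ r,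
        E.state D ζ α r (fun x => if x ∈ A then l x else N) k z = E.state D ζ α r l k z :=
      (Filter.eventually_all_finset _).2 fun x _ => (Filter.eventually_all_finset _).2 fun z _ =>
        ih z
    filter_upwards [h1, h2, ih y] with A hA1 hA2 hA3 ζ r
    exact stepState_congr (fun x hx => by simp [hA1 x hx]) (fun _ _ _ => rfl) (hA3 ζ r)
      fun x hx _ z hz _ => hA2 x hx z hz ζ r

open Classical in
lemma eventually_result_eq (D : MatchingData V κ) (E : MatchingEnv V κ) (α : ℝ≥0) {l : V → ℕ}
    (hl : ∀ x, l x < N) (x : V) :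
    ∀ᶠ A : Finset V in Filter.atTop, ∀ ζ r,
      E.result D ζ α r (fun x => if x ∈ A then l x else N) N x = E.result D ζ α r l N x := by
  have h2 : ∀ᶠ A : Finset V in Filter.atTop, ∀ z ∈ D.supp x, ∀ ζ r,
      E.state D ζ α r (fun x => if x ∈ A then l x else N) (l x) z = E.state D ζ α r l (l x) z :=
    (Filter.eventually_all_finset _).2 fun z _ => eventually_state_eq D E α l _ (hl x).le z
  filter_upwards [h2, Filter.eventually_ge_atTop {x}] with A hA hx ζ r
  have hx : x ∈ A := hx (Finset.mem_singleton_self x)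
  simp only [result, hx, if_true, hl x]
  rw [outcome_congr rfl fun z hz _ => hA z hz ζ r]

/-- Every initial point at `o` is either used by an owner of `o` or left at the end. -/
lemma le_state_add_sum
    (hF : ∀ p n b q, b ≤ (D.sampler p n b q).1.1 + (D.sampler p n b q).2)
    (h : ∀ {x y}, E.own x y → y ∈ D.supp x) (o : V) (k : ℕ) :
    r o ≤ (E.state D ζ α r l k o).2 +
      ∑ x ∈ D.supp o, (E.result D ζ α r l k x).1 (E.rk x o) := by
  classical
  induction k with
  | zero => simp [state]
  | succ k ih =>
    refine ih.trans ?_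
    have hmono : ∀ x ∈ D.supp o, (E.result D ζ α r l k x).1 (E.rk x o) +
        (if l x = k ∧ E.own x o then
          (E.outcome D ζ x (E.state D ζ α r l k)).1.1 (E.rk x o) else 0) ≤
        (E.result D ζ α r l (k + 1) x).1 (E.rk x o) := by
      intro x _
      simp only [result]
      rcases lt_trichotomy (l x) k with h1 | h1 | h1
      · simp [h1, h1.ne, Nat.lt_succ_of_lt h1]
      · subst h1
        simp only [lt_irrefl, if_false, Nat.lt_succ_self, if_true, true_and]
        split_ifs <;> simp
      · simp [h1.ne', not_lt.2 h1.le, not_lt.2 (Nat.succ_le_of_lt h1)]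
    refine le_trans ?_ (Nat.add_le_add_left (Finset.sum_le_sum hmono) _)
    rw [Finset.sum_add_distrib]
    suffices hs : (E.state D ζ α r l k o).2 ≤ (E.state D ζ α r l (k + 1) o).2 +
        ∑ x ∈ D.supp o, (if l x = k ∧ E.own x o then
          (E.outcome D ζ x (E.state D ζ α r l k)).1.1 (E.rk x o) else 0) by omega
    simp only [state, stepState]
    by_cases hex : ∃ x ∈ D.supp o, l x = k ∧ E.own x o
    · simp only [hex, if_true, add_zero]
      rw [← Finset.sum_add_distrib]
      obtain ⟨x, hx, hlx, hox⟩ := hex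
      refine le_trans ?_ (Finset.single_le_sum (fun _ _ => Nat.zero_le _) hx)
      simp only [hlx, hox, and_self, if_true]
      have h1 := hF (D.rates (E.rk x) x) (ζ x).1 (E.localPoints D x (E.state D ζ α r l k))
        (E.localBudget D x (E.state D ζ α r l k), (ζ x).2) (E.rk x o)
      rw [add_comm] at h1
      refine le_trans ?_ h1
      have h2 := Finset.single_le_sum (f := fun y => if E.own x y ∧ E.rk x y = E.rk x o then
        (E.state D ζ α r l k y).2 else 0) (fun _ _ => Nat.zero_le _) (h hox)
      simpa [hox, localPoints] using h2
    · simp only [hex, if_false]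
      omega

end MatchingEnv

end MatchingProcess

/-! ### Measurability and equivariance of the process -/

section ProcessMeasurable

namespace MatchingEnv

variable {V κ : Type*} [Finite κ] [MeasurableSpace κ] [DiscreteMeasurableSpace κ]
  {D : MatchingData V κ} {Ω₀ : Type*} [MeasurableSpace Ω₀] {E : Ω₀ → MatchingEnv V κ}
  {ζ : Ω₀ → V → ℕ × unitInterval} {r l : Ω₀ → V → ℕ} {α : ℝ≥0}

/-- A measurable random environment. -/
structure IsMeasurable (E : Ω₀ → MatchingEnv V κ) : Prop where
  own : ∀ x y, MeasurableSet {w | (E w).own x y}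
  rk : ∀ x y, Measurable fun w => (E w).rk x y

lemma measurable_outcome (hF : ∀ p n b, Measurable (D.sampler p n b)) (hE : IsMeasurable E)
    (hζ : ∀ x, Measurable fun w => ζ w x) {s : Ω₀ → V → ℝ × ℕ}
    (hs : ∀ y, Measurable fun w => s w y) (x : V) :
    Measurable fun w => (E w).outcome D (ζ w) x (s w) := by
  classical
  have := Fintype.ofFinite κ
  have hset : ∀ y j, MeasurableSet {w | (E w).own x y ∧ (E w).rk x y = j} := fun y j =>
    (hE.own x y).inter ((hE.rk x y) (measurableSet_singleton j))
  have hb : Measurable fun w => (E w).localBudget D x (s w) := by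
    refine measurable_pi_lambda _ fun j => Finset.measurable_sum _ fun y _ => ?_
    exact Measurable.ite (hset y j) (measurable_fst.comp (hs y)) measurable_const
  have hr : Measurable fun w => (E w).localPoints D x (s w) := by
    refine measurable_pi_lambda _ fun j => Finset.measurable_sum _ fun y _ => ?_
    exact Measurable.ite (hset y j) (measurable_snd.comp (hs y)) measurable_const
  have hrk : Measurable fun w => fun y : D.supp x => (E w).rk x y :=
    measurable_pi_lambda _ fun y => hE.rk x y
  -- The sampler is known to be measurable only for fixed rates, particle number and points. The
  -- rates factor through the finitely many enumerations of the support, so all three range over a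
  -- countable set and measurability can be checked slice by slice.
  let R : (D.supp x → κ) → κ → ℝ := fun f j => ∑ y : D.supp x, if f y = j then D.p x y else 0
  have hR : ∀ w, R (fun y : D.supp x => (E w).rk x y) = D.rates ((E w).rk x) x := by
    intro w
    ext j
    exact Finset.sum_coe_sort (D.supp x) fun y => if (E w).rk x y = j then D.p x y else 0
  have hG : Measurable fun q : ((D.supp x → κ) × ℕ × (κ → ℕ)) × (κ → ℝ) × unitInterval =>
      D.sampler (R q.1.1) q.1.2.1 q.1.2.2 q.2 :=
    measurable_from_prod_countable_right fun c => hF (R c.1) c.2.1 c.2.2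
  have h := hG.comp ((hrk.prodMk ((measurable_fst.comp (hζ x)).prodMk hr)).prodMk
    (hb.prodMk (measurable_snd.comp (hζ x))))
  simp only [outcome, ← hR]
  exact h

lemma measurable_stepState (hF : ∀ p n b, Measurable (D.sampler p n b)) (hE : IsMeasurable E)
    (hζ : ∀ x, Measurable fun w => ζ w x) {s : Ω₀ → V → ℝ × ℕ}
    (hs : ∀ y, Measurable fun w => s w y) {A : Ω₀ → V → Prop}
    (hA : ∀ x, MeasurableSet {w | A w x}) (y : V) :
    Measurable fun w => (E w).stepState D (ζ w) (A w) (s w) y := by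
  classical
  have ho := fun x => measurable_outcome hF hE hζ hs x
  have hset : ∀ x, MeasurableSet {w | A w x ∧ (E w).own x y} := fun x => (hA x).inter (hE.own x y)
  have hex : MeasurableSet {w | ∃ x ∈ D.supp y, A w x ∧ (E w).own x y} := by
    have : {w | ∃ x ∈ D.supp y, A w x ∧ (E w).own x y} =
        ⋃ x ∈ D.supp y, {w | A w x ∧ (E w).own x y} := by
      ext w
      simp only [Set.mem_ofPred_eq, Set.mem_iUnion, exists_prop]
    rw [this]
    exact Finset.measurableSet_biUnion _ fun x _ => hset x
  have hr : ∀ x, Measurable fun w => ((E w).outcome D (ζ w) x (s w)).2 ((E w).rk x y) := fun x =>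
    (measurable_from_prod_countable_right (f := fun q : κ × (κ → ℕ) => q.2 q.1)
      fun j => measurable_pi_apply j).comp ((hE.rk x y).prodMk (measurable_snd.comp (ho x)))
  refine Measurable.prodMk ?_ ?_
  · refine (measurable_fst.comp (hs y)).sub (Finset.measurable_sum _ fun x _ => ?_)
    exact Measurable.ite (hset x) ((measurable_snd.comp (measurable_fst.comp (ho x))).mul_const _)
      measurable_const
  · refine (Finset.measurable_sum _ fun x _ => ?_).add
      (Measurable.ite hex measurable_const (measurable_snd.comp (hs y)))
    exact Measurable.ite (hset x) (hr x) measurable_const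

lemma measurable_state (hF : ∀ p n b, Measurable (D.sampler p n b)) (hE : IsMeasurable E)
    (hζ : ∀ x, Measurable fun w => ζ w x) (hr : ∀ y, Measurable fun w => r w y)
    (hl : ∀ x, Measurable fun w => l w x) (k : ℕ) (y : V) :
    Measurable fun w => (E w).state D (ζ w) α (r w) (l w) k y := by
  induction k generalizing y with
  | zero => exact measurable_const.prodMk (hr y)
  | succ k ih =>
    exact measurable_stepState hF hE hζ ih (fun x => hl x (measurableSet_singleton k)) y

lemma measurable_result (hF : ∀ p n b, Measurable (D.sampler p n b)) (hE : IsMeasurable E)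
    (hζ : ∀ x, Measurable fun w => ζ w x) (hr : ∀ y, Measurable fun w => r w y)
    (hl : ∀ x, Measurable fun w => l w x) (N : ℕ) (x : V) :
    Measurable fun w => (E w).result D (ζ w) α (r w) (l w) N x := by
  have h : Measurable fun q : ℕ × Ω₀ =>
      (E q.2).outcome D (ζ q.2) x ((E q.2).state D (ζ q.2) α (r q.2) (l q.2) q.1) :=
    measurable_from_prod_countable_right fun k =>
      measurable_outcome hF hE hζ (fun y => measurable_state hF hE hζ hr hl k y) x
  refine Measurable.ite ?_ (measurable_fst.comp (h.comp ((hl x).prodMk measurable_id)))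
    measurable_const
  exact hl x (Set.to_countable (Set.Iio N)).measurableSet

/-! ### Equivariance -/

section Equivariance

variable {φ : V ≃ V} {E E' : MatchingEnv V κ} {ζ ζ' : V → ℕ × unitInterval} {r r' l l' : V → ℕ}

/-- The environment `E'` is the image of the environment `E` under `φ`. -/
structure IsImage (D : MatchingData V κ) (φ : V ≃ V) (E E' : MatchingEnv V κ) : Prop where
  supp : ∀ x, D.supp (φ x) = (D.supp x).map φ.toEmbedding
  p : ∀ x y, D.p (φ x) (φ y) = D.p x y
  own : ∀ x y, E'.own (φ x) (φ y) ↔ E.own x y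
  rk : ∀ x y, E'.rk (φ x) (φ y) = E.rk x y

/-- The sampler sees a vertex only through slot-indexed sums over its support, and these are
unchanged when an automorphism relabels the sites. -/
lemma outcome_image (h : IsImage D φ E E') (hζ : ∀ x, ζ' (φ x) = ζ x) {s s' : V → ℝ × ℕ}
    (hs : ∀ y, s' (φ y) = s y) (x : V) :
    E'.outcome D ζ' (φ x) s' = E.outcome D ζ x s := by
  classical
  have h1 : E'.localPoints D (φ x) s' = E.localPoints D x s := by
    ext j
    simp only [localPoints, h.supp, Finset.sum_map, Equiv.coe_toEmbedding, h.own, h.rk, hs]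
  have h2 : E'.localBudget D (φ x) s' = E.localBudget D x s := by
    ext j
    simp only [localBudget, h.supp, Finset.sum_map, Equiv.coe_toEmbedding, h.own, h.rk, hs]
  have h3 : D.rates (E'.rk (φ x)) (φ x) = D.rates (E.rk x) x := by
    ext j
    simp only [MatchingData.rates, h.supp, Finset.sum_map, Equiv.coe_toEmbedding, h.rk, h.p]
  rw [outcome, outcome, h1, h2, h3, hζ]

lemma state_image (h : IsImage D φ E E') (hζ : ∀ x, ζ' (φ x) = ζ x) (hr : ∀ x, r' (φ x) = r x)
    (hl : ∀ x, l' (φ x) = l x) (k : ℕ) (y : V) :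
    E'.state D ζ' α r' l' k (φ y) = E.state D ζ α r l k y := by
  classical
  induction k generalizing y with
  | zero => simp [state, hr]
  | succ k ih =>
    have ho := outcome_image h hζ ih
    have hex : (∃ x ∈ D.supp (φ y), l' x = k ∧ E'.own x (φ y)) ↔
        ∃ x ∈ D.supp y, l x = k ∧ E.own x y := by
      constructor
      · rintro ⟨x, hx, h1, h2⟩
        rw [h.supp, Finset.mem_map] at hx
        obtain ⟨z, hz, rfl⟩ := hx
        exact ⟨z, hz, (hl z).symm.trans h1, (h.own z y).1 h2⟩
      · rintro ⟨x, hx, h1, h2⟩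
        refine ⟨φ x, ?_, (hl x).trans h1, (h.own x y).2 h2⟩
        rw [h.supp]
        exact Finset.mem_map_of_mem _ hx
    simp only [state, stepState, hex, ih]
    simp only [h.supp y, Finset.sum_map, Equiv.coe_toEmbedding, hl, h.own, ho, h.p, h.rk]
    congr!

lemma result_image (h : IsImage D φ E E') (hζ : ∀ x, ζ' (φ x) = ζ x) (hr : ∀ x, r' (φ x) = r x)
    (hl : ∀ x, l' (φ x) = l x) (N : ℕ) (x : V) :
    E'.result D ζ' α r' l' N (φ x) = E.result D ζ α r l N x := by
  simp only [result, hl, outcome_image h hζ (fun y => state_image h hζ hr hl _ y)]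

end Equivariance

end MatchingEnv

end ProcessMeasurable

/-! ### The law of the process when finitely many vertices act -/

section ProcessLaw

/-- Needed for the slots of the enumeration that carry no owned site: there the budget is zero and
so must be the number of points. -/
lemma ae_poissonField_eq_zero {ι : Type*} (b : ι → ℝ) {j : ι} (hj : b j = 0) :
    ∀ᵐ σ ∂(poissonField b), σ j = 0 := by
  have h0 : ∀ᵐ n ∂(poissonMeasure (b j).toNNReal), n = 0 := by
    change {0} ∈ ae _
    rw [mem_ae_iff_prob_eq_one MeasurableSet.of_discrete, hj, poissonMeasure_singleton]
    simp
  exact (measurePreserving_eval_infinitePi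
    (fun i => poissonMeasure (b i).toNNReal) j).quasiMeasurePreserving.ae h0

namespace MatchingEnv

variable {V κ : Type*} [DecidableEq V] [Fintype κ] [DecidableEq κ] [MeasurableSpace κ]
  [DiscreteMeasurableSpace κ]
  {D : MatchingData V κ} {E : MatchingEnv V κ} {α : ℝ≥0} {l : V → ℕ} {N : ℕ}

/-- Forget the entries of vertices which do not act. -/
def truncate (l : V → ℕ) (N : ℕ) (X : V → (κ → ℕ) × ℝ) : V → (κ → ℕ) × ℝ := fun x =>
  if l x < N then X x else 0

/-- The environment enumerates the supports and the sampler has the right law. -/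
structure IsFaithful (D : MatchingData V κ) (E : MatchingEnv V κ) : Prop where
  measurable : ∀ p n b, Measurable (D.sampler p n b)
  injOn : ∀ x, Set.InjOn (E.rk x) (D.supp x)
  nonneg : ∀ x j, 0 ≤ D.rates (E.rk x) x j
  sum_eq_one : ∀ x, ∑ j, D.rates (E.rk x) x j = 1
  lintegral_sampler : ∀ x n b (F : ((κ → ℕ) × ℝ) × (κ → ℕ) → ℝ≥0∞), Measurable F →
    ∫⁻ r, ∫⁻ v, F (D.sampler (D.rates (E.rk x) x) n r (b, v)) ∂volume ∂(poissonField b) =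
      ∫⁻ q, ∫⁻ r, F (q, r) ∂(poissonField fun j => b j - q.2 * D.rates (E.rk x) x j)
        ∂(pathLaw (D.rates (E.rk x) x) n)

lemma rates_rk (h : IsFaithful D E) {x y : V} (hy : y ∈ D.supp x) :
    D.rates (E.rk x) x (E.rk x y) = D.p x y := by
  refine (Finset.sum_eq_single_of_mem y hy fun z hz hne =>
    if_neg fun h' => hne (h.injOn x hz hy h')).trans ?_
  simp

lemma localBudget_rk (h : IsFaithful D E) {x y : V} (hy : y ∈ D.supp x) (ho : E.own x y)
    (s : V → ℝ × ℕ) : E.localBudget D x s (E.rk x y) = (s y).1 := by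
  rw [localBudget, Finset.sum_eq_single_of_mem y hy fun z hz hne =>
    if_neg fun h' => hne (h.injOn x hz hy h'.2)]
  simp [ho]

lemma localPoints_rk (h : IsFaithful D E) {x y : V} (hy : y ∈ D.supp x) (ho : E.own x y)
    (s : V → ℝ × ℕ) : E.localPoints D x s (E.rk x y) = (s y).2 := by
  rw [localPoints, Finset.sum_eq_single_of_mem y hy fun z hz hne =>
    if_neg fun h' => hne (h.injOn x hz hy h'.2)]
  simp [ho]

lemma localBudget_eq_zero {x : V} {j : κ} (hj : ∀ y ∈ D.supp x, ¬ (E.own x y ∧ E.rk x y = j))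
    (s : V → ℝ × ℕ) : E.localBudget D x s j = 0 :=
  Finset.sum_eq_zero fun y hy => if_neg (hj y hy)

lemma localPoints_eq_zero {x : V} {j : κ} (hj : ∀ y ∈ D.supp x, ¬ (E.own x y ∧ E.rk x y = j))
    (s : V → ℝ × ℕ) : E.localPoints D x s j = 0 :=
  Finset.sum_eq_zero fun y hy => if_neg (hj y hy)

lemma budget_update_of_own {x y : V} (hx : x ∈ D.supp y) (ho : E.own x y)
    {X : V → (κ → ℕ) × ℝ} (hX : X x = 0) (q : (κ → ℕ) × ℝ) :
    E.budget D α (Function.update X x q) y = E.budget D α X y - q.2 * D.p x y := by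
  classical
  rw [budget, budget, ← Finset.add_sum_erase _ _ hx, ← Finset.add_sum_erase _ _ hx]
  have h : ∀ x' ∈ (D.supp y).erase x, (if E.own x' y then (Function.update X x q x').2 * D.p x' y
      else 0) = if E.own x' y then (X x').2 * D.p x' y else 0 := fun x' hx' => by
    rw [Function.update_of_ne (Finset.ne_of_mem_erase hx')]
  rw [Finset.sum_congr rfl h]
  simp [ho, hX]
  ring

lemma budget_update_of_not_own {x y : V} (ho : ¬ E.own x y)
    (X : V → (κ → ℕ) × ℝ) (q : (κ → ℕ) × ℝ) :
    E.budget D α (Function.update X x q) y = E.budget D α X y := by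
  classical
  rw [budget, budget]
  congr 1
  refine Finset.sum_congr rfl fun x' _ => ?_
  by_cases h : x' = x
  · subst h; simp [ho]
  · rw [Function.update_of_ne h]

lemma measurable_budget (D : MatchingData V κ) (E : MatchingEnv V κ) (α : ℝ≥0) (y : V) :
    Measurable fun X => E.budget D α X y := by
  classical
  refine measurable_const.sub (Finset.measurable_sum _ fun x _ => ?_)
  split_ifs <;> fun_prop

lemma measurable_budget_pi (D : MatchingData V κ) (E : MatchingEnv V κ) (α : ℝ≥0) :
    Measurable fun X => E.budget D α X :=
  measurable_pi_lambda _ fun y => measurable_budget D E α y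

lemma measurable_update_pi {X : V → Type*} [∀ y, MeasurableSpace (X y)] (x : V) :
    Measurable fun q : (∀ y, X y) × X x => Function.update q.1 x q.2 := by
  refine measurable_pi_lambda _ fun y => ?_
  by_cases h : y = x
  · subst h; simp only [Function.update_self]; fun_prop
  · simp only [Function.update_of_ne h]; fun_prop

/-- One vertex with `n` particles acts. -/
lemma lintegral_outcome_step (h : IsFaithful D E) {x : V} [DecidablePred (E.own x)]
    (hs : ∀ {y}, E.own x y → y ∈ D.supp x) (hs' : ∀ {y}, E.own x y → x ∈ D.supp y)
    {X : V → (κ → ℕ) × ℝ} (hX : X x = 0) (n : ℕ)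
    {G : (V → (κ → ℕ) × ℝ) × (V → ℕ) → ℝ≥0∞} (hG : Measurable G) :
    ∫⁻ ρ, ∫⁻ v, G (Function.update X x
        (E.outcome D (fun _ => (n, v)) x fun y => (E.budget D α X y, ρ y)).1,
        glueAlong (E.own x) (E.rk x)
          (E.outcome D (fun _ => (n, v)) x fun y => (E.budget D α X y, ρ y)).2 ρ) ∂volume
        ∂(poissonField (E.budget D α X)) =
      ∫⁻ q, ∫⁻ ρ, G (Function.update X x q, ρ)
        ∂(poissonField (E.budget D α (Function.update X x q)))
        ∂(pathLaw (D.rates (E.rk x) x) n) := by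
  have hp := isProbabilityMeasure_pathLaw (h.nonneg x) (h.sum_eq_one x) n
  set P := D.rates (E.rk x) x with hP
  set b := E.budget D α X with hb
  set b' : κ → ℝ := E.localBudget D x fun y => (b y, 0) with hb'
  have hinj : ∀ y z, E.own x y → E.own x z → E.rk x y = E.rk x z → y = z := fun y z hy hz =>
    fun e => h.injOn x (hs hy) (hs hz) e
  have hm1 : Measurable fun q : ((V → ℕ) × (κ → ℕ)) × unitInterval =>
      D.sampler P n q.1.2 (b', q.2) := by
    have : Measurable fun q : (κ → ℕ) × unitInterval => D.sampler P n q.1 (b', q.2) :=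
      measurable_from_prod_countable_right fun c => (h.measurable P n c).comp measurable_prodMk_left
    exact this.comp (f := fun q : ((V → ℕ) × (κ → ℕ)) × unitInterval => (q.1.2, q.2))
      (by fun_prop)
  have hglue := measurable_glueAlong (X := ℕ) (E.own x) (E.rk x)
  have hupd := measurable_update_pi (X := fun _ : V => (κ → ℕ) × ℝ) x
  have hpts : Measurable fun ρ : V → ℕ => E.localPoints D x fun y => (b y, ρ y) := by
    refine measurable_pi_lambda _ fun j => Finset.measurable_sum _ fun y _ => ?_
    split_ifs <;> fun_prop
  -- the integrand as a function of the local points and the field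
  let Φ : (V → ℕ) × (κ → ℕ) → ℝ≥0∞ := fun q => ∫⁻ v, G (Function.update X x
    (D.sampler P n q.2 (b', v)).1, glueAlong (E.own x) (E.rk x) (D.sampler P n q.2 (b', v)).2 q.1)
  have hΦ : Measurable Φ := by
    refine Measurable.lintegral_prod_right' (f := fun q : ((V → ℕ) × (κ → ℕ)) × unitInterval =>
      G (Function.update X x (D.sampler P n q.1.2 (b', q.2)).1,
        glueAlong (E.own x) (E.rk x) (D.sampler P n q.1.2 (b', q.2)).2 q.1.1)) ?_
    refine hG.comp (Measurable.prodMk ?_ ?_)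
    · exact hupd.comp (measurable_const.prodMk (measurable_fst.comp hm1))
    · exact hglue.comp ((measurable_fst.comp measurable_fst).prodMk (measurable_snd.comp hm1))
  have hstart : ∀ ρ : V → ℕ, ∫⁻ v, G (Function.update X x
        (E.outcome D (fun _ => (n, v)) x fun y => (b y, ρ y)).1,
        glueAlong (E.own x) (E.rk x)
          (E.outcome D (fun _ => (n, v)) x fun y => (b y, ρ y)).2 ρ) ∂volume =
      Φ (ρ, E.localPoints D x fun y => (b y, ρ y)) := fun ρ => rfl
  simp_rw [hstart]
  -- Replace the field on the owned sites by an independent copy read from the slots of `κ`: the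
  -- sampler can then be applied to the slot field, with the other sites frozen.
  have hres : ∀ f : (V → ℕ) → ℝ≥0∞, Measurable f → ∫⁻ ρ, f ρ ∂(poissonField b) =
      ∫⁻ ρ, ∫⁻ σ, f (glueAlong (E.own x) (E.rk x) σ ρ) ∂(poissonField b') ∂(poissonField b) := by
    intro f hf
    refine (lintegral_infinitePi_glueAlong (E.own x) (E.rk x) hinj _ _ _ (fun y hy => ?_)
      (fun _ _ => rfl) hf).symm
    rw [hb', localBudget_rk h (hs hy) hy]
  rw [hres (fun ρ => Φ (ρ, E.localPoints D x fun y => (b y, ρ y)))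
    (hΦ.comp (measurable_id.prodMk hpts))]
  -- After the replacement, the points that `x` reads are the slot field itself, since slots without
  -- an owned site are almost surely empty.
  have hae : ∀ ρ : V → ℕ, ∀ᵐ σ ∂(poissonField b'),
      E.localPoints D x (fun y => (b y, glueAlong (E.own x) (E.rk x) σ ρ y)) = σ := by
    intro ρ
    have h0 : ∀ᵐ σ ∂(poissonField b'), ∀ j,
        (∀ y ∈ D.supp x, ¬ (E.own x y ∧ E.rk x y = j)) → σ j = 0 := by
      refine ae_all_iff.2 fun j => ?_
      by_cases hj : ∀ y ∈ D.supp x, ¬ (E.own x y ∧ E.rk x y = j)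
      · filter_upwards [ae_poissonField_eq_zero b' (localBudget_eq_zero hj _)] with σ hσ _
        exact hσ
      · exact Filter.Eventually.of_forall fun σ h' => absurd h' hj
    filter_upwards [h0] with σ hσ
    ext j
    by_cases hj : ∀ y ∈ D.supp x, ¬ (E.own x y ∧ E.rk x y = j)
    · rw [localPoints_eq_zero hj, hσ j hj]
    · push Not at hj
      obtain ⟨y, hy, ho, rfl⟩ := hj
      rw [localPoints_rk h hy ho]
      simp [glueAlong, ho]
  have hgg : ∀ (σ σ' : κ → ℕ) (ρ : V → ℕ), glueAlong (E.own x) (E.rk x) σ'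
      (glueAlong (E.own x) (E.rk x) σ ρ) = glueAlong (E.own x) (E.rk x) σ' ρ := by
    intro σ σ' ρ
    ext y
    simp only [glueAlong]
    split_ifs <;> rfl
  have hmid : ∀ ρ : V → ℕ, ∫⁻ σ, Φ (glueAlong (E.own x) (E.rk x) σ ρ, E.localPoints D x
      fun y => (b y, glueAlong (E.own x) (E.rk x) σ ρ y)) ∂(poissonField b') =
      ∫⁻ q, ∫⁻ r, G (Function.update X x q, glueAlong (E.own x) (E.rk x) r ρ)
        ∂(poissonField fun j => b' j - q.2 * P j) ∂(pathLaw P n) := by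
    intro ρ
    rw [← h.lintegral_sampler x n b' (fun q => G (Function.update X x q.1,
      glueAlong (E.own x) (E.rk x) q.2 ρ)) ?_]
    · refine lintegral_congr_ae ?_
      filter_upwards [hae ρ] with σ hσ
      rw [hσ]
      simp only [Φ, hgg]
      rfl
    · exact hG.comp ((hupd.comp (measurable_const.prodMk measurable_fst)).prodMk
        (hglue.comp (measurable_const.prodMk measurable_snd)))
  simp_rw [hmid]
  rw [lintegral_lintegral_swap]
  · refine lintegral_congr fun q => ?_
    refine lintegral_infinitePi_glueAlong (E.own x) (E.rk x) hinj _ _ _ (fun y hy => ?_)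
      (fun y hy => ?_) (F := fun ρ => G (Function.update X x q, ρ))
      (hG.comp measurable_prodMk_left)
    · rw [budget_update_of_own (hs' hy) hy hX]
      simp only [hb', hP, localBudget_rk h (hs hy) hy, rates_rk h (hs hy)]
      rfl
    · rw [budget_update_of_not_own hy]
  · have hf : Measurable fun o : ((V → ℕ) × ((κ → ℕ) × ℝ)) × (κ → ℕ) =>
        G (Function.update X x o.1.2, glueAlong (E.own x) (E.rk x) o.2 o.1.1) := by
      refine hG.comp (Measurable.prodMk ?_ ?_)
      · exact hupd.comp (measurable_const.prodMk (measurable_snd.comp measurable_fst))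
      · exact hglue.comp ((measurable_fst.comp measurable_fst).prodMk measurable_snd)
    exact (Measurable.lintegral_kernel_prod_right'
      (κ := (poissonFieldKernel κ).comap (fun q : (V → ℕ) × ((κ → ℕ) × ℝ) =>
        fun j => b' j - q.2.2 * P j) (by fun_prop)) hf).aemeasurable

/-- The particle number at `x` is Poisson and independent of the field, so averaging the
fixed-number step over it turns the path law into the particle law. -/
lemma lintegral_outcome (h : IsFaithful D E) {x : V} [DecidablePred (E.own x)]
    (hs : ∀ {y}, E.own x y → y ∈ D.supp x) (hs' : ∀ {y}, E.own x y → x ∈ D.supp y)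
    {X : V → (κ → ℕ) × ℝ} (hX : X x = 0)
    {G : (V → (κ → ℕ) × ℝ) × (V → ℕ) → ℝ≥0∞} (hG : Measurable G)
    (hK : Measurable fun q : (ℕ × unitInterval) × (V → ℕ) => G (Function.update X x
        (E.outcome D (fun _ => q.1) x fun y => (E.budget D α X y, q.2 y)).1,
        glueAlong (E.own x) (E.rk x)
          (E.outcome D (fun _ => q.1) x fun y => (E.budget D α X y, q.2 y)).2 q.2)) :
    ∫⁻ ρ, ∫⁻ z, G (Function.update X x
        (E.outcome D (fun _ => z) x fun y => (E.budget D α X y, ρ y)).1,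
        glueAlong (E.own x) (E.rk x)
          (E.outcome D (fun _ => z) x fun y => (E.budget D α X y, ρ y)).2 ρ)
        ∂((poissonMeasure α).prod volume) ∂(poissonField (E.budget D α X)) =
      ∫⁻ q, ∫⁻ ρ, G (Function.update X x q, ρ)
        ∂(poissonField (E.budget D α (Function.update X x q)))
        ∂(particleLaw α (D.rates (E.rk x) x)) := by
  have hupd := measurable_update_pi (X := fun _ : V => (κ → ℕ) × ℝ) x
  have hR : Measurable fun q : (κ → ℕ) × ℝ => ∫⁻ ρ, G (Function.update X x q, ρ)
        ∂(poissonField (E.budget D α (Function.update X x q))) :=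
    Measurable.lintegral_kernel_prod_right'
      (κ := (poissonFieldKernel V).comap (fun q : (κ → ℕ) × ℝ =>
        E.budget D α (Function.update X x q))
        ((measurable_budget_pi D E α).comp (hupd.comp measurable_prodMk_left)))
      (f := fun o : ((κ → ℕ) × ℝ) × (V → ℕ) => G (Function.update X x o.1, o.2))
      (hG.comp ((hupd.comp (measurable_const.prodMk measurable_fst)).prodMk measurable_snd))
  rw [lintegral_particleLaw _ _ hR]
  simp_rw [← lintegral_outcome_step h hs hs' hX _ hG]
  have h1 : ∀ ρ : V → ℕ, ∫⁻ z, G (Function.update X x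
        (E.outcome D (fun _ => z) x fun y => (E.budget D α X y, ρ y)).1,
        glueAlong (E.own x) (E.rk x)
          (E.outcome D (fun _ => z) x fun y => (E.budget D α X y, ρ y)).2 ρ)
        ∂((poissonMeasure α).prod volume) = ∫⁻ n, ∫⁻ v, G (Function.update X x
        (E.outcome D (fun _ => (n, v)) x fun y => (E.budget D α X y, ρ y)).1,
        glueAlong (E.own x) (E.rk x)
          (E.outcome D (fun _ => (n, v)) x fun y => (E.budget D α X y, ρ y)).2 ρ)
        ∂volume ∂(poissonMeasure α) := fun ρ =>
    lintegral_prod _ (hK.comp measurable_prodMk_right).aemeasurable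
  simp_rw [h1]
  rw [lintegral_lintegral_swap]
  exact (Measurable.lintegral_prod_right'
    (f := fun o : ((V → ℕ) × ℕ) × unitInterval => G (Function.update X x
        (E.outcome D (fun _ => (o.1.2, o.2)) x fun y => (E.budget D α X y, o.1.1 y)).1,
        glueAlong (E.own x) (E.rk x)
          (E.outcome D (fun _ => (o.1.2, o.2)) x fun y => (E.budget D α X y, o.1.1 y)).2 o.1.1))
    (hK.comp (g := _) (f := fun o : ((V → ℕ) × ℕ) × unitInterval => ((o.1.2, o.2), o.1.1))
      (by fun_prop))).aemeasurable

lemma isMeasurable_const {Ω₀ : Type*} [MeasurableSpace Ω₀] (E : MatchingEnv V κ) :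
    IsMeasurable fun _ : Ω₀ => E :=
  ⟨fun _ _ => MeasurableSet.const _, fun _ _ => measurable_const⟩

lemma measurable_truncate (l : V → ℕ) (N : ℕ) :
    Measurable (truncate (κ := κ) l N) := by
  refine measurable_pi_lambda _ fun x => ?_
  unfold truncate
  split_ifs <;> fun_prop

/-- The joint law of the displacements and of the points which are left, when finitely many
vertices act. -/
theorem lintegral_result_state (h : IsFaithful D E) (hE : E.IsAdmissible D l N)
    (hfin : {x | l x < N}.Finite)
    {G : (V → (κ → ℕ) × ℝ) × (V → ℕ) → ℝ≥0∞} (hG : Measurable G) :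
    ∫⁻ ζ, ∫⁻ r, G (E.result D ζ α r l N, fun y => (E.state D ζ α r l N y).2)
        ∂(poissonField fun _ => (α : ℝ))
        ∂(Measure.infinitePi fun _ : V => (poissonMeasure α).prod (volume : Measure unitInterval)) =
      ∫⁻ X, ∫⁻ ρ, G (truncate l N X, ρ) ∂(poissonField (E.budget D α (truncate l N X)))
        ∂(Measure.infinitePi fun x => particleLaw α (D.rates (E.rk x) x)) := by
  classical
  have hP : ∀ x, IsProbabilityMeasure (particleLaw α (D.rates (E.rk x) x)) := fun x =>
    isProbabilityMeasure_particleLaw α (h.nonneg x) (h.sum_eq_one x)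
  obtain ⟨s, hs⟩ : ∃ s : Finset V, ∀ x, x ∈ s ↔ l x < N :=
    ⟨hfin.toFinset, fun x => by simp⟩
  clear hfin
  induction hn : s.card generalizing l s G with
  | zero =>
    rw [Finset.card_eq_zero] at hn
    have hl : ∀ x, ¬ l x < N := fun x hx => by simpa [hn] using (hs x).2 hx
    have h1 : ∀ ζ r, E.result D ζ α r l N = 0 := fun ζ r => funext fun x => if_neg (hl x)
    have h2 : ∀ X : V → (κ → ℕ) × ℝ, truncate l N X = 0 := fun X => funext fun x => if_neg (hl x)
    have h3 : ∀ ζ r, E.state D ζ α r l N = E.state D ζ α r l 0 := fun ζ r =>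
      state_eq_of_le (Nat.zero_le _) fun x _ => not_lt.1 (hl x)
    have h4 : E.budget D α 0 = fun _ => (α : ℝ) := by ext y; simp [budget]
    simp_rw [h1, h2, h3, h4, state]
    simp
  | succ n ih =>
    -- Induction on the number of acting vertices. A vertex of maximal label can be taken to act
    -- last, and the induction hypothesis is used for the labels in which it is silent.
    obtain ⟨x, hxs, hmax'⟩ := s.exists_max_image l (Finset.card_pos.1 (by omega))
    have hx : l x < N := (hs x).1 hxs
    have hmax : ∀ x', l x' < N → l x' ≤ l x := fun x' hx' => hmax' x' ((hs x').2 hx')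
    set l' := Function.update l x N with hl'
    have hl'x : ¬ l' x < N := by simp [hl']
    have hE' : E.IsAdmissible D l' N := by
      refine ⟨hE.mem_supp, hE.mem_supp', fun {a b y} ha hb hlt heq => ?_⟩
      have hax : a ≠ x := by rintro rfl; exact hl'x hlt
      have hbx : b ≠ x := by rintro rfl; exact hl'x (heq ▸ hlt)
      rw [hl', Function.update_of_ne hax] at hlt heq
      rw [Function.update_of_ne hbx] at heq
      exact hE.unique ha hb hlt heq
    have hs2 : ∀ a, a ∈ s.erase x ↔ l' a < N := by
      intro a
      by_cases ha : a = x
      · subst ha; simp [hl']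
      · rw [Finset.mem_erase, hs, hl', Function.update_of_ne ha]
        simp [ha]
    have hupd := measurable_update_pi (X := fun _ : V => (κ → ℕ) × ℝ) x
    -- the action of `x` on the state left by the other vertices
    let out : (ℕ × unitInterval) → (V → (κ → ℕ) × ℝ) × (V → ℕ) → ((κ → ℕ) × ℝ) × (κ → ℕ) :=
      fun z o => E.outcome D (fun _ => z) x fun y => (E.budget D α o.1 y, o.2 y)
    have hout : Measurable fun q : (ℕ × unitInterval) × (V → (κ → ℕ) × ℝ) × (V → ℕ) =>
        out q.1 q.2 := by
      refine measurable_outcome (E := fun _ => E) h.measurable (isMeasurable_const E)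
        (fun _ => measurable_fst) (fun y => ?_) x
      exact ((measurable_budget D E α y).comp (measurable_fst.comp measurable_snd)).prodMk
        ((measurable_pi_apply y).comp (measurable_snd.comp measurable_snd))
    let K : (ℕ × unitInterval) → (V → (κ → ℕ) × ℝ) × (V → ℕ) → ℝ≥0∞ := fun z o =>
      G (Function.update o.1 x (out z o).1, glueAlong (E.own x) (E.rk x) (out z o).2 o.2)
    have hK : Measurable fun q : (ℕ × unitInterval) × (V → (κ → ℕ) × ℝ) × (V → ℕ) =>
        K q.1 q.2 := by
      refine hG.comp (Measurable.prodMk ?_ ?_)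
      · exact hupd.comp ((measurable_fst.comp measurable_snd).prodMk (measurable_fst.comp hout))
      · exact (measurable_glueAlong (E.own x) (E.rk x)).comp
          ((measurable_snd.comp measurable_snd).prodMk (measurable_snd.comp hout))
    have hmeas : Measurable fun q : (V → ℕ × unitInterval) × (V → ℕ) =>
        ((E.result D q.1 α q.2 l' N, fun y => (E.state D q.1 α q.2 l' N y).2) :
          (V → (κ → ℕ) × ℝ) × (V → ℕ)) := by
      refine Measurable.prodMk (measurable_pi_lambda _ fun y => ?_)
        (measurable_pi_lambda _ fun y => ?_)
      · exact measurable_result (E := fun _ => E) (l := fun _ => l') h.measurable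
          (isMeasurable_const E) (fun x => by fun_prop) (fun y => by fun_prop)
          (fun _ => measurable_const) N y
      · exact measurable_snd.comp (measurable_state (E := fun _ => E) (l := fun _ => l')
          h.measurable (isMeasurable_const E) (fun x => by fun_prop) (fun y => by fun_prop)
          (fun _ => measurable_const) N y)
    have hGK : ∀ ζ r, G (E.result D ζ α r l N, fun y => (E.state D ζ α r l N y).2) =
        K (ζ x) (E.result D ζ α r l' N, fun y => (E.state D ζ α r l' N y).2) := by
      intro ζ r
      rw [result_eq_update hE hx hmax, state_eq_glueAlong hE hx hmax]
      have : E.outcome D ζ x (E.state D ζ α r l' N) =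
          out (ζ x) (E.result D ζ α r l' N, fun y => (E.state D ζ α r l' N y).2) := by
        refine outcome_congr rfl fun y _ _ => ?_
        ext1
        · exact state_budget N le_rfl y
        · rfl
      rw [this]
    have hKint : Measurable fun o => ∫⁻ z, K z o ∂((poissonMeasure α).prod volume) :=
      Measurable.lintegral_prod_left' hK
    -- The noise at `x` was not used by the other vertices, so it may be resampled independently of
    -- their results.
    have hL : ∫⁻ ζ, ∫⁻ r, K (ζ x) (E.result D ζ α r l' N, fun y => (E.state D ζ α r l' N y).2)
        ∂(poissonField fun _ => (α : ℝ))
        ∂(Measure.infinitePi fun _ : V =>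
          (poissonMeasure α).prod (volume : Measure unitInterval)) =
        ∫⁻ ζ, ∫⁻ r, ∫⁻ z, K z (E.result D ζ α r l' N, fun y => (E.state D ζ α r l' N y).2)
        ∂((poissonMeasure α).prod volume) ∂(poissonField fun _ => (α : ℝ))
        ∂(Measure.infinitePi fun _ : V =>
          (poissonMeasure α).prod (volume : Measure unitInterval)) := by
      have hm : Measurable fun q : (V → ℕ × unitInterval) × (V → ℕ) =>
          K (q.1 x) (E.result D q.1 α q.2 l' N, fun y => (E.state D q.1 α q.2 l' N y).2) :=
        hK.comp (((measurable_pi_apply x).comp measurable_fst).prodMk hmeas)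
      rw [← lintegral_infinitePi_update _ x (Measurable.lintegral_prod_right' hm)]
      refine lintegral_congr fun ζ => ?_
      simp only [Function.update_self, result_update_noise hl'x, state_update_noise hl'x]
      rw [lintegral_lintegral_swap]
      exact (hK.comp (g := _) (f := fun q : (ℕ × unitInterval) × (V → ℕ) => (q.1,
        ((E.result D ζ α q.2 l' N, fun y => (E.state D ζ α q.2 l' N y).2) :
          (V → (κ → ℕ) × ℝ) × (V → ℕ)))) (measurable_fst.prodMk
        (hmeas.comp (measurable_const.prodMk measurable_snd)))).aemeasurable
    simp_rw [hGK]
    rw [hL, ih hE' hKint (s.erase x) hs2 (by rw [Finset.card_erase_of_mem hxs, hn]; rfl)]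
    have htr : ∀ (X : V → (κ → ℕ) × ℝ) q, truncate l N (Function.update X x q) =
        Function.update (truncate l' N X) x q := by
      intro X q
      ext1 y
      by_cases hy : y = x
      · subst hy; simp [truncate, hx]
      · simp only [truncate, Function.update_of_ne hy, hl']
    have hR : Measurable fun X => ∫⁻ ρ, G (truncate l N X, ρ)
        ∂(poissonField (E.budget D α (truncate l N X))) :=
      Measurable.lintegral_kernel_prod_right'
        (κ := (poissonFieldKernel V).comap (fun X => E.budget D α (truncate l N X))
          ((measurable_budget_pi D E α).comp (measurable_truncate l N)))
        (f := fun o : (V → (κ → ℕ) × ℝ) × (V → ℕ) => G (truncate l N o.1, o.2))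
        (hG.comp (((measurable_truncate l N).comp measurable_fst).prodMk measurable_snd))
    rw [← lintegral_infinitePi_update _ x hR]
    refine lintegral_congr fun X => ?_
    simp_rw [htr]
    refine lintegral_outcome h hE.mem_supp hE.mem_supp' (if_neg hl'x) hG ?_
    exact hK.comp (g := _) (f := fun q : (ℕ × unitInterval) × (V → ℕ) =>
      (q.1, (truncate l' N X, q.2))) (by fun_prop)

end MatchingEnv

end ProcessLaw

/-! ### All vertices acting: passage from finite sets by locality -/

section ProcessLaw

namespace MatchingEnv

variable {V κ : Type*} [Fintype κ] [DecidableEq κ] [MeasurableSpace κ]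
  [DiscreteMeasurableSpace κ]
  {D : MatchingData V κ} {E : MatchingEnv V κ} {α : ℝ≥0} {l : V → ℕ} {N : ℕ}

/-- Label `N` outside a finite set silences all but finitely many vertices without affecting the
ownership conditions. -/
lemma isAdmissible_restrict [DecidableEq V] (hE : E.IsAdmissible D l N) (A : Finset V) :
    E.IsAdmissible D (fun x => if x ∈ A then l x else N) N := by
  refine ⟨hE.mem_supp, hE.mem_supp', fun {a b y} ha hb hlt heq => ?_⟩
  by_cases h1 : a ∈ A
  · by_cases h2 : b ∈ A
    · simp only [h1, h2, if_true] at hlt heq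
      exact hE.unique ha hb hlt heq
    · simp only [h1, h2, if_true, if_false] at hlt heq
      omega
  · simp [h1] at hlt

lemma finite_restrict [DecidableEq V] (l : V → ℕ) (N : ℕ) (A : Finset V) :
    {x | (if x ∈ A then l x else N) < N}.Finite := by
  refine A.finite_toSet.subset fun x hx => ?_
  by_contra h
  simp [show x ∉ A from h] at hx

/-- The law of the displacements of all particles. -/
theorem map_result (h : IsFaithful D E) (hE : E.IsAdmissible D l N) (hl : ∀ x, l x < N) :
    ((Measure.infinitePi fun _ : V => (poissonMeasure α).prod (volume : Measure unitInterval)).prod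
      (poissonField fun _ : V => (α : ℝ))).map (fun q => E.result D q.1 α q.2 l N) =
      Measure.infinitePi fun x => particleLaw α (D.rates (E.rk x) x) := by
  classical
  have hP : ∀ x, IsProbabilityMeasure (particleLaw α (D.rates (E.rk x) x)) := fun x =>
    isProbabilityMeasure_particleLaw α (h.nonneg x) (h.sum_eq_one x)
  have hm : Measurable fun q : (V → ℕ × unitInterval) × (V → ℕ) =>
      E.result D q.1 α q.2 l N :=
    measurable_pi_lambda _ fun y => measurable_result (E := fun _ => E) (l := fun _ => l)
      h.measurable (isMeasurable_const E) (fun x => by fun_prop) (fun y => by fun_prop)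
      (fun _ => measurable_const) N y
  refine Measure.eq_infinitePi _ fun s t ht => ?_
  have hms := measurableSet_finset_pi (s := s) ht
  have hev : ∀ᶠ A : Finset V in Filter.atTop, ∀ x ∈ s, ∀ ζ r,
      E.result D ζ α r (fun x => if x ∈ A then l x else N) N x = E.result D ζ α r l N x :=
    (Filter.eventually_all_finset _).2 fun x _ => eventually_result_eq D E α hl x
  -- With finitely many rounds of finite range, the results on `s` are exactly those of a large
  -- finite system, for every noise and every field. No limit of laws is needed.
  obtain ⟨A, hA, hsA⟩ := (hev.and (Filter.eventually_ge_atTop s)).exists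
  set l' : V → ℕ := fun x => if x ∈ A then l x else N with hl'
  have hlaw := lintegral_result_state (α := α) h (isAdmissible_restrict hE A)
    (finite_restrict l N A) (G := fun o => (Set.pi (s : Set V) t).indicator 1 o.1)
    ((measurable_one.indicator hms).comp measurable_fst)
  simp only [lintegral_const, measure_univ, mul_one] at hlaw
  rw [Measure.map_apply hm hms, ← lintegral_indicator_one (hm hms), lintegral_prod _
    ((measurable_one.indicator (hm hms)).aemeasurable), ← Measure.infinitePi_pi _ fun x _ => ht x,
    ← lintegral_indicator_one hms]
  refine Eq.trans ?_ (hlaw.trans ?_)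
  · refine lintegral_congr fun ζ => lintegral_congr fun r => ?_
    refine Set.indicator_eq_indicator (a := _) (b := _) ?_ rfl
    simp only [Set.mem_preimage, Set.mem_pi, Finset.mem_coe]
    exact forall_congr' fun x => forall_congr' fun hx => by rw [hA x hx]
  · refine lintegral_congr fun X => ?_
    refine Set.indicator_eq_indicator (a := _) (b := _) ?_ rfl
    simp only [Set.mem_pi, Finset.mem_coe]
    exact forall_congr' fun x => forall_congr' fun hx => by
      simp [truncate, hsA hx, hl]

/-- The mean number of points left at `o`. -/
theorem lintegral_state (h : IsFaithful D E) (hE : E.IsAdmissible D l N) (hl : ∀ x, l x < N)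
    (o : V) :
    ∫⁻ ζ, ∫⁻ r, ((E.state D ζ α r l N o).2 : ℝ≥0∞) ∂(poissonField fun _ => (α : ℝ))
        ∂(Measure.infinitePi fun _ : V => (poissonMeasure α).prod (volume : Measure unitInterval)) =
      ∫⁻ X, ENNReal.ofReal (E.budget D α X o)
        ∂(Measure.infinitePi fun x => particleLaw α (D.rates (E.rk x) x)) := by
  classical
  have hP : ∀ x, IsProbabilityMeasure (particleLaw α (D.rates (E.rk x) x)) := fun x =>
    isProbabilityMeasure_particleLaw α (h.nonneg x) (h.sum_eq_one x)
  obtain ⟨A, hA, hsA⟩ := ((eventually_state_eq D E α l N le_rfl o).and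
    (Filter.eventually_ge_atTop (D.supp o))).exists
  have hlaw := lintegral_result_state (α := α) h (isAdmissible_restrict hE A)
    (finite_restrict l N A) (G := fun q => ((q.2 o : ℕ) : ℝ≥0∞))
    (measurable_from_top.comp ((measurable_pi_apply o).comp measurable_snd))
  simp only [hA] at hlaw
  rw [hlaw]
  refine lintegral_congr fun X => ?_
  have h1 : ∀ b : V → ℝ, ∫⁻ ρ, ((ρ o : ℕ) : ℝ≥0∞) ∂(poissonField b) = ENNReal.ofReal (b o) := by
    intro b
    rw [poissonField, ← lintegral_map (f := fun n : ℕ => (n : ℝ≥0∞)) measurable_from_top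
      (measurable_pi_apply o), Measure.infinitePi_map_eval, lintegral_natCast_poissonMeasure]
    rfl
  rw [h1]
  congr 1
  simp only [budget]
  congr 1
  refine Finset.sum_congr rfl fun x hx => ?_
  simp [truncate, hsA hx, hl]

end MatchingEnv

end ProcessLaw

/-! ### Second-moment bound for the budget left over -/

section SecondMoment

/-- The mean positive part of a difference is controlled by the standard deviation and the
difference of the means. -/
lemma lintegral_ofReal_sub_le {Ω : Type*} [MeasurableSpace Ω] {P : Measure Ω}
    [IsProbabilityMeasure P] {Z : Ω → ℝ} (hZ : MemLp Z 2 P) (a : ℝ) {c : ℝ} (hc : 0 < c)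
    (hvar : variance Z P ≤ c ^ 2) :
    ∫⁻ w, ENNReal.ofReal (a - Z w) ∂P ≤
      ENNReal.ofReal (c / 2) + ENNReal.ofReal (a - ∫ w, Z w ∂P) := by
  set m := ∫ w, Z w ∂P with hm
  have hY : MemLp (fun w => m - Z w) 2 P := (memLp_const m).sub hZ
  have hYi : Integrable (fun w => m - Z w) P := hY.integrable one_le_two
  have hY0 : ∫ w, (m - Z w) ∂P = 0 := by
    rw [integral_sub (integrable_const m) (hZ.integrable one_le_two)]
    simp [hm]
  have hYvar : ∫ w, (m - Z w) ^ 2 ∂P ≤ c ^ 2 := by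
    rw [← variance_of_integral_eq_zero hY.aemeasurable hY0]
    have : variance (fun w => m - Z w) P = variance Z P :=
      variance_const_sub hZ.aestronglyMeasurable m
    rwa [this]
  -- For `y = m - Z w`, y⁺ ≤ (y + c)²/(4c), because the right side is nonnegative and exceeds y by
  -- (y - c)²/(4c). With mean zero and variance at most c² its expectation is at most c/2, which
  -- gains a factor 2 over the bound by the standard deviation.
  have hpt : ∀ w, ENNReal.ofReal (a - Z w) ≤
      ENNReal.ofReal ((m - Z w + c) ^ 2 / (4 * c)) + ENNReal.ofReal (a - m) := by
    intro w
    rw [show a - Z w = (m - Z w) + (a - m) by ring]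
    refine ENNReal.ofReal_add_le.trans ?_
    gcongr
    rw [le_div_iff₀ (by positivity)]
    nlinarith [sq_nonneg (m - Z w - c)]
  have hexp : ∀ w, (m - Z w + c) ^ 2 / (4 * c) =
      (4 * c)⁻¹ * ((m - Z w) ^ 2 + 2 * c * (m - Z w) + c ^ 2) := fun w => by
    field_simp; ring
  have hint : Integrable (fun w => (m - Z w + c) ^ 2 / (4 * c)) P := by
    simp_rw [hexp]
    exact (((hY.integrable_sq).add (hYi.const_mul _)).add (integrable_const _)).const_mul _
  calc ∫⁻ w, ENNReal.ofReal (a - Z w) ∂P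
      ≤ ∫⁻ w, (ENNReal.ofReal ((m - Z w + c) ^ 2 / (4 * c)) + ENNReal.ofReal (a - m)) ∂P :=
        lintegral_mono hpt
    _ = ENNReal.ofReal (∫ w, (m - Z w + c) ^ 2 / (4 * c) ∂P) + ENNReal.ofReal (a - m) := by
        rw [lintegral_add_right _ measurable_const, ofReal_integral_eq_lintegral_ofReal hint
          (Filter.Eventually.of_forall fun w => by positivity)]
        simp
    _ ≤ _ := by
        gcongr
        simp_rw [hexp]
        have hi : Integrable (fun w => (m - Z w) ^ 2 + 2 * c * (m - Z w)) P :=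
          (hY.integrable_sq).add (hYi.const_mul _)
        rw [integral_const_mul, integral_add hi (integrable_const _), integral_add hY.integrable_sq (hYi.const_mul _),
          integral_const_mul, hY0]
        simp only [mul_zero, add_zero, integral_const, probReal_univ, smul_eq_mul,
          one_mul]
        rw [inv_mul_le_iff₀ (by positivity)]
        nlinarith

end SecondMoment

namespace MatchingEnv

variable {V κ : Type*} [Fintype κ] [DecidableEq κ] [MeasurableSpace κ]
  [DiscreteMeasurableSpace κ]
  {D : MatchingData V κ} {E : MatchingEnv V κ} {α : ℝ≥0} {l : V → ℕ} {N : ℕ}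

open Classical in
/-- The total transition probability to `o` from vertices which own `o`. -/
def ownMass (D : MatchingData V κ) (E : MatchingEnv V κ) (o : V) : ℝ :=
  ∑ x ∈ D.supp o, if E.own x o then D.p x o else 0

/-- The total times are independent with mean α and variance 2α. Ownership only deletes terms: this
lowers the variance of the weighted sum, and lowers its mean from α to α times the owned mass, which
accounts for the second summand. -/
lemma lintegral_budget_le (h : IsFaithful D E) (o : V) {c : ℝ} (hc : 0 < c)
    (hvar : 2 * α * ∑ x ∈ D.supp o, D.p x o ^ 2 ≤ c ^ 2) :
    ∫⁻ X, ENNReal.ofReal (E.budget D α X o)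
        ∂(Measure.infinitePi fun x => particleLaw α (D.rates (E.rk x) x)) ≤
      ENNReal.ofReal (c / 2) + ENNReal.ofReal (α * (1 - E.ownMass D o)) := by
  classical
  have hP : ∀ x, IsProbabilityMeasure (particleLaw α (D.rates (E.rk x) x)) := fun x =>
    isProbabilityMeasure_particleLaw α (h.nonneg x) (h.sum_eq_one x)
  set Q := Measure.infinitePi fun x => particleLaw α (D.rates (E.rk x) x) with hQ
  let a : V → ℝ := fun x => if E.own x o then D.p x o else 0
  let T : V → (V → (κ → ℕ) × ℝ) → ℝ := fun x X => a x * (X x).2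
  have hev : ∀ x, MeasurePreserving (fun X : V → (κ → ℕ) × ℝ => X x) Q
      (particleLaw α (D.rates (E.rk x) x)) := fun x => measurePreserving_eval_infinitePi _ x
  have hTm : ∀ x, MemLp (T x) 2 Q := fun x =>
    ((memLp_particleLaw_time α (h.nonneg x) (h.sum_eq_one x)).comp_measurePreserving
      (hev x)).const_mul (a x)
  have hTi : ∀ x, ∫ X, T x X ∂Q = a x * α := by
    intro x
    rw [integral_const_mul, ← integral_particleLaw_time α (h.nonneg x) (h.sum_eq_one x),
      ← (hev x).map_eq, integral_map (hev x).measurable.aemeasurable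
      measurable_snd.aestronglyMeasurable]
  have hTv : ∀ x, variance (T x) Q = a x ^ 2 * (2 * α) := by
    intro x
    rw [variance_const_mul, ← variance_particleLaw_time α (h.nonneg x) (h.sum_eq_one x),
      ← (hev x).map_eq, variance_map measurable_snd.aemeasurable (hev x).measurable.aemeasurable]
    rfl
  have hind : iIndepFun T Q :=
    iIndepFun_infinitePi (X := fun x (q : (κ → ℕ) × ℝ) => a x * q.2) fun x => by fun_prop
  have hsum : ∀ X : V → (κ → ℕ) × ℝ,
      E.budget D α X o = α - (∑ x ∈ D.supp o, T x) X := by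
    intro X
    rw [budget, Finset.sum_apply]
    congr 1
    refine Finset.sum_congr rfl fun x _ => ?_
    simp only [T, a]
    split_ifs <;> ring
  have hS : MemLp (∑ x ∈ D.supp o, T x) 2 Q := memLp_finsetSum' _ fun x _ => hTm x
  have hSv : variance (∑ x ∈ D.supp o, T x) Q ≤ c ^ 2 := by
    rw [IndepFun.variance_sum (fun x _ => hTm x) fun x _ y _ hxy => hind.indepFun hxy]
    refine le_trans ?_ hvar
    simp_rw [hTv]
    rw [Finset.mul_sum]
    refine Finset.sum_le_sum fun x _ => ?_
    rw [mul_comm]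
    refine mul_le_mul_of_nonneg_left ?_ (by positivity)
    simp only [a]
    split_ifs
    · exact le_rfl
    · simpa using sq_nonneg _
  have hSi : ∫ X, (∑ x ∈ D.supp o, T x) X ∂Q = α * E.ownMass D o := by
    simp only [Finset.sum_apply]
    rw [integral_finsetSum _ fun x _ => (hTm x).integrable one_le_two]
    simp_rw [hTi]
    rw [← Finset.sum_mul, mul_comm]
    rfl
  simp_rw [hsum]
  refine (lintegral_ofReal_sub_le hS α hc hSv).trans ?_
  rw [hSi, mul_sub, mul_one]

end MatchingEnv

/-! ### Simple random walk on a vertex-transitive graph -/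

section Walk

variable {V : Type*} (G : SimpleGraph V) [G.LocallyFinite]

/-- By local finiteness only countably many vertices are reached by walks from a root, and
connectedness makes these all. -/
lemma countable_of_connected (hconn : G.Connected) : Countable V := by
  obtain ⟨o⟩ := hconn.nonempty
  let S : ℕ → Set V := fun n => n.rec {o} fun _ s => ⋃ x ∈ s, G.neighborSet x
  have hS : ∀ n, (S n).Countable := by
    intro n
    induction n with
    | zero => exact Set.countable_singleton o
    | succ n ih => exact ih.biUnion fun x _ => (Set.toFinite (G.neighborSet x)).countable
  have hw : ∀ x y (w : G.Walk x y) n, x ∈ S n → ∃ m, y ∈ S m := by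
    intro x y w
    induction w with
    | nil => exact fun n h => ⟨n, h⟩
    | cons h _ ih =>
      intro n hn
      exact ih (n + 1) (Set.mem_biUnion hn h)
  have hall : (Set.univ : Set V) ⊆ ⋃ n, S n := by
    intro y _
    obtain ⟨w⟩ := hconn.preconnected o y
    exact Set.mem_iUnion.2 (hw o y w 0 rfl)
  exact Set.countable_univ_iff.1 ((Set.countable_iUnion hS).mono hall)

variable {G}

open Classical in
lemma srwStep_apply (x y : V) :
    srwStep G x y = if G.degree x = 0 then (if x = y then 1 else 0)
      else if G.Adj x y then ((G.degree x : ℕ) : ℝ≥0∞)⁻¹ else 0 := by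
  unfold srwStep
  by_cases h : (G.neighborFinset x).Nonempty
  · have h0 : G.degree x ≠ 0 := (Finset.card_pos.2 h).ne'
    rw [dif_pos h, if_neg h0, PMF.uniformOfFinset_apply]
    simp [SimpleGraph.mem_neighborFinset]
  · have h0 : G.degree x = 0 := Finset.card_eq_zero.2 (Finset.not_nonempty_iff_eq_empty.1 h)
    rw [dif_neg h, if_pos h0, PMF.pure_apply]
    simp [eq_comm]

lemma degree_aut (φ : G ≃g G) (x : V) : G.degree (φ x) = G.degree x := by
  rw [← SimpleGraph.card_neighborSet_eq_degree, ← SimpleGraph.card_neighborSet_eq_degree]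
  exact (Fintype.card_congr (φ.mapNeighborSet x)).symm

lemma srwStep_aut (φ : G ≃g G) (x y : V) : srwStep G (φ x) (φ y) = srwStep G x y := by
  rw [srwStep_apply, srwStep_apply, degree_aut, φ.map_adj_iff]
  by_cases h : x = y
  · simp [h]
  · simp [h, φ.injective.ne h]

/-- Transitivity makes the graph regular, so one step has the same probability in both directions.
-/
lemma srwStep_comm (htrans : IsVertexTransitive G) (x y : V) :
    srwStep G x y = srwStep G y x := by
  have hd : G.degree y = G.degree x := by
    obtain ⟨φ, rfl⟩ := htrans x y
    exact degree_aut φ x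
  rw [srwStep_apply, srwStep_apply, hd, G.adj_comm, eq_comm (a := x)]

lemma srwLaw_aut (φ : G ≃g G) (n : ℕ) (x y : V) :
    srwLaw G (φ x) n (φ y) = srwLaw G x n y := by
  induction n generalizing y with
  | zero =>
    by_cases h : y = x
    · simp [srwLaw, PMF.pure_apply, h]
    · simp [srwLaw, PMF.pure_apply, h, φ.injective.ne h]
  | succ n ih =>
    simp only [srwLaw, PMF.bind_apply]
    rw [← φ.toEquiv.tsum_eq]
    refine tsum_congr fun z => ?_
    change srwLaw G (φ x) n (φ z) * srwStep G (φ z) (φ y) = _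
    rw [ih, srwStep_aut]

lemma srwLaw_add (x : V) (m n : ℕ) :
    srwLaw G x (m + n) = (srwLaw G x m).bind fun z => srwLaw G z n := by
  induction n with
  | zero => simp [srwLaw]
  | succ n ih => rw [← add_assoc, srwLaw, ih, PMF.bind_bind]; rfl

/-- Split off the last step of one walk and the first step of the reversed one, then use symmetry of
a single step. -/
lemma srwLaw_comm (htrans : IsVertexTransitive G) (n : ℕ) (x y : V) :
    srwLaw G x n y = srwLaw G y n x := by
  induction n generalizing x y with
  | zero =>
    by_cases h : y = x
    · simp [srwLaw, PMF.pure_apply, h]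
    · simp [srwLaw, PMF.pure_apply, h, Ne.symm h]
  | succ n ih =>
    rw [srwLaw, add_comm, srwLaw_add, PMF.bind_apply, PMF.bind_apply]
    refine tsum_congr fun z => ?_
    have : srwLaw G y 1 = srwStep G y := by simp [srwLaw]
    rw [this, ih, srwStep_comm htrans z y, mul_comm]

lemma finite_support_srwLaw (n : ℕ) (x : V) : (srwLaw G x n).support.Finite := by
  classical
  induction n with
  | zero => simp [srwLaw]
  | succ n ih =>
    rw [srwLaw, PMF.support_bind]
    refine ih.biUnion fun z _ => ?_
    unfold srwStep
    split_ifs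
    · rw [PMF.support_uniformOfFinset]; exact Finset.finite_toSet _
    · simp

variable (G) in
/-- The possible positions of the walk from `x` at time `n`. -/
def srwSupport (n : ℕ) (x : V) : Finset V := (finite_support_srwLaw (G := G) n x).toFinset

lemma mem_srwSupport {n : ℕ} {x y : V} : y ∈ srwSupport G n x ↔ srwLaw G x n y ≠ 0 := by
  simp [srwSupport, PMF.mem_support_iff]

lemma ofReal_srwProb (n : ℕ) (x y : V) : ENNReal.ofReal (srwProb G n x y) = srwLaw G x n y :=
  ENNReal.ofReal_toReal (PMF.apply_ne_top _ _)

lemma srwProb_nonneg (n : ℕ) (x y : V) : 0 ≤ srwProb G n x y := ENNReal.toReal_nonneg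

lemma srwProb_comm (htrans : IsVertexTransitive G) (n : ℕ) (x y : V) :
    srwProb G n x y = srwProb G n y x := by rw [srwProb, srwLaw_comm htrans, srwProb]

lemma srwProb_aut (φ : G ≃g G) (n : ℕ) (x y : V) :
    srwProb G n (φ x) (φ y) = srwProb G n x y := by rw [srwProb, srwLaw_aut, srwProb]

lemma srwProb_eq_zero {n : ℕ} {x y : V} (h : y ∉ srwSupport G n x) : srwProb G n x y = 0 := by
  rw [mem_srwSupport, not_not] at h
  simp [srwProb, h]

lemma mem_srwSupport_comm (htrans : IsVertexTransitive G) {n : ℕ} {x y : V} :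
    y ∈ srwSupport G n x ↔ x ∈ srwSupport G n y := by
  rw [mem_srwSupport, mem_srwSupport, srwLaw_comm htrans]

lemma srwSupport_aut (φ : G ≃g G) (n : ℕ) (x : V) :
    srwSupport G n (φ x) = (srwSupport G n x).map φ.toEquiv.toEmbedding := by
  ext y
  obtain ⟨y, rfl⟩ := φ.surjective y
  rw [mem_srwSupport, srwLaw_aut, ← mem_srwSupport]
  exact (Finset.mem_map' φ.toEquiv.toEmbedding (a := y)).symm

lemma sum_srwProb (n : ℕ) (x : V) : ∑ y ∈ srwSupport G n x, srwProb G n x y = 1 := by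
  have h := (srwLaw G x n).tsum_coe
  rw [tsum_eq_sum (s := srwSupport G n x) fun y hy => by simpa [mem_srwSupport] using hy] at h
  have h2 := congrArg ENNReal.toReal h
  rwa [ENNReal.toReal_sum fun y _ => PMF.apply_ne_top _ _, ENNReal.toReal_one] at h2

lemma srwSupport_nonempty (n : ℕ) (x : V) : (srwSupport G n x).Nonempty := by
  by_contra h
  have := sum_srwProb (G := G) n x
  rw [Finset.not_nonempty_iff_eq_empty.1 h] at this
  simp at this

lemma card_srwSupport (htrans : IsVertexTransitive G) (n : ℕ) (x y : V) :
    (srwSupport G n x).card = (srwSupport G n y).card := by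
  obtain ⟨φ, rfl⟩ := htrans y x
  rw [srwSupport_aut, Finset.card_map]

/-- Chapman–Kolmogorov at half time combined with symmetry; this is how the return probability
enters the variance. -/
lemma sum_srwProb_sq (htrans : IsVertexTransitive G) (n : ℕ) (x : V) :
    ∑ y ∈ srwSupport G n x, srwProb G n y x ^ 2 = srwProb G (2 * n) x x := by
  rw [srwProb, two_mul, srwLaw_add, PMF.bind_apply,
    tsum_eq_sum (s := srwSupport G n x) fun y hy => by
      rw [mem_srwSupport, not_not] at hy; rw [hy, zero_mul],
    ENNReal.toReal_sum fun y _ => ENNReal.mul_ne_top (PMF.apply_ne_top _ _) (PMF.apply_ne_top _ _)]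
  refine Finset.sum_congr rfl fun y _ => ?_
  rw [srwProb, ENNReal.toReal_mul, srwLaw_comm htrans n x y, sq]

/-- A nonempty sum of squares of positive numbers. It leaves a positive amount of room for the loss
caused by equal labels. -/
lemma srwProb_two_mul_pos (htrans : IsVertexTransitive G) (n : ℕ) (x : V) :
    0 < srwProb G (2 * n) x x := by
  rw [← sum_srwProb_sq htrans]
  refine Finset.sum_pos (fun y hy => ?_) (srwSupport_nonempty n x)
  have h : srwProb G n y x ≠ 0 := by
    rw [srwProb_comm htrans, srwProb, ENNReal.toReal_ne_zero]
    exact ⟨mem_srwSupport.1 hy, PMF.apply_ne_top _ _⟩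
  positivity

lemma srwProb_diag (htrans : IsVertexTransitive G) (n : ℕ) (x y : V) :
    srwProb G n x x = srwProb G n y y := by
  obtain ⟨φ, rfl⟩ := htrans x y
  rw [srwProb_aut]

end Walk

/-! ### Sums and disjoint blocks of independent Poisson variables -/

section Superposition

variable {S : Type*}

lemma iIndepFun_map_measure {Ω Ω₁ ι : Type*} [MeasurableSpace Ω] [MeasurableSpace Ω₁]
    {P : Measure Ω} [IsProbabilityMeasure P] {g : Ω → Ω₁} (hg : Measurable g)
    {X : ι → Type*} [∀ i, MeasurableSpace (X i)] {f : ∀ i, Ω₁ → X i} (hf : ∀ i, Measurable (f i)) :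
    iIndepFun f (P.map g) ↔ iIndepFun (fun i w => f i (g w)) P := by
  have := Measure.isProbabilityMeasure_map (μ := P) hg.aemeasurable
  rw [iIndepFun_iff_map_fun_eq_infinitePi_map hf,
    iIndepFun_iff_map_fun_eq_infinitePi_map (X := fun i w => f i (g w)) fun i => (hf i).comp hg,
    Measure.map_map (measurable_pi_lambda _ hf) hg]
  simp_rw [Measure.map_map (hf _) hg]
  rfl

lemma map_eval_poissonField (b : S → ℝ) (z : S) :
    (poissonField b).map (fun c => c z) = poissonMeasure (b z).toNNReal :=
  Measure.infinitePi_map_eval _ z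

lemma map_finsetSum_poissonField {b : S → ℝ} (hb : ∀ z, 0 ≤ b z) (s : Finset S) :
    (poissonField b).map (fun c => ∑ z ∈ s, c z) = poissonMeasure (∑ z ∈ s, b z).toNNReal := by
  classical
  induction s using Finset.induction_on with
  | empty =>
    simp only [Finset.sum_empty, Real.toNNReal_zero]
    rw [Measure.map_const, measure_univ, one_smul]
    refine (Measure.ext_of_singleton fun n => ?_)
    rw [poissonMeasure_singleton, Measure.dirac_apply]
    rcases Nat.eq_zero_or_pos n with rfl | hn
    · simp
    · simp [hn.ne', hn.ne]
  | insert z s hz ih =>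
    have hind : iIndepFun (fun z (c : S → ℕ) => c z) (poissonField b) :=
      iIndepFun_infinitePi (X := fun _ (n : ℕ) => n) fun _ => measurable_id
    have h2 := (hind.indepFun_finsetSum_of_notMem (fun z => measurable_pi_apply z) hz).symm
    have h1 : HasLaw (fun c : S → ℕ => c z) (poissonMeasure (b z).toNNReal) (poissonField b) :=
      ⟨(measurable_pi_apply z).aemeasurable, map_eval_poissonField b z⟩
    have h3 : HasLaw (∑ z ∈ s, fun c : S → ℕ => c z) (poissonMeasure (∑ z ∈ s, b z).toNNReal)
        (poissonField b) := by
      have he : (∑ z ∈ s, fun c : S → ℕ => c z) = fun c => ∑ z ∈ s, c z := by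
        ext c
        simp
      rw [he]
      exact ⟨(Finset.measurable_sum _ fun z _ => measurable_pi_apply z).aemeasurable, ih⟩
    have h4 := (h2.hasLaw_add_poissonMeasure h1 h3).map_eq
    rw [Finset.sum_insert hz, Real.toNNReal_add (hb z) (Finset.sum_nonneg fun z _ => hb z), ← h4]
    congr 1
    ext c
    simp [Finset.sum_insert hz]

lemma continuous_poissonMeasure_singleton (n : ℕ) :
    Continuous fun c : ℝ => poissonMeasure c.toNNReal {n} := by
  simp_rw [poissonMeasure_toNNReal_singleton]
  exact ENNReal.continuous_ofReal.comp (continuous_poissonWeight n)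

lemma lintegral_eval_poissonField (b : S → ℝ) (z : S) :
    ∫⁻ c, (c z : ℝ≥0∞) ∂(poissonField b) = ENNReal.ofReal (b z) := by
  rw [← lintegral_map (f := fun n : ℕ => (n : ℝ≥0∞)) measurable_from_top (measurable_pi_apply z),
    map_eval_poissonField, lintegral_natCast_poissonMeasure]
  rfl

/-- A countable sum of independent Poisson variables. -/
lemma map_tsum_poissonField [Countable S] {b : S → ℝ} (hb : ∀ z, 0 ≤ b z)
    (hfin : ∑' z, ENNReal.ofReal (b z) ≠ ∞) :
    (poissonField b).map (fun c => ∑' z, (c z : ℝ≥0∞)) =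
      (poissonMeasure (∑' z, ENNReal.ofReal (b z)).toNNReal).map fun k : ℕ => (k : ℝ≥0∞) := by
  classical
  have hsum : HasSum b (∑' z, ENNReal.ofReal (b z)).toReal := by
    have h := ENNReal.summable_toReal hfin
    have h2 := h.hasSum
    rw [← ENNReal.tsum_toReal_eq fun z => ENNReal.ofReal_ne_top] at h2
    simpa [ENNReal.toReal_ofReal (hb _)] using h2
  have hae : ∀ᵐ c ∂(poissonField b), ∑' z, (c z : ℝ≥0∞) < ∞ := by
    refine ae_lt_top (Measurable.tsum fun z => by fun_prop) ?_
    rw [lintegral_tsum fun z => Measurable.aemeasurable (by fun_prop)]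
    simp_rw [lintegral_eval_poissonField]
    exact hfin
  obtain ⟨T, hTdef⟩ : ∃ T : (S → ℕ) → ℕ, ∀ c, T c = ∑ᶠ z, c z := ⟨_, fun _ => rfl⟩
  have hT : ∀ c : S → ℕ, ∑' z, (c z : ℝ≥0∞) < ∞ →
      (∀ᶠ s : Finset S in Filter.atTop, ∑ z ∈ s, c z = T c) ∧
        ∑' z, (c z : ℝ≥0∞) = (T c : ℝ≥0∞) := by
    intro c hc
    have hf : (Function.support c).Finite := by
      have := ENNReal.finite_const_le_of_tsum_ne_top hc.ne one_ne_zero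
      refine this.subset fun z hz => ?_
      have : 1 ≤ c z := Nat.one_le_iff_ne_zero.2 hz
      exact_mod_cast this
    have hs : ∀ s : Finset S, hf.toFinset ⊆ s → ∑ z ∈ s, c z = T c := fun s hs =>
      ((hTdef c).trans (finsum_eq_sum_of_support_subset c (by simpa using hs))).symm
    refine ⟨(Filter.eventually_ge_atTop hf.toFinset).mono fun s h => hs s h, ?_⟩
    rw [← hs _ subset_rfl, tsum_eq_sum (s := hf.toFinset) fun z hz => by simpa using hz]
    push_cast
    rfl
  have hTm : AEMeasurable T (poissonField b) := by
    refine ⟨fun c => ⌊(∑' z, (c z : ℝ≥0∞)).toReal⌋₊, ?_, ?_⟩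
    · exact Nat.measurable_floor.comp
        (Measurable.tsum fun z => by fun_prop).ennreal_toReal
    · filter_upwards [hae] with c hc
      rw [(hT c hc).2]
      simp
  have hlaw : (poissonField b).map T =
      poissonMeasure (∑' z, ENNReal.ofReal (b z)).toNNReal := by
    refine Measure.ext_of_singleton fun n => ?_
    -- Poisson weights are continuous in the parameter, so the laws of the finite partial sums
    -- converge pointwise to the candidate. On the other side almost every configuration is finite,
    -- its partial sums are eventually constant, and dominated convergence applies.
    have h1 : Filter.Tendsto (fun s : Finset S => poissonMeasure (∑ z ∈ s, b z).toNNReal {n})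
        Filter.atTop (nhds (poissonMeasure (∑' z, ENNReal.ofReal (b z)).toNNReal {n})) := by
      have ht : (∑' z, ENNReal.ofReal (b z)).toNNReal =
          (∑' z, ENNReal.ofReal (b z)).toReal.toNNReal := Real.toNNReal_coe.symm
      rw [ht]
      exact ((continuous_poissonMeasure_singleton n).tendsto _).comp hsum
    refine tendsto_nhds_unique ?_ h1
    simp only [← map_finsetSum_poissonField hb]
    have hm : ∀ s : Finset S, Measurable fun c : S → ℕ => ∑ z ∈ s, c z := fun s =>
      Finset.measurable_sum _ fun z _ => measurable_pi_apply z
    have h2 : ∀ s : Finset S, (poissonField b).map (fun c => ∑ z ∈ s, c z) {n} =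
        ∫⁻ c, (if ∑ z ∈ s, c z = n then 1 else 0) ∂(poissonField b) := by
      intro s
      rw [Measure.map_apply (hm s) (measurableSet_singleton n), ← lintegral_indicator_one
        (hm s (measurableSet_singleton n))]
      refine lintegral_congr fun c => ?_
      simp [Set.indicator_apply]
    have h3 : (poissonField b).map T {n} =
        ∫⁻ c, (if T c = n then 1 else 0) ∂(poissonField b) := by
      have hn : NullMeasurableSet (T ⁻¹' {n}) (poissonField b) :=
        hTm.nullMeasurableSet_preimage (measurableSet_singleton n)
      rw [Measure.map_apply_of_aemeasurable hTm (measurableSet_singleton n),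
        ← lintegral_indicator_one₀ hn]
      refine lintegral_congr fun c => ?_
      by_cases hc : T c = n <;> simp [hc]
    simp only [h2]
    rw [h3]
    refine tendsto_lintegral_filter_of_dominated_convergence 1
      (Filter.Eventually.of_forall fun s => ?_) (Filter.Eventually.of_forall fun s =>
        Filter.Eventually.of_forall fun c => ?_) (by simp) ?_
    · exact Measurable.ite (hm s (measurableSet_singleton n)) measurable_const measurable_const
    · simp only [Pi.one_apply]; split_ifs <;> simp
    · filter_upwards [hae] with c hc
      refine tendsto_const_nhds.congr' ?_
      filter_upwards [(hT c hc).1] with s hs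
      rw [hs]
  rw [← hlaw, AEMeasurable.map_map_of_aemeasurable measurable_from_top.aemeasurable hTm]
  refine Measure.map_congr ?_
  filter_upwards [hae] with c hc
  exact (hT c hc).2

lemma map_restrict_poissonField (b : S → ℝ) (A : Set S) :
    (poissonField b).map (fun c (z : A) => c z) = poissonField fun z : A => b z :=
  Measure.map_infinitePi_infinitePi_of_inj Subtype.val_injective

/-- Functions of disjoint blocks of independent variables are independent. -/
lemma iIndepFun_blocks_poissonField (b : S → ℝ) {n : ℕ} {A : Fin n → Set S}
    (hA : ∀ i j, i ≠ j → Disjoint (A i) (A j)) {Y : Type*} [MeasurableSpace Y]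
    {f : Fin n → (S → ℕ) → Y} (hf : ∀ i, Measurable (f i))
    (hfA : ∀ i c c', (∀ z ∈ A i, c z = c' z) → f i c = f i c') :
    iIndepFun f (poissonField b) := by
  classical
  let blk : S → Option (Fin n) := fun z => if h : ∃ i, z ∈ A i then some h.choose else none
  have hblk : ∀ i, ∀ z ∈ A i, blk z = some i := by
    intro i z hz
    have h : ∃ i, z ∈ A i := ⟨i, hz⟩
    simp only [blk, dif_pos h, Option.some.injEq]
    by_contra hne
    exact Set.disjoint_left.1 (hA _ _ hne) h.choose_spec hz
  -- Take one independent copy of the field per block, and one for the rest, and read each site from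
  -- the copy of its block. Each site is read once, so the law is unchanged, while the blocks now
  -- come from independent copies.
  let g : (Option (Fin n) → S → ℕ) → S → ℕ := fun d z => d (blk z) z
  have hg : Measurable g := measurable_pi_lambda _ fun z => by fun_prop
  have hmap : (Measure.infinitePi fun _ : Option (Fin n) => poissonField b).map g =
      poissonField b := by
    have h1 := Measure.infinitePi_map_curry_symm
      (fun (_ : Option (Fin n)) (z : S) => poissonMeasure (b z).toNNReal)
    have h2 := Measure.map_infinitePi_infinitePi_of_inj
      (P := fun q : Option (Fin n) × S => poissonMeasure (b q.2).toNNReal)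
      (f := fun z => (blk z, z)) (fun z z' h => (Prod.ext_iff.1 h).2)
    rw [← h1, Measure.map_map (by fun_prop) (MeasurableEquiv.measurable _)] at h2
    exact h2
  rw [← hmap, iIndepFun_map_measure hg hf]
  have h3 : iIndepFun (fun (i : Option (Fin n)) (d : Option (Fin n) → S → ℕ) => d i)
      (Measure.infinitePi fun _ : Option (Fin n) => poissonField b) :=
    iIndepFun_infinitePi (X := fun _ (c : S → ℕ) => c) fun _ => measurable_id
  have h4 := (h3.precomp (Option.some_injective (Fin n))).comp f hf
  have h5 : (fun i d => f i (g d)) = fun i => f i ∘ fun d : Option (Fin n) → S → ℕ => d (some i) := by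
    ext1 i
    ext1 d
    exact hfA i _ _ fun z hz => by simp [g, hblk i z hz]
  rw [h5]
  exact h4

end Superposition

/-! ### Point measures on a countable set as families of counts -/

section PointMeasure

namespace LocFinPointMeasure

variable {S : Type*} [MeasurableSpace S]

/-- The number of points of a point measure at `z`. -/
def counts (ω : LocFinPointMeasure S) (z : S) : ℕ := ⌊(ω.1 {z}).toReal⌋₊

/-- The mass of a singleton is the cardinality of a fibre of the indexing family; being finite it is
a natural number, and the floor loses nothing. -/
lemma coe_counts [MeasurableSingletonClass S] (ω : LocFinPointMeasure S) (z : S) :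
    (ω.counts z : ℝ≥0∞) = ω.1 {z} := by
  obtain ⟨μ, ⟨I, hI, s, rfl⟩, hfin⟩ := ω
  have h : (Measure.sum fun i => Measure.dirac (s i)) {z} =
      (({i | s i = z} : Set I).encard : ℝ≥0∞) := by
    rw [Measure.sum_apply _ (measurableSet_singleton z), ← ENNReal.tsum_set_one,
      tsum_subtype {i | s i = z} fun _ => (1 : ℝ≥0∞)]
    refine tsum_congr fun i => ?_
    rw [Measure.dirac_apply' _ (measurableSet_singleton z)]
    by_cases hi : s i = z
    · simp [hi]
    · simp [hi]
  have hz := hfin z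
  simp only [counts]
  rw [h] at hz ⊢
  have h2 : ({i | s i = z} : Set I).encard ≠ ⊤ := by
    intro h3
    rw [h3] at hz
    simp at hz
  obtain ⟨n, hn⟩ := ENat.ne_top_iff_exists.1 h2
  rw [← hn]
  simp

lemma measurable_counts [MeasurableSingletonClass S] (z : S) :
    Measurable fun ω : LocFinPointMeasure S => ω.counts z :=
  Nat.measurable_floor.comp ((Measure.measurable_coe (measurableSet_singleton z)).comp
    measurable_subtype_coe).ennreal_toReal

lemma apply_eq_tsum [Countable S] [MeasurableSingletonClass S] (ω : LocFinPointMeasure S)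
    (A : Set S) : ω.1 A = ∑' z : A, (ω.counts z : ℝ≥0∞) := by
  rw [← Measure.tsum_indicator_apply_singleton ω.1 A A.to_countable.measurableSet, ← tsum_subtype]
  exact tsum_congr fun z => (ω.coe_counts z).symm

lemma ext_counts [Countable S] [MeasurableSingletonClass S] {ω ω' : LocFinPointMeasure S}
    (h : ∀ z, ω.counts z = ω'.counts z) : ω = ω' := by
  refine Subtype.ext (Measure.ext_of_singleton fun z => ?_)
  rw [← coe_counts, ← coe_counts, h]

lemma counts_image [MeasurableSingletonClass S] {T : Type*} [MeasurableSpace T]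
    [MeasurableSingletonClass T] (e : S ≃ᵐ T) (ω : LocFinPointMeasure S) (z : S) :
    (ω.image e).counts (e z) = ω.counts z := by
  unfold counts image
  rw [e.map_apply]
  congr
  ext x
  simp

/-- The measure with `c z` points at `z`. -/
def countsMeasure (c : S → ℕ) : Measure S := Measure.sum fun z => (c z : ℝ≥0∞) • Measure.dirac z

lemma countsMeasure_singleton [Countable S] [MeasurableSingletonClass S] (c : S → ℕ) (z : S) :
    countsMeasure c {z} = c z := by
  rw [countsMeasure, Measure.sum_apply _ (measurableSet_singleton z),
    tsum_eq_single z fun y hy => by simp [hy]]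
  simp

lemma isPointMeasure_countsMeasure [Countable S] (c : S → ℕ) :
    IsPointMeasure (countsMeasure c) := by
  -- A point measure is indexed by a type in the lowest universe, whereas `S` is arbitrary.
  -- Embedding `S` in `ℕ` allows the points to be indexed by a subtype of `ℕ × ℕ`.
  obtain ⟨e, he⟩ := exists_injective_nat S
  have hfib : ∀ q : {q : ℕ × ℕ // ∃ z, e z = q.1 ∧ q.2 < c z}, ∃ z, e z = q.1.1 ∧ q.1.2 < c z :=
    fun q => q.2
  choose f hf using hfib
  refine ⟨{q : ℕ × ℕ // ∃ z, e z = q.1 ∧ q.2 < c z}, inferInstance, f, ?_⟩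
  refine Measure.ext fun A hA => ?_
  rw [countsMeasure, Measure.sum_apply _ hA, Measure.sum_apply _ hA]
  let E : (Σ z : S, Fin (c z)) ≃ {q : ℕ × ℕ // ∃ z, e z = q.1 ∧ q.2 < c z} :=
    Equiv.ofBijective (fun q => ⟨(e q.1, q.2), q.1, rfl, q.2.2⟩) ⟨by
      rintro ⟨z, i⟩ ⟨z', i'⟩ h
      simp only [Subtype.mk.injEq, Prod.mk.injEq] at h
      obtain rfl := he h.1
      simp only [Sigma.mk.injEq, heq_eq_eq, true_and]
      exact Fin.ext h.2, by
      rintro ⟨⟨a, i⟩, z, hz, hi⟩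
      exact ⟨⟨z, ⟨i, hi⟩⟩, Subtype.ext (Prod.ext hz rfl)⟩⟩
  rw [← E.tsum_eq, ENNReal.tsum_sigma' (fun q => Measure.dirac (f (E q)) A)]
  refine tsum_congr fun z => ?_
  have hE : ∀ i : Fin (c z), f (E ⟨z, i⟩) = z := fun i => he (hf (E ⟨z, i⟩)).1
  simp_rw [hE]
  simp

/-- The point measure with `c z` points at `z`. -/
def ofCounts [Countable S] [MeasurableSingletonClass S] (c : S → ℕ) : LocFinPointMeasure S :=
  ⟨countsMeasure c, isPointMeasure_countsMeasure c, fun z => by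
    rw [countsMeasure_singleton]; exact ENNReal.natCast_lt_top _⟩

lemma counts_ofCounts [Countable S] [MeasurableSingletonClass S] (c : S → ℕ) (z : S) :
    (ofCounts c).counts z = c z := by
  simp [counts, ofCounts, countsMeasure_singleton]

lemma measurable_of_counts [Countable S] [MeasurableSingletonClass S] {Ω : Type*}
    [MeasurableSpace Ω] {X : Ω → LocFinPointMeasure S}
    (hX : ∀ z, Measurable fun w => (X w).counts z) : Measurable X := by
  refine Measurable.subtype_mk (Measure.measurable_of_measurable_coe _ fun A _ => ?_)
  simp_rw [apply_eq_tsum]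
  exact Measurable.tsum fun z => measurable_from_top.comp (hX z)

end LocFinPointMeasure

open LocFinPointMeasure

variable {S : Type*} [MeasurableSpace S] [Countable S] [MeasurableSingletonClass S]
  {Ω : Type*} [MeasurableSpace Ω] {P : Measure Ω} [IsProbabilityMeasure P]
  {X : Ω → LocFinPointMeasure S} {ν : Measure S}

/-- The counts of a Poisson point process on a countable set are independent Poisson variables. -/
lemma IsPoissonPointProcess.map_counts (h : IsPoissonPointProcess P X ν) {b : S → ℝ}
    (hν : ∀ z, ν {z} = ENNReal.ofReal (b z)) :
    P.map (fun w z => (X w).counts z) = poissonField b := by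
  have hm : ∀ z, Measurable fun w => (X w).counts z := fun z =>
    (LocFinPointMeasure.measurable_counts z).comp h.measurable
  have hcoe : ∀ z, Measurable fun w => (X w).1 {z} := fun z =>
    (Measure.measurable_coe (measurableSet_singleton z)).comp
      (measurable_subtype_coe.comp h.measurable)
  have hfl : Measurable fun x : ℝ≥0∞ => ⌊x.toReal⌋₊ :=
    Nat.measurable_floor.comp ENNReal.measurable_toReal
  have hind : iIndepFun (fun z w => (X w).counts z) P := by
    have hind' : iIndepFun (fun z w => (X w).1 {z}) P := by
      rw [iIndepFun_iff_finset]
      intro s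
      have h1 := h.indep s.card (fun i => {(s.equivFin.symm i : S)})
        (fun i => measurableSet_singleton _) fun i j hij => by
          rw [Set.disjoint_singleton]
          exact fun he => hij (s.equivFin.symm.injective (Subtype.ext he))
      have h2 := h1.precomp s.equivFin.injective
      convert h2 using 1
      ext z w
      simp [Finset.restrict]
    exact hind'.comp (fun _ x => ⌊x.toReal⌋₊) fun _ => hfl
  rw [(iIndepFun_iff_map_fun_eq_infinitePi_map hm).1 hind, poissonField]
  congr 1
  ext1 z
  have h3 := h.map_eq_poisson {z} (measurableSet_singleton z) (by rw [hν]; simp)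
  have h4 := congrArg (Measure.map fun x : ℝ≥0∞ => ⌊x.toReal⌋₊) h3
  rw [Measure.map_map hfl (hcoe z), Measure.map_map hfl measurable_from_top] at h4
  have h5 : ((fun x : ℝ≥0∞ => ⌊x.toReal⌋₊) ∘ fun k : ℕ => (k : ℝ≥0∞)) = id := by
    ext k; simp
  rw [h5, Measure.map_id] at h4
  refine Eq.trans h4 ?_
  rw [hν]
  rfl

/-- A random point measure whose counts are independent Poisson variables is a Poisson point
process. -/
lemma isPoissonPointProcess_of_counts (hX : Measurable X) {b : S → ℝ} (hb : ∀ z, 0 ≤ b z)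
    (hν : ∀ z, ν {z} = ENNReal.ofReal (b z))
    (hlaw : P.map (fun w z => (X w).counts z) = poissonField b) :
    IsPoissonPointProcess P X ν := by
  have hm : Measurable fun w z => (X w).counts z :=
    measurable_pi_lambda _ fun z => (LocFinPointMeasure.measurable_counts z).comp hX
  have hνA : ∀ A : Set S, ν A = ∑' z : A, ENNReal.ofReal (b z) := by
    intro A
    rw [← Measure.tsum_indicator_apply_singleton ν A A.to_countable.measurableSet, ← tsum_subtype]
    exact tsum_congr fun z => hν z
  have hA : ∀ A : Set S, Measurable fun c : S → ℕ => ∑' z : A, (c z : ℝ≥0∞) := fun A =>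
    Measurable.tsum fun z => by fun_prop
  refine ⟨hX, fun A hAm hfin => ?_, fun n A hAm hdisj => ?_⟩
  · simp_rw [apply_eq_tsum]
    rw [hνA] at hfin ⊢
    rw [← map_tsum_poissonField (b := fun z : A => b z) (fun z => hb z) hfin,
      ← map_restrict_poissonField, ← hlaw,
      Measure.map_map (measurable_pi_lambda _ fun z => by fun_prop) hm,
      Measure.map_map (Measurable.tsum fun z => by fun_prop)
        ((measurable_pi_lambda _ fun z => by fun_prop).comp hm)]
    rfl
  · simp_rw [apply_eq_tsum]
    refine (iIndepFun_map_measure hm fun i => hA (A i)).1 ?_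
    rw [hlaw]
    refine iIndepFun_blocks_poissonField b hdisj (fun i => hA (A i)) fun i c c' hc => ?_
    exact tsum_congr fun z => by rw [hc z z.2]

end PointMeasure

/-! ### The matching map for simple random walk -/

section Matching

section Sampler

variable {d : ℕ}

open Classical in
/-- A sampler for the local coupling, made total. -/
def localSampler (d : ℕ) (p : Fin (d + 1) → ℝ) : ℕ → (Fin (d + 1) → ℕ) →
    (Fin (d + 1) → ℝ) × unitInterval → ((Fin (d + 1) → ℕ) × ℝ) × (Fin (d + 1) → ℕ) :=
  if h : (∀ i, 0 ≤ p i) ∧ ∑ i, p i = 1 then (exists_sampler h.1 h.2).choose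
  else fun n r _ => ((Pi.single 0 n, 0), r)

lemma measurable_localSampler (p : Fin (d + 1) → ℝ) (n : ℕ) (r : Fin (d + 1) → ℕ) :
    Measurable (localSampler d p n r) := by
  unfold localSampler
  split_ifs with h
  · exact (exists_sampler h.1 h.2).choose_spec.1 n r
  · exact measurable_const

lemma sum_localSampler (p : Fin (d + 1) → ℝ) (n : ℕ) (r : Fin (d + 1) → ℕ)
    (q : (Fin (d + 1) → ℝ) × unitInterval) : ∑ j, (localSampler d p n r q).1.1 j = n := by
  unfold localSampler
  split_ifs with h
  · exact (exists_sampler h.1 h.2).choose_spec.2.1 n r q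
  · simp

lemma le_localSampler (p : Fin (d + 1) → ℝ) (n : ℕ) (r : Fin (d + 1) → ℕ)
    (q : (Fin (d + 1) → ℝ) × unitInterval) :
    r ≤ (localSampler d p n r q).1.1 + (localSampler d p n r q).2 := by
  unfold localSampler
  split_ifs with h
  · exact (exists_sampler h.1 h.2).choose_spec.2.2.1 n r q
  · simp

lemma lintegral_localSampler {p : Fin (d + 1) → ℝ} (hp : ∀ i, 0 ≤ p i) (hp1 : ∑ i, p i = 1)
    (n : ℕ) (b : Fin (d + 1) → ℝ)
    (F : ((Fin (d + 1) → ℕ) × ℝ) × (Fin (d + 1) → ℕ) → ℝ≥0∞) (hF : Measurable F) :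
    ∫⁻ r, ∫⁻ v, F (localSampler d p n r (b, v)) ∂volume ∂(poissonField b) =
      ∫⁻ q, ∫⁻ r, F (q, r) ∂(poissonField fun j => b j - q.2 * p j) ∂(pathLaw p n) := by
  unfold localSampler
  rw [dif_pos ⟨hp, hp1⟩]
  exact (exists_sampler hp hp1).choose_spec.2.2.2 n b F hF

end Sampler

/-- The labels and the positions used to enumerate the neighbourhoods. -/
abbrev LabelNoise (M : ℕ) : Type := Fin (M + 1) × unitInterval

/-- The auxiliary randomness attached to a vertex. -/
abbrev VertexNoise (M : ℕ) : Type := LabelNoise M × unitInterval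

variable {V : Type*} (G : SimpleGraph V) [G.LocallyFinite] (L d M : ℕ)

/-- The matching data of simple random walk at time `L`. -/
def srwData : MatchingData V (Fin (d + 1)) where
  p := srwProb G L
  supp := srwSupport G L
  sampler := localSampler d

open Classical in
/-- The environment determined by the label noise: `x` owns `y` if `x` is the only vertex of its
label from which `y` can be reached. -/
def srwEnv (e : V → LabelNoise M) : MatchingEnv V (Fin (d + 1)) where
  own x y := y ∈ srwSupport G L x ∧ x ∈ srwSupport G L y ∧
    ∀ x' ∈ srwSupport G L y, (e x').1 = (e x).1 → x' = x
  rk x y := Fin.ofNat (d + 1) (((srwSupport G L x).filter fun y' => (e y').2 < (e y).2).card)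

variable {G L d M}

lemma isMeasurable_srwEnv : MatchingEnv.IsMeasurable (srwEnv G L d M) := by
  classical
  constructor
  · intro x y
    simp only [srwEnv]
    refine MeasurableSet.inter (MeasurableSet.const _) (MeasurableSet.inter (MeasurableSet.const _)
      ?_)
    have : {e : V → LabelNoise M | ∀ x' ∈ srwSupport G L y, (e x').1 = (e x).1 → x' = x} =
        ⋂ x' ∈ srwSupport G L y, {e | (e x').1 = (e x).1 → x' = x} := by
      ext e; simp only [Set.mem_ofPred_eq, Set.mem_iInter]
    change MeasurableSet {e : V → LabelNoise M | ∀ x' ∈ srwSupport G L y, (e x').1 = (e x).1 → x' = x}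
    rw [this]
    refine Finset.measurableSet_biInter _ fun x' _ => ?_
    by_cases hx : x' = x
    · simp [hx]
    · simp only [hx, imp_false]
      exact (measurableSet_eq_fun (by fun_prop) (by fun_prop)).compl
  · intro x y
    simp only [srwEnv, Finset.card_filter]
    refine (measurable_from_top (f := Fin.ofNat (d + 1))).comp ?_
    refine Finset.measurable_sum _ fun y' _ => Measurable.ite ?_ measurable_const measurable_const
    exact measurableSet_lt (by fun_prop) (by fun_prop)

/-- Ownership and ranks are defined from supports, equality of labels and comparison of positions,
all of which an automorphism carries along. -/
lemma isImage_srwEnv (φ : G ≃g G) {e e' : V → LabelNoise M} (he : ∀ x, e' (φ x) = e x) :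
    MatchingEnv.IsImage (srwData G L d) φ.toEquiv (srwEnv G L d M e) (srwEnv G L d M e') := by
  have hφ : ∀ x, φ.toEquiv x = φ x := fun _ => rfl
  refine ⟨fun x => srwSupport_aut φ L x, fun x y => srwProb_aut φ L x y, fun x y => ?_,
    fun x y => ?_⟩
  · have hmem : ∀ a b, φ a ∈ srwSupport G L (φ b) ↔ a ∈ srwSupport G L b := fun a b => by
      rw [mem_srwSupport, mem_srwSupport, srwLaw_aut]
    simp only [srwEnv, hφ, hmem, he]
    refine and_congr_right fun _ => and_congr_right fun _ => ⟨fun h z hz hl => ?_,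
      fun h z hz hl => ?_⟩
    · exact φ.injective (h (φ z) ((hmem z y).2 hz) (by rwa [he]))
    · obtain ⟨z, rfl⟩ := φ.surjective z
      rw [h z ((hmem z y).1 hz) (by rwa [he] at hl)]
  · simp only [srwEnv, hφ, srwSupport_aut, Finset.filter_map, Finset.card_map]
    congr 2
    ext z
    simp only [Finset.mem_filter, Function.comp, Equiv.coe_toEmbedding, hφ, he]

lemma isAdmissible_srwEnv (e : V → LabelNoise M) :
    (srwEnv G L d M e).IsAdmissible (srwData G L d) (fun x => ((e x).1 : ℕ)) (M + 1) :=
  ⟨fun h => h.1, fun h => h.2.1, fun {_ _ _} h h' _ heq => h'.2.2 _ h.2.1 (Fin.ext heq)⟩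

/-- The rank of a site in a support counts the sites with smaller position, hence is strictly
increasing in the position. It stays below `d + 1`, so the reduction in `Fin.ofNat` never wraps
around. -/
lemma injOn_rk_srwEnv (hd : ∀ x, (srwSupport G L x).card = d + 1) {e : V → LabelNoise M}
    (he : ∀ x y, (e x).2 = (e y).2 → x = y) (x : V) :
    Set.InjOn ((srwEnv G L d M e).rk x) (srwSupport G L x) := by
  classical
  have hlt : ∀ y ∈ srwSupport G L x,
      ((srwSupport G L x).filter fun y' => (e y').2 < (e y).2).card < d + 1 := fun y hy => by
    rw [← hd x]
    exact Finset.card_lt_card (Finset.filter_ssubset.2 ⟨y, hy, lt_irrefl _⟩)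
  have hmono : ∀ y ∈ srwSupport G L x, ∀ z, (e y).2 < (e z).2 →
      ((srwSupport G L x).filter fun y' => (e y').2 < (e y).2).card <
      ((srwSupport G L x).filter fun y' => (e y').2 < (e z).2).card := fun y hy z hyz => by
    refine Finset.card_lt_card ⟨fun a ha => ?_, fun h => ?_⟩
    · rw [Finset.mem_filter] at ha ⊢
      exact ⟨ha.1, ha.2.trans hyz⟩
    · exact lt_irrefl _ (Finset.mem_filter.1 (h (Finset.mem_filter.2 ⟨hy, hyz⟩))).2
  intro y hy z hz h
  simp only [srwEnv, Fin.ext_iff, Fin.val_ofNat] at h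
  rw [Nat.mod_eq_of_lt (hlt y hy), Nat.mod_eq_of_lt (hlt z hz)] at h
  rcases lt_trichotomy (e y).2 (e z).2 with h1 | h1 | h1
  · exact absurd h (hmono y hy z h1).ne
  · exact he y z h1
  · exact absurd h (hmono z hz y h1).ne'

lemma isFaithful_srwEnv (hd : ∀ x, (srwSupport G L x).card = d + 1) {e : V → LabelNoise M}
    (he : ∀ x y, (e x).2 = (e y).2 → x = y) :
    MatchingEnv.IsFaithful (srwData G L d) (srwEnv G L d M e) := by
  classical
  have h0 : ∀ x j, 0 ≤ (srwData G L d).rates ((srwEnv G L d M e).rk x) x j := fun x j =>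
    Finset.sum_nonneg fun y _ => by
      split_ifs
      · exact srwProb_nonneg _ _ _
      · exact le_rfl
  have h1 : ∀ x, ∑ j, (srwData G L d).rates ((srwEnv G L d M e).rk x) x j = 1 := fun x => by
    simp only [MatchingData.rates]
    rw [Finset.sum_comm, ← sum_srwProb (G := G) L x]
    exact Finset.sum_congr rfl fun y _ => (Finset.sum_eq_single_of_mem
      ((srwEnv G L d M e).rk x y) (Finset.mem_univ _) fun j _ hj => if_neg hj.symm).trans
      (if_pos rfl)
  exact ⟨measurable_localSampler, injOn_rk_srwEnv hd he, h0, h1,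
    fun x n b F hF => lintegral_localSampler (h0 x) (h1 x) n b F hF⟩

/-! ### The matching of two configurations -/

variable (G L d M) (α : ℝ≥0)

/-- The numbers of particles moved from each vertex. -/
def srwResult (n r : V → ℕ) (η : V → VertexNoise M) : V → (Fin (d + 1) → ℕ) × ℝ :=
  (srwEnv G L d M fun x => (η x).1).result (srwData G L d) (fun x => (n x, (η x).2)) α r
    (fun x => ((η x).1.1 : ℕ)) (M + 1)

/-- The number of particles at `x` whose destination is accounted for. -/
def srwTotal (n r : V → ℕ) (η : V → VertexNoise M) (x : V) : ℕ :=
  ∑ y ∈ srwSupport G L x, (srwResult G L d M α n r η x).1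
    ((srwEnv G L d M fun x => (η x).1).rk x y)

open Classical in
/-- The numbers of particles moved along each pair; on the null set where the enumerations are
not injective the particles stay put. -/
def matchCounts (n r : V → ℕ) (η : V → VertexNoise M) (z : V × V) : ℕ :=
  if srwTotal G L d M α n r η z.1 = n z.1 then
    if z.2 ∈ srwSupport G L z.1 then (srwResult G L d M α n r η z.1).1
      ((srwEnv G L d M fun x => (η x).1).rk z.1 z.2) else 0
  else if z.2 = z.1 then n z.1 else 0

variable {G L d M α}

/-- The fallback in `matchCounts` makes this hold without an exceptional set: either the recorded
displacements account for all particles at `x`, or all of them stay put. -/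
lemma tsum_matchCounts (n r : V → ℕ) (η : V → VertexNoise M) (x : V) :
    ∑' y, (matchCounts G L d M α n r η (x, y) : ℝ≥0∞) = n x := by
  by_cases h : srwTotal G L d M α n r η x = n x
  · simp only [matchCounts, h, if_true]
    rw [tsum_eq_sum (s := srwSupport G L x) fun y hy => by simp [hy]]
    rw [Finset.sum_congr rfl fun y hy => by rw [if_pos hy]]
    conv_rhs => rw [← h, srwTotal]
    push_cast
    rfl
  · simp only [matchCounts, h, if_false]
    rw [tsum_eq_single x fun y hy => by simp [hy]]
    simp

lemma matchCounts_aut (φ : G ≃g G) {n n' r r' : V → ℕ} {η η' : V → VertexNoise M}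
    (hn : ∀ x, n' (φ x) = n x) (hr : ∀ x, r' (φ x) = r x) (hη : ∀ x, η' (φ x) = η x) (x y : V) :
    matchCounts G L d M α n' r' η' (φ x, φ y) = matchCounts G L d M α n r η (x, y) := by
  classical
  have hE := isImage_srwEnv (L := L) (d := d) φ (e := fun x => (η x).1) (e' := fun x => (η' x).1)
    fun x => by rw [hη]
  have hR : ∀ x, srwResult G L d M α n' r' η' (φ x) = srwResult G L d M α n r η x := fun x =>
    MatchingEnv.result_image hE (fun x => Prod.ext (hn x) (by
      change (η' (φ x)).2 = _
      rw [hη])) hr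
      (fun x => congrArg (fun q : VertexNoise M => (q.1.1 : ℕ)) (hη x)) _ x
  have hrk : ∀ x y, (srwEnv G L d M fun x => (η' x).1).rk (φ x) (φ y) =
      (srwEnv G L d M fun x => (η x).1).rk x y := hE.rk
  have hT : srwTotal G L d M α n' r' η' (φ x) = srwTotal G L d M α n r η x := by
    simp only [srwTotal, srwSupport_aut, Finset.sum_map, Equiv.coe_toEmbedding]
    exact Finset.sum_congr rfl fun y _ => by
      rw [hR]
      exact congrArg _ (hrk x y)
  have hmem : φ y ∈ srwSupport G L (φ x) ↔ y ∈ srwSupport G L x := by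
    rw [mem_srwSupport, mem_srwSupport, srwLaw_aut]
  simp only [matchCounts, hT, hn, hR, hrk]
  by_cases h1 : srwTotal G L d M α n r η x = n x
  · by_cases h2 : y ∈ srwSupport G L x
    · simp [h1, h2, hmem.2 h2]
    · simp [h1, h2, mt hmem.1 h2]
  · by_cases h2 : y = x
    · simp [h1, h2]
    · simp [h1, h2, φ.injective.ne h2]

lemma measurable_srwResult (x : V) :
    Measurable fun q : (V → ℕ) × (V → ℕ) × (V → VertexNoise M) =>
      srwResult G L d M α q.1 q.2.1 q.2.2 x := by
  have hE : MatchingEnv.IsMeasurable fun q : (V → ℕ) × (V → ℕ) × (V → VertexNoise M) =>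
      srwEnv G L d M fun x => (q.2.2 x).1 := by
    have hm : Measurable fun q : (V → ℕ) × (V → ℕ) × (V → VertexNoise M) =>
        fun x => (q.2.2 x).1 := by fun_prop
    exact ⟨fun x y => hm ((isMeasurable_srwEnv (L := L) (d := d)).own x y),
      fun x y => (isMeasurable_srwEnv.rk x y).comp hm⟩
  exact MatchingEnv.measurable_result (D := srwData G L d) measurable_localSampler hE
    (ζ := fun q x => (q.1 x, (q.2.2 x).2)) (fun x => by fun_prop)
    (r := fun q => q.2.1) (fun y => by fun_prop)
    (l := fun q x => ((q.2.2 x).1.1 : ℕ)) (fun x => (measurable_from_top (f := fun i : Fin (M + 1) => (i : ℕ))).comp (by fun_prop)) (M + 1) x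

lemma measurable_matchCounts (z : V × V) :
    Measurable fun q : (V → ℕ) × (V → ℕ) × (V → VertexNoise M) =>
      matchCounts G L d M α q.1 q.2.1 q.2.2 z := by
  have hm : ∀ x y, Measurable fun q : (V → ℕ) × (V → ℕ) × (V → VertexNoise M) =>
      (srwResult G L d M α q.1 q.2.1 q.2.2 x).1
        ((srwEnv G L d M fun x => (q.2.2 x).1).rk x y) := by
    intro x y
    have h1 : Measurable fun o : Fin (d + 1) × (Fin (d + 1) → ℕ) => o.2 o.1 :=
      measurable_from_prod_countable_right fun j => measurable_pi_apply j
    refine h1.comp (Measurable.prodMk ?_ (measurable_fst.comp (measurable_srwResult x)))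
    exact (isMeasurable_srwEnv.rk x y).comp (by fun_prop)
  have hT : Measurable fun q : (V → ℕ) × (V → ℕ) × (V → VertexNoise M) =>
      srwTotal G L d M α q.1 q.2.1 q.2.2 z.1 := Finset.measurable_sum _ fun y _ => hm z.1 y
  unfold matchCounts
  refine Measurable.ite (measurableSet_eq_fun hT (by fun_prop)) ?_ ?_
  · split_ifs
    · exact hm _ _
    · exact measurable_const
  · split_ifs
    · fun_prop
    · exact measurable_const

section PointMeasures

variable [Countable V] [MeasurableSpace V] [DiscreteMeasurableSpace V]

variable (G L d M α) in
/-- The matching of two point measures. -/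
def matchingMap (q : LocFinPointMeasure V × LocFinPointMeasure V × (V → VertexNoise M)) :
    LocFinPointMeasure (V × V) :=
  LocFinPointMeasure.ofCounts
    (matchCounts G L d M α q.1.counts q.2.1.counts q.2.2)

lemma counts_matchingMap (q : LocFinPointMeasure V × LocFinPointMeasure V × (V → VertexNoise M))
    (z : V × V) : (matchingMap G L d M α q).counts z =
      matchCounts G L d M α q.1.counts q.2.1.counts q.2.2 z :=
  LocFinPointMeasure.counts_ofCounts _ z

lemma measurable_counts_pi : Measurable fun ω : LocFinPointMeasure V => ω.counts :=
  measurable_pi_lambda _ fun x => LocFinPointMeasure.measurable_counts x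

lemma measurable_matchingMap : Measurable (matchingMap G L d M α) := by
  refine LocFinPointMeasure.measurable_of_counts fun z => ?_
  have hg : Measurable fun q : LocFinPointMeasure V × LocFinPointMeasure V ×
      (V → VertexNoise M) => (q.1.counts, q.2.1.counts, q.2.2) :=
    (measurable_counts_pi.comp measurable_fst).prodMk
      ((measurable_counts_pi.comp (measurable_fst.comp measurable_snd)).prodMk
        (measurable_snd.comp measurable_snd))
  generalize hf : (fun q : (V → ℕ) × (V → ℕ) × (V → VertexNoise M) =>
      matchCounts G L d M α q.1 q.2.1 q.2.2 z) = f
  have hm : Measurable f := hf ▸ measurable_matchCounts z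
  have he : (fun w => (matchingMap G L d M α w).counts z) =
      f ∘ fun q => (q.1.counts, q.2.1.counts, q.2.2) := by
    ext q
    rw [counts_matchingMap, ← hf]
    rfl
  rw [he]
  exact hm.comp hg

lemma matchingMap_aut (φ : G ≃g G) (ω₁ ω₂ : LocFinPointMeasure V) (η : V → VertexNoise M) :
    matchingMap G L d M α (autActV φ ω₁, autActV φ ω₂, autActFamily φ η) =
      autActVV φ (matchingMap G L d M α (ω₁, ω₂, η)) := by
  have hc : ∀ (ω : LocFinPointMeasure V) x, (autActV φ ω).counts (φ x) = ω.counts x :=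
    fun ω x => LocFinPointMeasure.counts_image (autMeasurableEquiv φ) ω x
  refine LocFinPointMeasure.ext_counts fun z => ?_
  obtain ⟨x, y⟩ := z
  obtain ⟨x, rfl⟩ := φ.surjective x
  obtain ⟨y, rfl⟩ := φ.surjective y
  have h := LocFinPointMeasure.counts_image
    ((autMeasurableEquiv φ).prodCongr (autMeasurableEquiv φ)) (matchingMap G L d M α (ω₁, ω₂, η))
    (x, y)
  refine Eq.trans ?_ h.symm
  rw [counts_matchingMap, counts_matchingMap]
  exact matchCounts_aut φ (hc ω₁) (hc ω₂) (fun x => by simp [autActFamily]) x y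

lemma projFst_singleton (ω : LocFinPointMeasure (V × V)) (x : V) :
    projFst ω {x} = ∑' y, (ω.counts (x, y) : ℝ≥0∞) := by
  rw [projFst, Measure.map_apply measurable_fst (measurableSet_singleton x),
    ← Measure.tsum_indicator_apply_singleton ω.1 _ (measurable_fst (measurableSet_singleton x)),
    ENNReal.tsum_prod', tsum_eq_single x fun x' hx' => by simp [hx']]
  exact tsum_congr fun y => by simp [LocFinPointMeasure.coe_counts]

lemma projSnd_singleton (ω : LocFinPointMeasure (V × V)) (o : V) :
    projSnd ω {o} = ∑' x, (ω.counts (x, o) : ℝ≥0∞) := by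
  rw [projSnd, Measure.map_apply measurable_snd (measurableSet_singleton o),
    ← Measure.tsum_indicator_apply_singleton ω.1 _ (measurable_snd (measurableSet_singleton o)),
    ENNReal.tsum_prod']
  refine tsum_congr fun x => ?_
  rw [tsum_eq_single o fun y hy => by simp [hy]]
  simp [LocFinPointMeasure.coe_counts]

lemma projFst_matchingMap (ω₁ ω₂ : LocFinPointMeasure V) (η : V → VertexNoise M) :
    projFst (matchingMap G L d M α (ω₁, ω₂, η)) = ω₁.1 := by
  refine Measure.ext_of_singleton fun x => ?_
  rw [projFst_singleton, ← LocFinPointMeasure.coe_counts]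
  simp only [counts_matchingMap]
  exact tsum_matchCounts _ _ _ x

end PointMeasures

end Matching

/-! ### The law of the labels and of the auxiliary noise -/

section LabelLaw

/-- The law of the label noise. -/
def labelMeasure (M : ℕ) : Measure (LabelNoise M) :=
  (uniformOn (Set.univ : Set (Fin (M + 1)))).prod (volume : Measure unitInterval)

/-- The law of the auxiliary randomness attached to a vertex. -/
def vertexMeasure (M : ℕ) : Measure (VertexNoise M) :=
  (labelMeasure M).prod (volume : Measure unitInterval)

instance (M : ℕ) : IsProbabilityMeasure (uniformOn (Set.univ : Set (Fin (M + 1)))) :=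
  isProbabilityMeasure_uniformOn Set.finite_univ Set.univ_nonempty

instance (M : ℕ) : IsProbabilityMeasure (labelMeasure M) := by unfold labelMeasure; infer_instance

instance (M : ℕ) : IsProbabilityMeasure (vertexMeasure M) := by unfold vertexMeasure; infer_instance

variable {V : Type*} {M : ℕ}

lemma labelMeasure_snd_eq (u : unitInterval) : labelMeasure M {z | z.2 = u} = 0 := by
  have : {z : LabelNoise M | z.2 = u} = Set.univ ×ˢ {u} := by ext; simp
  rw [this, labelMeasure, Measure.prod_prod]
  simp

lemma labelMeasure_fst_eq (k : Fin (M + 1)) :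
    labelMeasure M {z | z.1 = k} = ((M + 1 : ℕ) : ℝ≥0∞)⁻¹ := by
  have : {z : LabelNoise M | z.1 = k} = {k} ×ˢ Set.univ := by ext; simp
  rw [this, labelMeasure, Measure.prod_prod, uniformOn_univ]
  simp

/-- Freeze the noise at `y` and resample it at `x`: the conditional probability of a match is `c`
whatever value is to be hit. It serves for coinciding positions (`c = 0`) and for coinciding labels
(`c = 1/(M+1)`). -/
lemma infinitePi_labelMeasure_eq {x y : V} (hxy : x ≠ y) {T : Type*} [MeasurableSpace T]
    [MeasurableEq T]
    {f : LabelNoise M → T} (hf : Measurable f) {c : ℝ≥0∞}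
    (hc : ∀ t, labelMeasure M {z | f z = t} = c) :
    (Measure.infinitePi fun _ : V => labelMeasure M) {e | f (e x) = f (e y)} = c := by
  classical
  have hm : MeasurableSet {e : V → LabelNoise M | f (e x) = f (e y)} :=
    measurableSet_eq_fun (by fun_prop) (by fun_prop)
  rw [← lintegral_indicator_one hm, ← lintegral_infinitePi_update _ x
    (measurable_one.indicator hm)]
  have h : ∀ e : V → LabelNoise M, ∫⁻ z, ({e : V → LabelNoise M | f (e x) = f (e y)}.indicator 1
      (Function.update e x z) : ℝ≥0∞) ∂(labelMeasure M) = c := by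
    intro e
    rw [← hc (f (e y))]
    have hm' : MeasurableSet {z : LabelNoise M | f z = f (e y)} :=
      measurableSet_eq_fun hf measurable_const
    rw [← lintegral_indicator_one hm']
    refine lintegral_congr fun z => ?_
    simp only [Set.indicator_apply, Set.mem_ofPred_eq, Function.update_self,
      Function.update_of_ne hxy.symm, Pi.one_apply]
  simp_rw [h]
  simp

lemma ae_injective_label [Countable V] :
    ∀ᵐ e ∂(Measure.infinitePi fun _ : V => labelMeasure M), ∀ x y, (e x).2 = (e y).2 → x = y := by
  refine ae_all_iff.2 fun x => ae_all_iff.2 fun y => ?_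
  by_cases hxy : x = y
  · exact Filter.Eventually.of_forall fun _ _ => hxy
  · have h := infinitePi_labelMeasure_eq (M := M) hxy measurable_snd labelMeasure_snd_eq
    have h2 : ∀ᵐ e ∂(Measure.infinitePi fun _ : V => labelMeasure M), ¬ (e x).2 = (e y).2 := by
      rw [ae_iff]
      simpa using h
    filter_upwards [h2] with e he he'
    exact absurd he' he

/-- The vertex noise is a product of the label noise and of further independent noise. -/
lemma lintegral_vertexMeasure (α : ℝ≥0) {F : (V → ℕ) × (V → ℕ) × (V → VertexNoise M) → ℝ≥0∞}
    (hF : Measurable F) :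
    ∫⁻ q, ∫⁻ η, F (q.1, q.2, η) ∂(Measure.infinitePi fun _ : V => vertexMeasure M)
        ∂((poissonField fun _ : V => (α : ℝ)).prod (poissonField fun _ : V => (α : ℝ))) =
      ∫⁻ e, ∫⁻ ζ, ∫⁻ r, F (fun x => (ζ x).1, r, fun x => (e x, (ζ x).2))
        ∂(poissonField fun _ : V => (α : ℝ))
        ∂(Measure.infinitePi fun _ : V => (poissonMeasure α).prod (volume : Measure unitInterval))
        ∂(Measure.infinitePi fun _ : V => labelMeasure M) := by
  have hzip1 := map_zip_infinitePi (fun _ : V => labelMeasure M)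
    (fun _ : V => (volume : Measure unitInterval))
  have hzip2 := map_zip_infinitePi (fun _ : V => poissonMeasure α)
    (fun _ : V => (volume : Measure unitInterval))
  have hpf : (poissonField fun _ : V => (α : ℝ)) = Measure.infinitePi fun _ => poissonMeasure α := by
    simp [poissonField]
  have hz1 : Measurable fun q : (V → LabelNoise M) × (V → unitInterval) =>
    fun x => (q.1 x, q.2 x) := by fun_prop
  have hz2 : Measurable fun q : (V → ℕ) × (V → unitInterval) =>
    fun x => (q.1 x, q.2 x) := by fun_prop
  -- the left-hand side
  have hL : ∀ n r, ∫⁻ η, F (n, r, η) ∂(Measure.infinitePi fun _ : V => vertexMeasure M) =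
      ∫⁻ e, ∫⁻ v, F (n, r, fun x => (e x, v x)) ∂(Measure.infinitePi fun _ : V => volume)
        ∂(Measure.infinitePi fun _ : V => labelMeasure M) := by
    intro n r
    have hFm : Measurable fun η => F (n, r, η) := hF.comp (by fun_prop)
    unfold vertexMeasure
    rw [← hzip1, lintegral_map hFm hz1, lintegral_prod
      (fun a : (V → LabelNoise M) × (V → unitInterval) => F (n, r, fun x => (a.1 x, a.2 x)))
      (hFm.comp hz1).aemeasurable]
  have hG1 : Measurable fun o : (((V → ℕ) × (V → ℕ)) × (V → LabelNoise M)) × (V → unitInterval) =>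
      F (o.1.1.1, o.1.1.2, fun x => (o.1.2 x, o.2 x)) := hF.comp (by fun_prop)
  have hG2 := Measurable.lintegral_prod_right' (ν := Measure.infinitePi fun _ : V =>
    (volume : Measure unitInterval)) hG1
  simp_rw [hL]
  rw [lintegral_lintegral_swap hG2.aemeasurable]
  refine lintegral_congr fun e => ?_
  have hG3 : Measurable fun o : ((V → ℕ) × (V → ℕ)) × (V → unitInterval) =>
      F (o.1.1, o.1.2, fun x => (e x, o.2 x)) := hF.comp (by fun_prop)
  have hG4 : Measurable fun ζ : V → ℕ × unitInterval =>
      ∫⁻ r, F (fun x => (ζ x).1, r, fun x => (e x, (ζ x).2))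
        ∂(poissonField fun _ : V => (α : ℝ)) :=
    Measurable.lintegral_prod_right' (f := fun o : (V → ℕ × unitInterval) × (V → ℕ) =>
      F (fun x => (o.1 x).1, o.2, fun x => (e x, (o.1 x).2))) (hF.comp (by fun_prop))
  rw [lintegral_prod _ (Measurable.lintegral_prod_right' hG3).aemeasurable, ← hzip2,
    lintegral_map hG4 hz2, lintegral_prod (fun a : (V → ℕ) × (V → unitInterval) =>
      ∫⁻ r, F (fun x => a.1 x, r, fun x => (e x, a.2 x)) ∂(poissonField fun _ : V => (α : ℝ))) (hG4.comp hz2).aemeasurable, ← hpf]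
  refine lintegral_congr fun n => ?_
  have hG5 : Measurable fun o : (V → ℕ) × (V → unitInterval) =>
      F (n, o.1, fun x => (e x, o.2 x)) := hF.comp (by fun_prop)
  exact lintegral_lintegral_swap hG5.aemeasurable

end LabelLaw

/-! ### The law of the matching for fixed labels and positions -/

section MatchingLaw

open MatchingEnv

/-- Outside `O` the parameter is zero, and a Poisson variable of parameter zero vanishes almost
surely, so filling in zeros is the same as filling in that field. -/
lemma map_embed_poissonField {V κ : Type*} [Countable V] [Fintype κ] (O : V → Prop)
    [DecidablePred O] (e : V → κ) (he : ∀ y z, O y → O z → e y = e z → y = z) (b : V → ℝ)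
    (b' : κ → ℝ) (h1 : ∀ y, O y → b y = b' (e y)) (h2 : ∀ y, ¬ O y → b y = 0) :
    (poissonField b').map (fun σ y => if O y then σ (e y) else 0) = poissonField b := by
  have hm : Measurable fun (σ : κ → ℕ) (y : V) => if O y then σ (e y) else 0 :=
    (measurable_glueAlong (X := ℕ) O e).comp (measurable_prodMk_left (x := fun _ => 0))
  refine Measure.ext fun A hA => ?_
  rw [Measure.map_apply hm hA, ← lintegral_indicator_one hA, ← lintegral_indicator_one (hm hA)]
  rw [poissonField, poissonField, ← lintegral_infinitePi_glueAlong O e he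
    (fun _ => poissonMeasure (0 : ℝ).toNNReal) (fun y => poissonMeasure (b y).toNNReal)
    (fun j => poissonMeasure (b' j).toNNReal) (fun y hy => by rw [h1 y hy])
    (fun y hy => by rw [h2 y hy]) (measurable_one.indicator hA)]
  have h0 : ∀ᵐ ρ ∂(poissonField fun _ : V => (0 : ℝ)), ∀ y, ρ y = 0 :=
    ae_all_iff.2 fun y => ae_poissonField_eq_zero _ rfl
  have h3 : ∀ᵐ ρ ∂(poissonField fun _ : V => (0 : ℝ)),
      ∫⁻ σ, A.indicator 1 (glueAlong O e σ ρ) ∂(Measure.infinitePi fun j =>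
        poissonMeasure (b' j).toNNReal) = ∫⁻ σ, ((fun (σ : κ → ℕ) (y : V) =>
          if O y then σ (e y) else 0) ⁻¹' A).indicator (1 : (κ → ℕ) → ℝ≥0∞) σ
          ∂(Measure.infinitePi fun j => poissonMeasure (b' j).toNNReal) := by
    filter_upwards [h0] with ρ hρ
    refine lintegral_congr fun σ => ?_
    have : glueAlong O e σ ρ = fun y => if O y then σ (e y) else 0 := by
      ext y; simp [glueAlong, hρ y]
    rw [this]
    rfl
  refine Eq.symm ((lintegral_congr_ae h3).trans ?_)
  rw [lintegral_const, measure_univ, mul_one]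

variable {V : Type*} [Countable V] {G : SimpleGraph V} [G.LocallyFinite] {L d M : ℕ} {α : ℝ≥0}
  (hd : ∀ x, (srwSupport G L x).card = d + 1) {e : V → LabelNoise M}
  (he : ∀ x y, (e x).2 = (e y).2 → x = y)

include hd he

/-- With distinct positions the ranks of the `d + 1` sites of a support exhaust `Fin (d + 1)`, so
every displaced particle is counted and the fallback is not used. -/
lemma srwTotal_eq (ζ : V → ℕ × unitInterval) (r : V → ℕ) (x : V) :
    srwTotal G L d M α (fun x => (ζ x).1) r (fun x => (e x, (ζ x).2)) x = (ζ x).1 := by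
  classical
  have hinj := injOn_rk_srwEnv hd he x
  have himg : (srwSupport G L x).image ((srwEnv G L d M e).rk x) = Finset.univ := by
    refine Finset.eq_univ_of_card _ ?_
    rw [Finset.card_image_of_injOn hinj, hd, Fintype.card_fin]
  rw [srwTotal, ← Finset.sum_image (f := fun j => (srwResult G L d M α (fun x => (ζ x).1) r
    (fun x => (e x, (ζ x).2)) x).1 j) hinj, himg, srwResult, result, if_pos (e x).1.is_lt]
  exact sum_localSampler _ _ _ _

open Classical in
lemma matchCounts_eq (ζ : V → ℕ × unitInterval) (r : V → ℕ) (z : V × V) :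
    matchCounts G L d M α (fun x => (ζ x).1) r (fun x => (e x, (ζ x).2)) z =
      if z.2 ∈ srwSupport G L z.1 then ((srwEnv G L d M e).result (srwData G L d) ζ α r
        (fun x => ((e x).1 : ℕ)) (M + 1) z.1).1 ((srwEnv G L d M e).rk z.1 z.2) else 0 := by
  rw [matchCounts, if_pos (srwTotal_eq hd he ζ r z.1)]
  rfl

/-- For a fixed environment the numbers of particles moved along the pairs are independent Poisson
variables. -/
lemma map_matchCounts :
    ((Measure.infinitePi fun _ : V => (poissonMeasure α).prod (volume : Measure unitInterval)).prod
      (poissonField fun _ : V => (α : ℝ))).map (fun q => matchCounts G L d M α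
        (fun x => (q.1 x).1) q.2 (fun x => (e x, (q.1 x).2))) =
      poissonField fun z : V × V => α * srwProb G L z.1 z.2 := by
  classical
  have hF := isFaithful_srwEnv hd he
  set E := srwEnv G L d M e with hE
  set D := srwData G L d with hD
  have hP : ∀ x, IsProbabilityMeasure (particleLaw α (D.rates (E.rk x) x)) := fun x =>
    isProbabilityMeasure_particleLaw α (hF.nonneg x) (hF.sum_eq_one x)
  let f : V → (Fin (d + 1) → ℕ) × ℝ → V → ℕ := fun x q y =>
    if y ∈ srwSupport G L x then q.1 (E.rk x y) else 0
  have hf' : ∀ x, Measurable fun (σ : Fin (d + 1) → ℕ) (y : V) =>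
      if y ∈ srwSupport G L x then σ (E.rk x y) else 0 := fun x =>
    (measurable_glueAlong (X := ℕ) (fun y => y ∈ srwSupport G L x) (E.rk x)).comp
      (measurable_prodMk_left (x := fun _ => 0))
  have hf : ∀ x, Measurable (f x) := fun x => (hf' x).comp measurable_fst
  have hlaw := map_result (α := α) hF (isAdmissible_srwEnv e) fun x => (e x).1.is_lt
  have hm : Measurable fun q : (V → ℕ × unitInterval) × (V → ℕ) =>
      E.result D q.1 α q.2 (fun x => ((e x).1 : ℕ)) (M + 1) :=
    measurable_pi_lambda _ fun y => measurable_result (E := fun _ => E)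
      (l := fun _ x => ((e x).1 : ℕ)) hF.measurable
      ⟨fun _ _ => MeasurableSet.const _, fun _ _ => measurable_const⟩ (fun x => by fun_prop)
      (fun y => by fun_prop) (fun _ => measurable_const) _ y
  have h1 : (fun q : (V → ℕ × unitInterval) × (V → ℕ) => matchCounts G L d M α
        (fun x => (q.1 x).1) q.2 (fun x => (e x, (q.1 x).2))) =
      (MeasurableEquiv.curry V V ℕ).symm ∘ (fun X x => f x (X x)) ∘
        fun q => E.result D q.1 α q.2 (fun x => ((e x).1 : ℕ)) (M + 1) := by
    ext q z
    rw [matchCounts_eq hd he]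
    rfl
  have h2 : ∀ x, (particleLaw α (D.rates (E.rk x) x)).map (f x) =
      poissonField fun y => α * srwProb G L x y := by
    intro x
    have h3 : (particleLaw α (D.rates (E.rk x) x)).map Prod.fst =
        poissonField fun j => α * D.rates (E.rk x) x j := by
      refine Measure.ext fun A hA => ?_
      rw [← lintegral_indicator_one hA, ← lintegral_indicator_one hA,
        lintegral_map (measurable_one.indicator hA) measurable_fst,
        lintegral_particleLaw_counts α (hF.nonneg x) (hF.sum_eq_one x)]
    have h4 : f x = (fun (σ : Fin (d + 1) → ℕ) (y : V) =>
      if y ∈ srwSupport G L x then σ (E.rk x y) else 0) ∘ Prod.fst := rfl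
    rw [h4, ← Measure.map_map (hf' x) measurable_fst, h3]
    refine map_embed_poissonField (fun y => y ∈ srwSupport G L x) (E.rk x)
      (fun y z hy hz h => hF.injOn x hy hz h) _ _ (fun y hy => ?_) fun y hy => ?_
    · rw [rates_rk hF hy]
      rfl
    · rw [srwProb_eq_zero hy, mul_zero]
  have hfm : Measurable fun (X : V → (Fin (d + 1) → ℕ) × ℝ) x => f x (X x) :=
    measurable_pi_lambda _ fun x => (hf x).comp (measurable_pi_apply x)
  rw [h1, ← Measure.map_map (MeasurableEquiv.measurable _) (hfm.comp hm),
    ← Measure.map_map hfm hm, hlaw, Measure.infinitePi_map_pi _ hf]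
  simp_rw [h2]
  exact Measure.infinitePi_map_curry_symm fun x y => poissonMeasure (α * srwProb G L x y).toNNReal

/-- The mean number of points at `o` which are not matched, for a fixed environment. -/
lemma lintegral_unmatched_le (htrans : IsVertexTransitive G) (o : V) {c : ℝ} (hc : 0 < c)
    (hvar : 2 * α * srwProb G (2 * L) o o ≤ c ^ 2) :
    ∫⁻ ζ, ∫⁻ r, (((r o : ℕ) : ℝ≥0∞) - ∑' x, (matchCounts G L d M α (fun x => (ζ x).1) r
        (fun x => (e x, (ζ x).2)) (x, o) : ℝ≥0∞)) ∂(poissonField fun _ : V => (α : ℝ))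
        ∂(Measure.infinitePi fun _ : V => (poissonMeasure α).prod (volume : Measure unitInterval)) ≤
      ENNReal.ofReal (c / 2) +
        ENNReal.ofReal (α * (1 - (srwEnv G L d M e).ownMass (srwData G L d) o)) := by
  have hF := isFaithful_srwEnv hd he
  have hA := isAdmissible_srwEnv (G := G) (L := L) (d := d) e
  refine le_trans ?_ ((lintegral_state (α := α) hF hA (fun x => (e x).1.is_lt) o).le.trans
    (lintegral_budget_le hF o hc ?_))
  -- A point at `o` that is not left at the end has been met by a particle which moved to `o`, so
  -- the unmatched excess is at most what is left.
  · refine lintegral_mono fun ζ => lintegral_mono fun r => ?_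
    refine tsub_le_iff_right.2 ?_
    have h1 := le_state_add_sum (D := srwData G L d) (E := srwEnv G L d M e) (ζ := ζ) (α := α)
      (r := r) (l := fun x => ((e x).1 : ℕ)) le_localSampler hA.mem_supp o (M + 1)
    have h2 : ((r o : ℕ) : ℝ≥0∞) ≤ (((srwEnv G L d M e).state (srwData G L d) ζ α r
        (fun x => ((e x).1 : ℕ)) (M + 1) o).2 : ℝ≥0∞) +
        ∑ x ∈ srwSupport G L o, (((srwEnv G L d M e).result (srwData G L d) ζ α r
        (fun x => ((e x).1 : ℕ)) (M + 1) x).1 ((srwEnv G L d M e).rk x o) : ℝ≥0∞) := by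
      exact_mod_cast h1
    refine h2.trans (add_le_add le_rfl (le_trans (le_of_eq ?_)
      (ENNReal.sum_le_tsum (srwSupport G L o))))
    refine Finset.sum_congr rfl fun x hx => ?_
    rw [matchCounts_eq hd he, if_pos ((mem_srwSupport_comm htrans).2 hx)]
  · refine le_trans (le_of_eq ?_) hvar
    rw [← sum_srwProb_sq htrans]
    rfl

end MatchingLaw

/-! ### The mass lost to coinciding labels -/

section OwnMass

variable {V : Type*} {G : SimpleGraph V} [G.LocallyFinite] {L d M : ℕ}

-- The transition probabilities into `o` sum to one, so the defect is the mass of the vertices not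
-- owning `o`. Such a vertex shares its label with another one that reaches `o`, and that pair alone
-- dominates its contribution.
open Classical in
lemma one_sub_ownMass_le (htrans : IsVertexTransitive G) (e : V → LabelNoise M) (o : V) :
    1 - (srwEnv G L d M e).ownMass (srwData G L d) o ≤
      ∑ x ∈ srwSupport G L o, ∑ x' ∈ (srwSupport G L o).erase x,
        srwProb G L x o * if (e x).1 = (e x').1 then 1 else 0 := by
  have h1 : ∑ x ∈ srwSupport G L o, srwProb G L x o = 1 := by
    simp_rw [srwProb_comm htrans L _ o]
    exact sum_srwProb L o
  suffices key : ∑ x ∈ srwSupport G L o, srwProb G L x o -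
      (srwEnv G L d M e).ownMass (srwData G L d) o ≤
      ∑ x ∈ srwSupport G L o, ∑ x' ∈ (srwSupport G L o).erase x,
        srwProb G L x o * if (e x).1 = (e x').1 then 1 else 0 by
    rwa [h1] at key
  rw [MatchingEnv.ownMass]
  change _ - ∑ x ∈ srwSupport G L o, _ ≤ _
  rw [← Finset.sum_sub_distrib]
  refine Finset.sum_le_sum fun x hx => ?_
  change srwProb G L x o - (if (srwEnv G L d M e).own x o then srwProb G L x o else 0) ≤ _
  have h0 : ∀ x' ∈ (srwSupport G L o).erase x,
      0 ≤ srwProb G L x o * if (e x).1 = (e x').1 then 1 else 0 := fun x' _ =>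
    mul_nonneg (srwProb_nonneg _ _ _) (by split_ifs <;> norm_num)
  by_cases ho : (srwEnv G L d M e).own x o
  · rw [if_pos ho, sub_self]
    exact Finset.sum_nonneg h0
  · rw [if_neg ho, sub_zero]
    have h2 : ∃ x' ∈ srwSupport G L o, (e x').1 = (e x).1 ∧ x' ≠ x := by
      by_contra hcon
      push Not at hcon
      exact ho ⟨(mem_srwSupport_comm htrans).1 hx, hx, hcon⟩
    obtain ⟨x', hx', hl, hne⟩ := h2
    refine le_trans ?_ (Finset.single_le_sum h0 (Finset.mem_erase.2 ⟨hne, hx'⟩))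
    simp [hl]

/-- On average, most transitions to `o` start from vertices which own `o`. -/
lemma lintegral_one_sub_ownMass_le (htrans : IsVertexTransitive G)
    (hd : ∀ x, (srwSupport G L x).card = d + 1) (o : V) :
    ∫⁻ e, ENNReal.ofReal (1 - (srwEnv G L d M e).ownMass (srwData G L d) o)
        ∂(Measure.infinitePi fun _ : V => labelMeasure M) ≤
      ENNReal.ofReal ((d + 1) / (M + 1)) := by
  classical
  have h1 : ∑ x ∈ srwSupport G L o, srwProb G L x o = 1 := by
    simp_rw [srwProb_comm htrans L _ o]
    exact sum_srwProb L o
  have hM : ENNReal.ofReal ((M + 1 : ℝ)⁻¹) = ((M + 1 : ℕ) : ℝ≥0∞)⁻¹ := by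
    rw [ENNReal.ofReal_inv_of_pos (by positivity)]
    congr 1
    exact_mod_cast ENNReal.ofReal_natCast (M + 1)
  have hpair : ∀ x x', x ≠ x' → ∫⁻ e : V → LabelNoise M,
      ENNReal.ofReal (if (e x).1 = (e x').1 then 1 else 0)
        ∂(Measure.infinitePi fun _ : V => labelMeasure M) = ENNReal.ofReal ((M + 1 : ℝ)⁻¹) := by
    intro x x' hne
    have h := infinitePi_labelMeasure_eq (M := M) hne measurable_fst labelMeasure_fst_eq
    have hm : MeasurableSet {e : V → LabelNoise M | (e x).1 = (e x').1} :=
      measurableSet_eq_fun (by fun_prop) (by fun_prop)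
    rw [hM, ← h, ← lintegral_indicator_one hm]
    refine lintegral_congr fun e => ?_
    by_cases hx : (e x).1 = (e x').1 <;> simp [hx]
  have hmeas : ∀ x x', Measurable fun e : V → LabelNoise M =>
      ENNReal.ofReal (srwProb G L x o * if (e x).1 = (e x').1 then 1 else 0) := fun x x' => by
    refine ENNReal.measurable_ofReal.comp (Measurable.const_mul (Measurable.ite ?_
      measurable_const measurable_const) _)
    exact measurableSet_eq_fun (by fun_prop) (by fun_prop)
  have h0 : ∀ (e : V → LabelNoise M) x x', 0 ≤ srwProb G L x o *
      if (e x).1 = (e x').1 then 1 else 0 := fun e x x' =>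
    mul_nonneg (srwProb_nonneg _ _ _) (by split_ifs <;> norm_num)
  calc _ ≤ ∫⁻ e, ∑ x ∈ srwSupport G L o, ∑ x' ∈ (srwSupport G L o).erase x,
        ENNReal.ofReal (srwProb G L x o * if (e x).1 = (e x').1 then 1 else 0)
        ∂(Measure.infinitePi fun _ : V => labelMeasure M) := by
        refine lintegral_mono fun e => (ENNReal.ofReal_le_ofReal
          (one_sub_ownMass_le htrans e o)).trans (le_of_eq ?_)
        rw [ENNReal.ofReal_sum_of_nonneg fun x _ => Finset.sum_nonneg fun x' _ => h0 e x x']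
        refine Finset.sum_congr rfl fun x _ => ?_
        rw [ENNReal.ofReal_sum_of_nonneg fun x' _ => h0 e x x']
    _ = ∑ x ∈ srwSupport G L o, ∑ x' ∈ (srwSupport G L o).erase x,
        ENNReal.ofReal (srwProb G L x o * (M + 1 : ℝ)⁻¹) := by
        rw [lintegral_finsetSum _ fun x _ => Finset.measurable_sum _ fun x' _ => hmeas x x']
        refine Finset.sum_congr rfl fun x _ => ?_
        rw [lintegral_finsetSum _ fun x' _ => hmeas x x']
        refine Finset.sum_congr rfl fun x' hx' => ?_
        rw [ENNReal.ofReal_mul (srwProb_nonneg _ _ _), ← hpair x x' (Finset.ne_of_mem_erase hx').symm,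
          ← lintegral_const_mul']
        · refine lintegral_congr fun e => ENNReal.ofReal_mul (srwProb_nonneg _ _ _)
        · exact ENNReal.ofReal_ne_top
    _ ≤ ∑ x ∈ srwSupport G L o, ENNReal.ofReal (srwProb G L x o * ((d + 1) / (M + 1))) := by
        refine Finset.sum_le_sum fun x hx => ?_
        rw [Finset.sum_const, Finset.card_erase_of_mem hx, hd, nsmul_eq_mul, Nat.add_sub_cancel,
          ← ENNReal.ofReal_natCast, ← ENNReal.ofReal_mul (by positivity)]
        refine ENNReal.ofReal_le_ofReal ?_
        have hp := srwProb_nonneg (G := G) L x o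
        rw [div_eq_mul_inv]
        have hi : (0 : ℝ) ≤ (M + 1 : ℝ)⁻¹ := by positivity
        nlinarith [mul_nonneg hp hi]
    _ = ENNReal.ofReal ((d + 1) / (M + 1)) := by
        rw [← ENNReal.ofReal_sum_of_nonneg fun x _ =>
          mul_nonneg (srwProb_nonneg _ _ _) (by positivity), ← Finset.sum_mul, h1, one_mul]

end OwnMass

/-! ### From the canonical space to arbitrary driving processes -/

section Coupling

variable {V : Type*} [Countable V] [MeasurableSpace V] [DiscreteMeasurableSpace V]
  {G : SimpleGraph V} [G.LocallyFinite] {L d M : ℕ} {α : ℝ≥0}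
  {Ω : Type*} [MeasurableSpace Ω] {P : Measure Ω} [IsProbabilityMeasure P]
  {R₁ R₂ : Ω → LocFinPointMeasure V} {η : V → Ω → VertexNoise M}

lemma map_counts_of_smul_count {R : Ω → LocFinPointMeasure V}
    (h : IsPoissonPointProcess P R ((α : ℝ≥0∞) • Measure.count)) :
    P.map (fun w z => (R w).counts z) = poissonField fun _ => (α : ℝ) :=
  h.map_counts fun z => by simp

/-- Expectations with respect to the driving processes are integrals over the canonical space. -/
lemma lintegral_driving (h1 : IsPoissonPointProcess P R₁ ((α : ℝ≥0∞) • Measure.count))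
    (h2 : IsPoissonPointProcess P R₂ ((α : ℝ≥0∞) • Measure.count)) (h12 : IndepFun R₁ R₂ P)
    (hη : ∀ x, Measurable (η x)) (hlaw : ∀ x, P.map (η x) = vertexMeasure M) (hind : iIndepFun η P)
    (hR : IndepFun (fun w => (R₁ w, R₂ w)) (fun w x => η x w) P)
    {F : (V → ℕ) × (V → ℕ) × (V → VertexNoise M) → ℝ≥0∞} (hF : Measurable F) :
    ∫⁻ w, F ((R₁ w).counts, (R₂ w).counts, fun x => η x w) ∂P =
      ∫⁻ e, ∫⁻ ζ, ∫⁻ r, F (fun x => (ζ x).1, r, fun x => (e x, (ζ x).2))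
        ∂(poissonField fun _ : V => (α : ℝ))
        ∂(Measure.infinitePi fun _ : V => (poissonMeasure α).prod (volume : Measure unitInterval))
        ∂(Measure.infinitePi fun _ : V => labelMeasure M) := by
  have hc := measurable_counts_pi (V := V)
  have hm1 := hc.comp h1.measurable
  have hm2 := hc.comp h2.measurable
  have hmη : Measurable fun w x => η x w := measurable_pi_lambda _ hη
  have hA : P.map (fun w => ((R₁ w).counts, (R₂ w).counts)) =
      (poissonField fun _ : V => (α : ℝ)).prod (poissonField fun _ : V => (α : ℝ)) := by
    have := (indepFun_iff_map_prod_eq_prod_map_map hm1.aemeasurable hm2.aemeasurable).1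
      (h12.comp hc hc)
    exact this.trans (congrArg₂ Measure.prod (map_counts_of_smul_count h1)
      (map_counts_of_smul_count h2))
  have hB : P.map (fun w x => η x w) = Measure.infinitePi fun _ : V => vertexMeasure M := by
    rw [(iIndepFun_iff_map_fun_eq_infinitePi_map hη).1 hind]
    simp_rw [hlaw]
  have hAB := (indepFun_iff_map_prod_eq_prod_map_map (hm1.prodMk hm2).aemeasurable
    hmη.aemeasurable).1 (hR.comp (hc.prodMap hc) measurable_id)
  have hFm : Measurable fun q : ((V → ℕ) × (V → ℕ)) × (V → VertexNoise M) =>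
      F (q.1.1, q.1.2, q.2) := hF.comp (by fun_prop)
  rw [← lintegral_vertexMeasure α hF, ← lintegral_prod (fun q : ((V → ℕ) × (V → ℕ)) ×
    (V → VertexNoise M) => F (q.1.1, q.1.2, q.2)) hFm.aemeasurable, ← hA, ← hB]
  refine Eq.trans ?_ (congrArg (fun μ => ∫⁻ q, F (q.1.1, q.1.2, q.2) ∂μ) hAB)
  rw [lintegral_map hFm ((hm1.prodMk hm2).prodMk hmη)]
  rfl

lemma pairIntensity_singleton (z : V × V) :
    pairIntensity G α L {z} = ENNReal.ofReal (α * srwProb G L z.1 z.2) := by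
  rw [pairIntensity, Measure.sum_apply _ (measurableSet_singleton z),
    tsum_eq_single z fun y hy => by simp [hy]]
  simp

/-- The matched pairs form a Poisson point process. -/
lemma isPoissonPointProcess_matchingMap (hd : ∀ x, (srwSupport G L x).card = d + 1)
    (h1 : IsPoissonPointProcess P R₁ ((α : ℝ≥0∞) • Measure.count))
    (h2 : IsPoissonPointProcess P R₂ ((α : ℝ≥0∞) • Measure.count)) (h12 : IndepFun R₁ R₂ P)
    (hη : ∀ x, Measurable (η x)) (hlaw : ∀ x, P.map (η x) = vertexMeasure M) (hind : iIndepFun η P)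
    (hR : IndepFun (fun w => (R₁ w, R₂ w)) (fun w x => η x w) P) :
    IsPoissonPointProcess P (fun w => matchingMap G L d M α (R₁ w, R₂ w, fun x => η x w))
      (pairIntensity G α L) := by
  have hX : Measurable fun w => matchingMap G L d M α (R₁ w, R₂ w, fun x => η x w) :=
    measurable_matchingMap.comp (h1.measurable.prodMk (h2.measurable.prodMk
      (measurable_pi_lambda _ hη)))
  refine isPoissonPointProcess_of_counts hX
    (fun z => mul_nonneg α.coe_nonneg (srwProb_nonneg _ _ _)) pairIntensity_singleton ?_
  have hC : Measurable fun q : (V → ℕ) × (V → ℕ) × (V → VertexNoise M) =>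
      matchCounts G L d M α q.1 q.2.1 q.2.2 := measurable_pi_lambda _ measurable_matchCounts
  have hXc : (fun w z => (matchingMap G L d M α (R₁ w, R₂ w, fun x => η x w)).counts z) =
      fun w => matchCounts G L d M α (R₁ w).counts (R₂ w).counts fun x => η x w := by
    ext w z
    exact counts_matchingMap _ z
  have hcm : Measurable fun w => matchCounts G L d M α (R₁ w).counts (R₂ w).counts
      fun x => η x w :=
    hC.comp (f := fun w => ((R₁ w).counts, (R₂ w).counts, fun x => η x w))
      ((measurable_counts_pi.comp h1.measurable).prodMk
        ((measurable_counts_pi.comp h2.measurable).prodMk (measurable_pi_lambda _ hη)))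
  rw [hXc]
  refine Measure.ext fun A hA => ?_
  rw [Measure.map_apply hcm hA, ← lintegral_indicator_one (hcm hA)]
  refine (lintegral_driving h1 h2 h12 hη hlaw hind hR (F := fun q => A.indicator 1
    (matchCounts G L d M α q.1 q.2.1 q.2.2)) ((measurable_one.indicator hA).comp hC)).trans ?_
  have hae : ∀ᵐ e ∂(Measure.infinitePi fun _ : V => labelMeasure M),
      ∫⁻ ζ, ∫⁻ r, A.indicator (1 : (V × V → ℕ) → ℝ≥0∞) (matchCounts G L d M α
        (fun x => (ζ x).1) r fun x => (e x, (ζ x).2)) ∂(poissonField fun _ : V => (α : ℝ))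
        ∂(Measure.infinitePi fun _ : V => (poissonMeasure α).prod (volume : Measure unitInterval))
      = poissonField (fun z : V × V => α * srwProb G L z.1 z.2) A := by
    filter_upwards [ae_injective_label (V := V) (M := M)] with e he
    have hm : Measurable fun q : (V → ℕ × unitInterval) × (V → ℕ) => matchCounts G L d M α
        (fun x => (q.1 x).1) q.2 fun x => (e x, (q.1 x).2) :=
      hC.comp (f := fun q : (V → ℕ × unitInterval) × (V → ℕ) => ((fun x => (q.1 x).1), q.2,
        fun x => (e x, (q.1 x).2))) (by fun_prop)
    rw [← map_matchCounts hd he, ← lintegral_indicator_one hA,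
      lintegral_map (measurable_one.indicator hA) hm, lintegral_prod
      (fun q : (V → ℕ × unitInterval) × (V → ℕ) => A.indicator (1 : (V × V → ℕ) → ℝ≥0∞)
        (matchCounts G L d M α (fun x => (q.1 x).1) q.2 fun x => (e x, (q.1 x).2)))
      ((measurable_one.indicator hA).comp hm).aemeasurable]
  rw [lintegral_congr_ae hae, lintegral_const, measure_univ, mul_one]

/-- The mean number of unmatched points. -/
lemma lintegral_sub_projSnd_le (htrans : IsVertexTransitive G)
    (hd : ∀ x, (srwSupport G L x).card = d + 1)
    (h1 : IsPoissonPointProcess P R₁ ((α : ℝ≥0∞) • Measure.count))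
    (h2 : IsPoissonPointProcess P R₂ ((α : ℝ≥0∞) • Measure.count)) (h12 : IndepFun R₁ R₂ P)
    (hη : ∀ x, Measurable (η x)) (hlaw : ∀ x, P.map (η x) = vertexMeasure M) (hind : iIndepFun η P)
    (hR : IndepFun (fun w => (R₁ w, R₂ w)) (fun w x => η x w) P) (o : V) {c : ℝ} (hc : 0 < c)
    (hvar : 2 * α * srwProb G (2 * L) o o ≤ c ^ 2) :
    ∫⁻ w, ((R₂ w).1 {o} - projSnd (matchingMap G L d M α (R₁ w, R₂ w, fun x => η x w)) {o}) ∂P ≤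
      ENNReal.ofReal (c / 2) + ENNReal.ofReal (α * ((d + 1) / (M + 1))) := by
  have hF : Measurable fun q : (V → ℕ) × (V → ℕ) × (V → VertexNoise M) =>
      ((q.2.1 o : ℕ) : ℝ≥0∞) - ∑' x, (matchCounts G L d M α q.1 q.2.1 q.2.2 (x, o) : ℝ≥0∞) := by
    refine Measurable.sub ?_ (Measurable.tsum fun x => ?_)
    · exact measurable_from_top.comp ((measurable_pi_apply o).comp
        (measurable_fst.comp measurable_snd))
    · exact measurable_from_top.comp (measurable_matchCounts (x, o))
  have hstart : ∀ w, (R₂ w).1 {o} -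
      projSnd (matchingMap G L d M α (R₁ w, R₂ w, fun x => η x w)) {o} =
      (((R₂ w).counts o : ℕ) : ℝ≥0∞) - ∑' x, (matchCounts G L d M α (R₁ w).counts (R₂ w).counts
        (fun x => η x w) (x, o) : ℝ≥0∞) := by
    intro w
    rw [projSnd_singleton, LocFinPointMeasure.coe_counts]
    simp_rw [counts_matchingMap]
  simp_rw [hstart]
  refine (lintegral_driving h1 h2 h12 hη hlaw hind hR hF).le.trans ?_
  calc _ ≤ ∫⁻ e, (ENNReal.ofReal (c / 2) + ENNReal.ofReal α *
        ENNReal.ofReal (1 - (srwEnv G L d M e).ownMass (srwData G L d) o))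
        ∂(Measure.infinitePi fun _ : V => labelMeasure M) := by
        refine lintegral_mono_ae ?_
        filter_upwards [ae_injective_label (V := V) (M := M)] with e he
        rw [← ENNReal.ofReal_mul α.coe_nonneg]
        exact lintegral_unmatched_le hd he htrans o hc hvar
    _ = ENNReal.ofReal (c / 2) + ENNReal.ofReal α *
        ∫⁻ e, ENNReal.ofReal (1 - (srwEnv G L d M e).ownMass (srwData G L d) o)
        ∂(Measure.infinitePi fun _ : V => labelMeasure M) := by
        rw [lintegral_add_left measurable_const, lintegral_const, measure_univ, mul_one,
          lintegral_const_mul' _ _ ENNReal.ofReal_ne_top]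
    _ ≤ _ := by
        rw [ENNReal.ofReal_mul α.coe_nonneg]
        gcongr
        exact lintegral_one_sub_ownMass_le htrans hd o

lemma lintegral_apply_of_ppp {S : Type*} [MeasurableSpace S] {X : Ω → LocFinPointMeasure S}
    {ν : Measure S} (h : IsPoissonPointProcess P X ν) {A : Set S} (hA : MeasurableSet A)
    (hν : ν A ≠ ∞) : ∫⁻ w, (X w).1 A ∂P = ν A := by
  have hm : Measurable fun w => (X w).1 A :=
    (Measure.measurable_coe hA).comp (measurable_subtype_coe.comp h.measurable)
  have h1 := lintegral_map (μ := P) (f := fun x : ℝ≥0∞ => x) measurable_id hm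
  rw [← h1, h.map_eq_poisson A hA hν, lintegral_map (f := fun x : ℝ≥0∞ => x) measurable_id
    measurable_from_top]
  refine (lintegral_natCast_poissonMeasure _).trans ?_
  exact ENNReal.coe_toNNReal hν

/-- Pointwise, (g - f)⁺ + f and (f - g)⁺ + g are both the maximum; equal finite means cancel. -/
lemma lintegral_sub_comm_of_eq {f g : Ω → ℝ≥0∞} (hf : Measurable f) (hg : Measurable g)
    (h : ∫⁻ w, f w ∂P = ∫⁻ w, g w ∂P) (hfin : ∫⁻ w, f w ∂P ≠ ∞) :
    ∫⁻ w, (g w - f w) ∂P = ∫⁻ w, (f w - g w) ∂P := by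
  have h1 : ∫⁻ w, (g w - f w) ∂P + ∫⁻ w, f w ∂P = ∫⁻ w, (f w - g w) ∂P + ∫⁻ w, g w ∂P := by
    rw [← lintegral_add_right _ hf, ← lintegral_add_right _ hg]
    refine lintegral_congr fun w => ?_
    rw [tsub_add_eq_max, tsub_add_eq_max, max_comm]
  rw [← h] at h1
  exact (ENNReal.add_left_inj hfin).1 h1

/-- By symmetry, summing transition probabilities over the starting point gives one, so the
displaced particles again have intensity α. -/
lemma pairIntensity_snd (htrans : IsVertexTransitive G) (o : V) :
    pairIntensity G α L (Prod.snd ⁻¹' {o}) = α := by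
  rw [← Measure.tsum_indicator_apply_singleton _ _ (measurable_snd (measurableSet_singleton o)),
    ENNReal.tsum_prod']
  have h1 : ∀ x : V, ∑' y, (Prod.snd ⁻¹' {o}).indicator
      (fun z => pairIntensity G α L {z}) (x, y) = α * srwLaw G o L x := by
    intro x
    rw [tsum_eq_single o fun y hy => by simp [hy]]
    rw [Set.indicator_of_mem (by simp), pairIntensity_singleton, ENNReal.ofReal_mul α.coe_nonneg,
      ofReal_srwProb, srwLaw_comm htrans]
    simp
  simp_rw [h1]
  rw [ENNReal.tsum_mul_left, PMF.tsum_coe, mul_one]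

end Coupling

end

/-! ### Choice of the number of labels and conclusion -/

theorem lemma6p1 {V : Type*} [Infinite V] [MeasurableSpace V] [DiscreteMeasurableSpace V]
    (G : SimpleGraph V) [G.LocallyFinite] (hconn : G.Connected) (htrans : IsVertexTransitive G)
    (α : ℝ≥0) (L : ℕ) :
    ∃ (Ω' : Type) (_ : MeasurableSpace Ω') (π : Measure Ω') (_ : IsProbabilityMeasure π)
      (Ψ : LocFinPointMeasure V × LocFinPointMeasure V × (V → Ω') → LocFinPointMeasure (V × V)),
      Measurable Ψ ∧
      (∀ (φ : G ≃g G) (ω₁ ω₂ : LocFinPointMeasure V) (η : V → Ω'),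
        Ψ (autActV φ ω₁, autActV φ ω₂, autActFamily φ η) = autActVV φ (Ψ (ω₁, ω₂, η))) ∧
      (∀ (ω₁ ω₂ : LocFinPointMeasure V) (η : V → Ω'), projFst (Ψ (ω₁, ω₂, η)) = ω₁.1) ∧
      ∀ (Ω : Type*) [MeasurableSpace Ω] (P : Measure Ω) [IsProbabilityMeasure P]
        (R₁ R₂ : Ω → LocFinPointMeasure V) (η : V → Ω → Ω'),
        IsPoissonPointProcess P R₁ ((α : ℝ≥0∞) • Measure.count) →
        IsPoissonPointProcess P R₂ ((α : ℝ≥0∞) • Measure.count) →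
        IndepFun R₁ R₂ P →
        (∀ x, Measurable (η x)) →
        (∀ x, P.map (η x) = π) →
        iIndepFun η P →
        IndepFun (fun w => (R₁ w, R₂ w)) (fun w x => η x w) P →
        IsPoissonPointProcess P (fun w => Ψ (R₁ w, R₂ w, fun x => η x w)) (pairIntensity G α L) ∧
        ∀ o : V,
          ∫⁻ w, ((R₂ w).1 {o} - projSnd (Ψ (R₁ w, R₂ w, fun x => η x w)) {o}) ∂P
              ≤ ENNReal.ofReal (√(2 * α * srwProb G (2 * L) o o)) ∧
          ∫⁻ w, (projSnd (Ψ (R₁ w, R₂ w, fun x => η x w)) {o} - (R₂ w).1 {o}) ∂P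
              ≤ ENNReal.ofReal (√(2 * α * srwProb G (2 * L) o o)) := by
  have := countable_of_connected G hconn
  obtain ⟨o₀⟩ := hconn.nonempty
  obtain ⟨d, hd₀⟩ : ∃ d, (srwSupport G L o₀).card = d + 1 :=
    ⟨_, (Nat.succ_pred (Finset.card_pos.2 (srwSupport_nonempty L o₀)).ne').symm⟩
  have hd : ∀ x, (srwSupport G L x).card = d + 1 := fun x =>
    (card_srwSupport htrans L x o₀).trans hd₀
  set c : ℝ := √(2 * α * srwProb G (2 * L) o₀ o₀) with hc
  -- The second-moment bound uses only half of the allowed error `c`; `M` is chosen so that the loss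
  -- from coinciding labels fits into the other half. For α = 0 there is no loss and any `M` will
  -- do.
  obtain ⟨M, hM⟩ : ∃ M : ℕ, (α : ℝ) * ((d + 1) / (M + 1)) ≤ c / 2 := by
    rcases eq_or_lt_of_le (α.coe_nonneg) with h0 | h0
    · exact ⟨0, by rw [← h0, zero_mul]; positivity⟩
    · have hcpos : 0 < c := Real.sqrt_pos.2 (mul_pos (by positivity)
        (srwProb_two_mul_pos htrans L o₀))
      obtain ⟨M, hM⟩ := exists_nat_gt ((α : ℝ) * (d + 1) / (c / 2))
      refine ⟨M, ?_⟩
      rw [div_lt_iff₀ (by positivity)] at hM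
      rw [← mul_div_assoc, div_le_iff₀ (by positivity)]
      nlinarith
  refine ⟨VertexNoise M, inferInstance, vertexMeasure M, inferInstance, matchingMap G L d M α,
    measurable_matchingMap, matchingMap_aut, projFst_matchingMap, ?_⟩
  intro Ω _ P _ R₁ R₂ η h1 h2 h12 hη hlaw hind hR
  have hppp := isPoissonPointProcess_matchingMap hd h1 h2 h12 hη hlaw hind hR
  refine ⟨hppp, fun o => ?_⟩
  have hco : √(2 * α * srwProb G (2 * L) o o) = c := by rw [hc, srwProb_diag htrans _ o o₀]
  rw [hco]
  have hS : MeasurableSet (Prod.snd ⁻¹' {o} : Set (V × V)) :=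
    measurable_snd (measurableSet_singleton o)
  have hsnd : ∀ ω : LocFinPointMeasure (V × V), projSnd ω {o} = ω.1 (Prod.snd ⁻¹' {o}) := fun ω =>
    Measure.map_apply measurable_snd (measurableSet_singleton o)
  have hI1 : ∫⁻ w, projSnd (matchingMap G L d M α (R₁ w, R₂ w, fun x => η x w)) {o} ∂P = α := by
    simp_rw [hsnd]
    rw [lintegral_apply_of_ppp hppp hS (by rw [pairIntensity_snd htrans]; simp),
      pairIntensity_snd htrans]
  have hI2 : ∫⁻ w, (R₂ w).1 {o} ∂P = α := by
    rw [lintegral_apply_of_ppp h2 (measurableSet_singleton o) (by simp)]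
    simp
  have hm1 : Measurable fun w =>
      projSnd (matchingMap G L d M α (R₁ w, R₂ w, fun x => η x w)) {o} := by
    simp_rw [hsnd]
    exact (Measure.measurable_coe hS).comp (measurable_subtype_coe.comp hppp.measurable)
  have hm2 : Measurable fun w => (R₂ w).1 {o} :=
    (Measure.measurable_coe (measurableSet_singleton o)).comp
      (measurable_subtype_coe.comp h2.measurable)
  have hbound : ∫⁻ w, ((R₂ w).1 {o} -
      projSnd (matchingMap G L d M α (R₁ w, R₂ w, fun x => η x w)) {o}) ∂P ≤ ENNReal.ofReal c := by
    -- For α = 0 the constant `c` vanishes and the second-moment bound, which divides by it, is not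
    -- available; but then `R₂` has mean zero.
    rcases eq_or_lt_of_le (α.coe_nonneg) with h0 | h0
    · refine (lintegral_mono fun w => tsub_le_self).trans ?_
      rw [hI2, NNReal.coe_eq_zero.1 h0.symm]
      simp
    · have hcpos : 0 < c := Real.sqrt_pos.2 (mul_pos (by positivity)
        (srwProb_two_mul_pos htrans L o₀))
      refine (lintegral_sub_projSnd_le htrans hd h1 h2 h12 hη hlaw hind hR o hcpos ?_).trans ?_
      · rw [srwProb_diag htrans _ o o₀, hc, Real.sq_sqrt]
        exact mul_nonneg (by positivity) (srwProb_nonneg _ _ _)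
      · rw [← ENNReal.ofReal_add (by positivity) (by positivity)]
        exact ENNReal.ofReal_le_ofReal (by linarith)
  refine ⟨hbound, ?_⟩
  -- Both processes have mean α at `o`, so the two positive parts have the same expectation.
  rw [lintegral_sub_comm_of_eq hm2 hm1 (hI2.trans hI1.symm) (by rw [hI2]; simp)]
  exact hbound
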